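/- **Conventions.** A vocabulary $\tau$ is a finite list of relation symbols $R$, each with an arity $\mathsf{ar}(R)\in\mathbb N$. A $\tau$-structure $\mathbf A$ consists of a nonempty finite universe $A=\{0,\dots,n-1\}$ and relations $R^{\mathbf A}\subseteq A^{\mathsf{ar}(R)}$ for $R\in\tau$; its size is $|\mathbf A|=|\tau|+|A|+\sum_{R\in\tau}|R^{\mathbf A}|\cdot\mathsf{ar}(R)$. For $\tau$-structures $\mathbf A,\mathbf B$, an embedding of $\mathbf A$ into $\mathbf B$ is an injective map $h\colon A\to B$ with $h(\bar a)\in R^{\mathbf B}$ for all $R\in\tau$ and $\bar a\in R^{\mathbf A}$. Structures are encoded as binary strings by listing, in self-delimiting form, $|A|$ in unary and, for every symbol in turn, its arity in unary and the tuples of its relation (in any order, without repetition), with elements written in binary; a pair is encoded by concatenation. A class $\mathcal A$ of structures (possibly of different vocabularies) is *decidable* if the set of codes of its members is decidable. It has *bounded arity* if there is $r\in\mathbb N$ such that all relation symbols in the vocabularies of its members have arity at most $r$. It has *bounded tree depth* if there is $w\in\mathbb N$ such that for every $\mathbf A\in\mathcal A$ the Gaifman graph of $\mathbf A$ (vertex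 set $A$; distinct elements are adjacent iff they occur together in some tuple of some relation of $\mathbf A$) has tree depth at most $w$. Here the tree depth of a graph is the least $h\in\mathbb N$ such that every connected component is isomorphic to a subgraph of the closure of some finite rooted tree of height at most $h$ (the height is the maximal distance from the root, and the closure joins distinct $t,t'$ whenever $t$ lies on the path from the root to $t'$). A parameterized problem $(Q,\kappa)$, that is, a set $Q\subseteq\{0,1\}^*$ with a logarithmic-space computable $\kappa\colon\{0,1\}^*\to\mathbb N$, is in *para-L* if $Q$ is decided by a deterministic Turing machine (read-only input tape, finitely many work tapes) that on input $x$ runs in space $O(f(\kappa(x))+\log|x|)$ for some computable $f\colon\mathbb N\to\mathbb N$. The problem $p\text{-}\mathrm{EMB}(\mathcal A)$ is $(Q,\kappa)$, where $Q$ is the set of codes of pairs $(\mathbf A,\mathbf B)$ of structures of the same vocabulary such that $\mathbf A\in\mathcal A$ and there is an embedding of $\mathbf A$ into $\mathbf B$, and $\kappa$ maps the code of a pair $(\mathbf A,\mathbf B)$ of structures to $|\mathbf A|$ and every other string to $0$. **Theorem.** Let $\mathcal A$ be a decidable class of structures of bounded arity and bounded tree depth. Then $p\text{-}\mathrm{EMB}(\mathcal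 A)\in\text{para-L}$ (in particular, its parameterization $\kappa$ is computable in logarithmic space). -/

import Mathlib

namespace ParaEmb

/-! ### Turing machines with a read-only input tape and several work tapes -/

/-- What the head on the input tape sees: the left end marker, an input bit or the right
end marker. -/
inductive InSym where
  | leftEnd : InSym
  | bit : Bool → InSym
  | rightEnd : InSym

/-- Head movements. -/
inductive Move where
  | left : Move
  | stay : Move
  | right : Move

/-- New position of a head on a one-sided infinite tape with cells `0, 1, 2, …`. A left move in
cell `0` has no effect. -/
def Move.apply : Move → ℕ → ℕ
  | .left, p => p - 1
  | .stay, p => p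
  | .right, p => p + 1

/-- The symbol in cell `p` of the input tape with input `x`: cell `0` holds the left end marker,
cells `1, …, |x|` hold `x`, and the right end marker follows. -/
def inputSym (x : List Bool) : ℕ → InSym
  | 0 => .leftEnd
  | p + 1 => match x[p]? with
    | some b => .bit b
    | none => .rightEnd

/-- The effect of one step of a machine: the new state, the movement of the input head, the symbol
written and the head movement on every work tape, and possibly one bit that is appended to the
write-only output tape. -/
structure Action (State Tape Sym : Type) where
  state : State
  inMove : Move
  write : Tape → Sym
  move : Tape → Move
  out : Option Bool

/-- A deterministic Turing machine with a read-only input tape, finitely many one-sided infinite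
work tapes (indexed by `Tape`) and a write-only output tape (ignored by machines that decide
problems). It halts when `trans` yields `none`. -/
structure Machine where
  State : Type
  Tape : Type
  Sym : Type
  finite_state : Finite State
  finite_tape : Finite Tape
  finite_sym : Finite Sym
  blank : Sym
  start : State
  accepting : State → Prop
  trans : State → InSym → (Tape → Sym) → Option (Action State Tape Sym)

namespace Machine

/-- Configurations of a machine. -/
structure Config (M : Machine) where
  state : M.State
  inHead : ℕ
  head : M.Tape → ℕ
  cell : M.Tape → ℕ → M.Sym
  out : List Bool

/-- The start configuration: empty work tapes, all heads in cell `0`. -/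
def init (M : Machine) : M.Config where
  state := M.start
  inHead := 0
  head := fun _ => 0
  cell := fun _ _ => M.blank
  out := []

/-- One computation step on input `x`; `none` in halting configurations. The input head never
leaves the cells `0, …, |x| + 1`. -/
def step (M : Machine) (x : List Bool) (c : M.Config) : Option M.Config :=
  (M.trans c.state (inputSym x c.inHead) (fun i => c.cell i (c.head i))).map fun a =>
    { state := a.state
      inHead := min (a.inMove.apply c.inHead) (x.length + 1)
      head := fun i => (a.move i).apply (c.head i)
      cell := fun i => Function.update (c.cell i) (c.head i) (a.write i)
      out := c.out ++ a.out.toList }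

/-- `c` is reached in the run of `M` on input `x`. -/
def Reaches (M : Machine) (x : List Bool) (c : M.Config) : Prop :=
  StateTransition.Reaches (M.step x) M.init c

/-- The run of `M` on input `x` halts in the configuration `c`. -/
def HaltsIn (M : Machine) (x : List Bool) (c : M.Config) : Prop :=
  M.Reaches x c ∧ M.step x c = none

/-- `M` decides the problem `Q`: it halts on every input, and accepts exactly those in `Q`. -/
def Decides (M : Machine) (Q : Set (List Bool)) : Prop :=
  ∀ x, ∃ c, M.HaltsIn x c ∧ (M.accepting c.state ↔ x ∈ Q)

/-- `M` computes the function `g`: on every input `x` it halts with `g x` on its output tape,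
in binary (least significant bit first, without leading zeros). -/
def Computes (M : Machine) (g : List Bool → ℕ) : Prop :=
  ∀ x, ∃ c, M.HaltsIn x c ∧ c.out = (g x).bits

/-- On every input `x`, the machine `M` only visits the first `s x` cells of each work tape. -/
def RunsInSpace (M : Machine) (s : List Bool → ℕ) : Prop :=
  ∀ x c, M.Reaches x c → ∀ i, c.head i < s x

end Machine

/-- `κ` is computable in logarithmic space. -/
def LogspaceComputable (κ : List Bool → ℕ) : Prop :=
  ∃ (M : Machine) (C : ℕ), M.Computes κ ∧
    M.RunsInSpace fun x => C * (Nat.log 2 x.length + 1)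

/-- `(Q, κ)` is a parameterized problem in para-L: `κ` is a parameterization, that is, computable
in logarithmic space, and `Q` is decided in space `O(f(κ(x)) + log |x|)` for some
computable `f`. -/
def InParaL (Q : Set (List Bool)) (κ : List Bool → ℕ) : Prop :=
  LogspaceComputable κ ∧
  ∃ (M : Machine) (f : ℕ → ℕ) (C : ℕ), Computable f ∧ M.Decides Q ∧
    M.RunsInSpace fun x => C * (f (κ x) + Nat.log 2 x.length)

/-! ### Finite relational structures -/

/-- A vocabulary: the list of the arities of its relation symbols, which are the indices
`i : Fin τ.length`. -/
abbrev Vocab := List ℕ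

/-- A finite structure over the vocabulary `τ` with the nonempty universe `Fin card`. -/
structure FinStr (τ : Vocab) where
  card : ℕ
  card_pos : 0 < card
  rel : (i : Fin τ.length) → Finset (Fin (τ.get i) → Fin card)

namespace FinStr

variable {τ : Vocab}

/-- The size `|τ| + |A| + ∑_R |R^A| · ar(R)`. -/
def size (A : FinStr τ) : ℕ :=
  τ.length + A.card + ∑ i, (A.rel i).card * τ.get i

/-- `h` is a homomorphism from `A` to `B`. -/
def IsHom (A B : FinStr τ) (h : Fin A.card → Fin B.card) : Prop :=
  ∀ i, ∀ t ∈ A.rel i, h ∘ t ∈ B.rel i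

/-- There is an embedding, i.e. an injective homomorphism, from `A` into `B`. -/
def Embeds (A B : FinStr τ) : Prop :=
  ∃ h : Fin A.card → Fin B.card, A.IsHom B h ∧ Function.Injective h

/-- The Gaifman graph: distinct elements are adjacent if they occur together in some tuple of some
relation. -/
def gaifman (A : FinStr τ) : SimpleGraph (Fin A.card) where
  Adj a b := a ≠ b ∧ ∃ i, ∃ t ∈ A.rel i, a ∈ Set.range t ∧ b ∈ Set.range t
  symm := ⟨fun _ _ h => ⟨h.1.symm, let ⟨i, t, ht, ha, hb⟩ := h.2; ⟨i, t, ht, hb, ha⟩⟩⟩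
  loopless := ⟨fun _ h => h.1 rfl⟩

end FinStr

/-! ### Tree depth -/

/-- The closure of the tree `T` with root `r`: vertices `t ≠ t'` are adjacent if one of them lies
on the simple path from the root to the other. -/
def rootedClosure {V : Type} (T : SimpleGraph V) (r : V) : SimpleGraph V :=
  SimpleGraph.fromRel fun t t' => ∃ p : T.Walk r t', p.IsPath ∧ t ∈ p.support

/-- Every connected component of `G` is (up to isomorphism) a subgraph of the closure of a finite
rooted tree of height at most `h`, the height being the maximal distance from the root. -/
def TreeDepthLE {V : Type} (G : SimpleGraph V) (h : ℕ) : Prop :=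
  ∀ C : G.ConnectedComponent, ∃ (W : Type) (_ : Finite W) (T : SimpleGraph W) (r : W),
    T.IsTree ∧ (∀ v, T.dist r v ≤ h) ∧ C.toSimpleGraph.IsContained (rootedClosure T r)

/-- The tree depth of a graph, the least `h` as above (a natural number for finite graphs). -/
noncomputable def treeDepth {V : Type} (G : SimpleGraph V) : ℕ∞ :=
  ⨅ (h : ℕ) (_ : TreeDepthLE G h), (h : ℕ∞)

/-! ### Binary encoding of structures -/

/-- Self-delimiting code of a list: each item is preceded by `1`, and a `0` ends the list. -/
def listCode {α : Type} (code : α → List Bool) (l : List α) : List Bool :=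
  l.flatMap (fun a => true :: code a) ++ [false]

/-- Self-delimiting unary code of a number. -/
def unaryCode (k : ℕ) : List Bool :=
  List.replicate k true ++ [false]

/-- Self-delimiting binary code of a number. -/
def binCode (k : ℕ) : List Bool :=
  listCode (fun b => [b]) k.bits

/-- The code of a tuple of elements: their binary codes one after the other. -/
def tupleCode {r n : ℕ} (t : Fin r → Fin n) : List Bool :=
  (List.ofFn t).flatMap fun a => binCode a

/-- The code of a structure with universe `Fin n` whose relations are listed by `L`: first `n` in
unary, then for every relation symbol its arity in unary and the list of its tuples. -/
def strCode (τ : Vocab) (n : ℕ) (L : (i : Fin τ.length) → List (Fin (τ.get i) → Fin n)) :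
    List Bool :=
  unaryCode n ++
    listCode (fun i => unaryCode (τ.get i) ++ listCode tupleCode (L i)) (List.finRange τ.length)

/-- `x` encodes the structure `A`. The tuples of a relation may be listed in any order, without
repetition. -/
def FinStr.Encodes {τ : Vocab} (A : FinStr τ) (x : List Bool) : Prop :=
  ∃ L : (i : Fin τ.length) → List (Fin (τ.get i) → Fin A.card),
    (∀ i, (L i).Nodup ∧ ∀ t, t ∈ L i ↔ t ∈ A.rel i) ∧ x = strCode τ A.card L

/-- `x` encodes the pair `(A, B)`. -/
def EncodesPair {τ σ : Vocab} (A : FinStr τ) (B : FinStr σ) (x : List Bool) : Prop :=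
  ∃ u v, A.Encodes u ∧ B.Encodes v ∧ x = u ++ v

/-! ### Classes of structures and the embedding problem -/

/-- A class of finite structures, of possibly different vocabularies. -/
abbrev StrClass := (τ : Vocab) → Set (FinStr τ)

/-- The class is decidable: so is the set of all codes of its members. -/
def StrClass.IsDecidable (𝒜 : StrClass) : Prop :=
  ComputablePred fun x : List Bool => ∃ (τ : Vocab) (A : FinStr τ), A ∈ 𝒜 τ ∧ A.Encodes x

/-- The arities of the relation symbols interpreted in members of the class are bounded. -/
def StrClass.BoundedArity (𝒜 : StrClass) : Prop :=
  ∃ r : ℕ, ∀ (τ : Vocab), ∀ A ∈ 𝒜 τ, ∀ i : Fin τ.length, τ.get i ≤ r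

/-- The tree depths of (the Gaifman graphs of) the members of the class are bounded. -/
def StrClass.BoundedTreeDepth (𝒜 : StrClass) : Prop :=
  ∃ w : ℕ, ∀ (τ : Vocab), ∀ A ∈ 𝒜 τ, treeDepth A.gaifman ≤ w

/-- The embedding problem of the class, as a set of binary strings: the codes of pairs `(A, B)` of
structures of the same vocabulary, `A` in the class, such that `A` embeds into `B`. -/
def embProblem (𝒜 : StrClass) : Set (List Bool) :=
  {x | ∃ (τ : Vocab) (A B : FinStr τ), A ∈ 𝒜 τ ∧ EncodesPair A B x ∧ A.Embeds B}

/-- The parameterization of the embedding problem: codes of pairs `(A, B)` of structures are mapped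
to `|A|` (which is determined by the code), all other strings to `0`, the infimum of the
empty set. -/
noncomputable def embParam (x : List Bool) : ℕ :=
  sInf {k | ∃ (τ σ : Vocab) (A : FinStr τ) (B : FinStr σ), EncodesPair A B x ∧ A.size = k}

/-! ### Unique decodability -/

theorem listCode_prefix {α β γ : Type} {c : α → List Bool} {c' : β → List Bool}
    (F : α → γ) (F' : β → γ)
    (h : ∀ a b u v, c a ++ u = c' b ++ v → F a = F' b ∧ u = v) :
    ∀ (l : List α) (l' : List β) (u v : List Bool), listCode c l ++ u = listCode c' l' ++ v →
      l.map F = l'.map F' ∧ u = v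
  | [], [], u, v, e => by simpa [listCode] using e
  | [], b :: l', u, v, e => by simp [listCode] at e
  | a :: l, [], u, v, e => by simp [listCode] at e
  | a :: l, b :: l', u, v, e => by
    have e' : c a ++ (listCode c l ++ u) = c' b ++ (listCode c' l' ++ v) := by
      simpa [listCode] using e
    obtain ⟨h1, h2⟩ := h _ _ _ _ e'
    obtain ⟨h3, h4⟩ := listCode_prefix F F' h l l' u v h2
    exact ⟨by simp [h1, h3], h4⟩

theorem unaryCode_prefix : ∀ (k k' : ℕ) (u v : List Bool),
    unaryCode k ++ u = unaryCode k' ++ v → k = k' ∧ u = v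
  | 0, 0, u, v, e => by simpa [unaryCode] using e
  | 0, k + 1, u, v, e => by simp [unaryCode, List.replicate_succ] at e
  | k + 1, 0, u, v, e => by simp [unaryCode, List.replicate_succ] at e
  | k + 1, k' + 1, u, v, e => by
    have e' : unaryCode k ++ u = unaryCode k' ++ v := by
      simpa [unaryCode, List.replicate_succ] using e
    obtain ⟨h1, h2⟩ := unaryCode_prefix k k' u v e'
    exact ⟨by rw [h1], h2⟩

theorem binCode_prefix (k k' : ℕ) (u v : List Bool)
    (e : binCode k ++ u = binCode k' ++ v) : k = k' ∧ u = v := by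
  obtain ⟨h, h'⟩ := listCode_prefix (c := fun b => [b]) (c' := fun b => [b]) id id
    (by intro a b u v h; simpa using h) _ _ _ _ e
  refine ⟨?_, h'⟩
  simp only [List.map_id] at h
  have := congrArg (fun l => Nat.ofDigits 2 (l.map fun b => cond b 1 0)) h
  simpa only [← Nat.digits_two_eq_bits, Nat.ofDigits_digits] using this

theorem tupleCode_prefix {r r' n n' : ℕ} (hr : r = r') (t : Fin r → Fin n) (t' : Fin r' → Fin n')
    (u v : List Bool) (e : tupleCode t ++ u = tupleCode t' ++ v) :
    (List.ofFn fun i => (t i : ℕ)) = (List.ofFn fun i => (t' i : ℕ)) ∧ u = v := by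
  subst hr
  induction r generalizing u v with
  | zero => simpa [tupleCode] using e
  | succ r ih =>
    have e' : binCode (t 0) ++ (tupleCode (fun i => t i.succ) ++ u) =
        binCode (t' 0) ++ (tupleCode (fun i => t' i.succ) ++ v) := by
      simpa [tupleCode] using e
    obtain ⟨h1, h2⟩ := binCode_prefix _ _ _ _ e'
    obtain ⟨h3, h4⟩ := ih _ _ _ _ h2
    exact ⟨by rw [List.ofFn_succ, List.ofFn_succ, h1, h3], h4⟩

theorem strCode_prefix (τ σ : Vocab) (n n' : ℕ) (L : (i : Fin τ.length) → List (Fin (τ.get i) → Fin n))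
    (L' : (i : Fin σ.length) → List (Fin (σ.get i) → Fin n')) (u v : List Bool)
    (e : strCode τ n L ++ u = strCode σ n' L' ++ v) :
    τ = σ ∧ n = n' ∧ HEq L L' ∧ u = v := by
  simp only [strCode, List.append_assoc] at e
  obtain ⟨rfl, e⟩ := unaryCode_prefix _ _ _ _ e
  obtain ⟨h, h'⟩ := listCode_prefix
    (F := fun i => (τ.get i, (L i).map fun t => List.ofFn fun j => (t j : ℕ)))
    (F' := fun i => (σ.get i, (L' i).map fun t => List.ofFn fun j => (t j : ℕ)))
    (by
      intro a b u v e
      simp only [List.append_assoc] at e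
      obtain ⟨h1, e⟩ := unaryCode_prefix _ _ _ _ e
      obtain ⟨h2, h3⟩ := listCode_prefix _ _ (fun t t' u v => tupleCode_prefix h1 t t' u v) _ _ _ _ e
      exact ⟨Prod.ext h1 h2, h3⟩) _ _ _ _ e
  have hτ : τ = σ := by
    have := congrArg (List.map Prod.fst) h
    simpa [List.map_map, Function.comp_def] using this
  subst hτ
  refine ⟨rfl, rfl, heq_of_eq ?_, h'⟩
  funext i
  have hi := (List.map_inj_left.1 h) i (List.mem_finRange i)
  refine List.map_injective_iff.2 ?_ (Prod.ext_iff.1 hi).2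
  intro t t' ht
  funext j
  have := congrFun (List.ofFn_injective ht) j
  exact Fin.ext this

theorem Encodes_inj {τ σ : Vocab} {A : FinStr τ} {B : FinStr σ} {x y u v} (hA : A.Encodes x)
   (hB : B.Encodes y) (e : x ++ u = y ++ v) : (⟨τ, A⟩ : Σ τ, FinStr τ) = ⟨σ, B⟩ ∧ u = v := by
  obtain ⟨L, hL, rfl⟩ := hA
  obtain ⟨L', hL', rfl⟩ := hB
  obtain ⟨rfl, h2, h3, rfl⟩ := strCode_prefix _ _ _ _ _ _ _ _ e
  obtain ⟨n, hn, R⟩ := A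
  obtain ⟨n', hn', R'⟩ := B
  simp only at h2
  subst h2
  cases h3
  have : R = R' := by
    funext i; ext t; rw [← (hL i).2, (hL' i).2]
  subst this
  simp

/-- The parameter of a pair is well defined. -/
theorem embParam_eq {τ σ : Vocab} {A : FinStr τ} {B : FinStr σ} {x} (h : EncodesPair A B x) :
    embParam x = A.size := by
  have : {k | ∃ (τ σ : Vocab) (A : FinStr τ) (B : FinStr σ), EncodesPair A B x ∧ A.size = k} = {A.size} := by
    ext k
    constructor
    · rintro ⟨τ', σ', A', B', ⟨u', v', hu', -, rfl⟩, rfl⟩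
      obtain ⟨u, v, hu, -, e⟩ := h
      cases (Encodes_inj hu hu' e.symm).1
      rfl
    · rintro rfl; exact ⟨_, _, _, _, h, rfl⟩
  rw [embParam, this, csInf_singleton]

end ParaEmb

namespace ParaEmb

/-! Bounded tree depth turns the search for a homomorphism into a formula of constant quantifier
depth. By `exists_forest` the universe of A carries a rooted forest of height bounded in terms of w,
with a virtual root `card`, such that the entries of every tuple lie on one root path: they form a
clique in the Gaifman graph, hence a chain of ancestors. A homomorphism can then be built from the
roots downwards, and sibling branches do not interact, since no tuple meets two of them.
`Extendable` expresses this: for every child a there is a value b that preserves the tuples on the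
current path and extends further down. Only the path is remembered, that is, boundedly many elements
of A and B, which fits into logarithmic space (`LSP.extendable`).

Injectivity is global and is lost in this recursion. Colour coding restores it. By `exists_hash`
some function v ↦ (q v mod p) mod (k² + 1) with p ≤ 2|B| is injective on the image of a given
embedding, where k is the number of elements of A. If each element of A may only take values with
its own colours, and no value of B is allowed for two elements, every map found by the recursion is
injective. The hash parameters p and q are numbers of logarithmic length. The forest and the
colouring are encoded by numbers bounded computably in the parameter. All of them are found by
exhaustive search (`HasWitness`). A witness is sound for every A (`Witness.embeds`); the tree depth
bound is needed only for completeness (`hasWitness_of_embeds`).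

Membership of A in the class depends on A alone. Bounded arity bounds the length of the code of A by
a computable function of |A| (`FinStr.Encodes.length_le`), so the answers for all codes up to that
length form the binary digits of one number that is computable from the parameter
(`computable_bitTable`, `inTable_iff`). `mem_embProblem_iff` combines these conditions.

The machine side is separated from this. Programs over counters with increment, decrement and zero
test are simulated with one binary counter per work tape, so that values at most N cost O(log N)
cells (`sim_run`). `LS` collects the functions computed by programs with values polynomial in a
size; such a program finds its arguments in fixed registers, assumes clean scratch registers, and
changes only its result register, so programs compose. The class is closed under bounded recursion
(`LS.rec`), hence under arithmetic, bounded quantifiers and parsing of codes. The size may contain a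
slack that the program does not see. A slack computable from the parameter pays for evaluating any
fixed computable function of the parameter (`slackLS_of_computable`), and `log_bound` turns a
polynomial in |x| + f(κ(x)) into the space bound of para-L. -/

/-! ### Flowcharts over binary counters -/

/-- Registers, position of the input head, and output of a counter machine. -/
@[ext] structure St where
  reg : ℕ → ℕ
  pos : ℕ
  out : List Bool

/-- Instructions of flowcharts with labels in `Q`. -/
inductive Instr (Q : Type) where
  | inc (r : ℕ) (q : Q)
  | dec (r : ℕ) (q q₀ : Q)
  | inp (f : InSym → Move × Q)
  | emit (b : Bool) (q : Q)
  | halt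

/-- The register used by an instruction. -/
def Instr.reg {Q : Type} : Instr Q → ℕ
  | .inc r _ => r
  | .dec r _ _ => r
  | _ => 0

/-- Set one register. -/
def St.set (s : St) (r v : ℕ) : St := { s with reg := Function.update s.reg r v }

/-- One step of a flowchart on input `x`, with register values at most `B`. -/
inductive FStep {Q : Type} (x : List Bool) (B : ℕ) (I : Q → Instr Q) : Q × St → Q × St → Prop
  | inc {q r q' s} : I q = .inc r q' → s.reg r < B → FStep x B I (q, s) (q', s.set r (s.reg r + 1))
  | dec {q r q' q₀ s n} : I q = .dec r q' q₀ → s.reg r = n + 1 →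
      FStep x B I (q, s) (q', s.set r n)
  | zero {q r q' q₀ s} : I q = .dec r q' q₀ → s.reg r = 0 → FStep x B I (q, s) (q₀, s)
  | inp {q f s} : I q = .inp f → FStep x B I (q, s) ((f (inputSym x s.pos)).2,
      { s with pos := min ((f (inputSym x s.pos)).1.apply s.pos) (x.length + 1) })
  | emit {q b q' s} : I q = .emit b q' → FStep x B I (q, s) (q', { s with out := s.out ++ [b] })

/-! ### Simulation of flowcharts by Turing machines -/

/-- Work tape symbols. -/
inductive Sym where
  | blank : Sym
  | mark : Sym
  | bit : Bool → Sym

/-- Phases of the simulation of an instruction. -/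
inductive Phase where
  | run : Phase
  | scan : Phase
  | ret : Bool → Phase

instance : Finite Sym :=
  Finite.of_surjective (fun o : Option (Option Bool) => match o with
    | none => Sym.blank
    | some none => Sym.mark
    | some (some b) => Sym.bit b) (by
    rintro (_ | _ | b)
    exacts [⟨none, rfl⟩, ⟨some none, rfl⟩, ⟨some (some b), rfl⟩])

instance : Finite Phase :=
  Finite.of_surjective (fun o : Option (Option Bool) => match o with
    | none => Phase.run
    | some none => Phase.scan
    | some (some b) => Phase.ret b) (by
    rintro (_ | _ | b)
    exacts [⟨none, rfl⟩, ⟨some none, rfl⟩, ⟨some (some b), rfl⟩])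

section Simulation

variable {Q : Type} (I : Q → Instr Q) (N : ℕ)

/-- The tape of a register. -/
def tapeIdx (r : ℕ) : Fin (N + 1) := Fin.ofNat (N + 1) r

/-- An action on the work tape `i` only. -/
def workAction (st : Option (Q × Phase)) (σ : Fin (N + 1) → Sym) (i : Fin (N + 1)) (a : Sym)
    (mv : Move) : Action (Option (Q × Phase)) (Fin (N + 1)) Sym where
  state := st
  inMove := .stay
  write := Function.update σ i a
  move := Function.update (fun _ => .stay) i mv
  out := none

/-- An action not using the work tapes. -/
def plainAction (st : Option (Q × Phase)) (σ : Fin (N + 1) → Sym) (mv : Move) (o : Option Bool) :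
    Action (Option (Q × Phase)) (Fin (N + 1)) Sym where
  state := st
  inMove := mv
  write := σ
  move := fun _ => .stay
  out := o

/-- The work of the simulating machine on tape `i`: `c` is the bit that the scan skips, `atEnd` the
action on a blank, given by a symbol and the flag of the return phase, `next` the label
reached at the end. -/
def counterTrans (i : Fin (N + 1)) (c : Bool) (atEnd : Sym × Bool) (next : Bool → Q) (q : Q)
    (ph : Phase) (σ : Fin (N + 1) → Sym) : Action (Option (Q × Phase)) (Fin (N + 1)) Sym :=
  match ph with
  | .run => plainAction N (some (q, .scan)) σ .stay none
  | .scan => match σ i with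
    | .bit b => if b = c then workAction N (some (q, .scan)) σ i (.bit b) .right
        else workAction N (some (q, .ret true)) σ i (.bit c) .left
    | .blank => workAction N (some (q, .ret atEnd.2)) σ i atEnd.1 .left
    | .mark => workAction N (some (q, .scan)) σ i .mark .right
  | .ret fl => match σ i with
    | .bit b => workAction N (some (q, .ret fl)) σ i (.bit (xor b fl)) .left
    | .blank => workAction N (some (q, .ret fl)) σ i .blank .left
    | .mark => workAction N (some (next fl, .run)) σ i .mark .right

/-- The transition function of the simulating machine, with first label `start`. -/
def simTrans (start : Q) : Option (Q × Phase) → InSym → (Fin (N + 1) → Sym) →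
    Option (Action (Option (Q × Phase)) (Fin (N + 1)) Sym)
  | none, _, _ => some
      { state := some (start, .run)
        inMove := .stay
        write := fun _ => .mark
        move := fun _ => .right
        out := none }
  | some (q, ph), a, σ => match I q with
    | .inc r q' => some (counterTrans N (tapeIdx N r) true (.bit true, true)
        (fun _ => q') q ph σ)
    | .dec r q' q₀ => some (counterTrans N (tapeIdx N r) false (.blank, false)
        (fun fl => if fl then q' else q₀) q ph σ)
    | .inp f => some (plainAction N (some ((f a).2, .run)) σ (f a).1 none)
    | .emit b q' => some (plainAction N (some (q', .run)) σ .stay (some b))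
    | .halt => none

/-- The simulating machine. -/
def simMachine [Finite Q] (start : Q) (acc : Q → Prop) : Machine where
  State := Option (Q × Phase)
  Tape := Fin (N + 1)
  Sym := Sym
  finite_state := inferInstance
  finite_tape := inferInstance
  finite_sym := inferInstance
  blank := .blank
  start := none
  accepting := fun st => ∃ q ph, st = some (q, ph) ∧ acc q
  trans := simTrans I N start

/-- The tape holding the binary digits `l`. -/
def tapeOf (l : List Bool) : ℕ → Sym
  | 0 => .mark
  | j + 1 => match l[j]? with
    | some b => .bit b
    | none => .blank

/-! ### Binary counters on a tape. -/

/-- The number with binary digits `l`, least significant first. -/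
def bitsVal : List Bool → ℕ
  | [] => 0
  | b :: l => b.toNat + 2 * bitsVal l

theorem tapeOf_append_cons (pre rest : List Bool) (b : Bool) :
    tapeOf (pre ++ b :: rest) (pre.length + 1) = .bit b := by
  simp [tapeOf]

theorem tapeOf_length (l : List Bool) : tapeOf l (l.length + 1) = .blank := by
  simp [tapeOf]

theorem update_tapeOf (pre rest : List Bool) (b c : Bool) :
    Function.update (tapeOf (pre ++ b :: rest)) (pre.length + 1) (.bit c) =
      tapeOf (pre ++ c :: rest) := by
  funext j
  rcases j with _ | j
  · simp [Function.update, tapeOf]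
  · rcases lt_trichotomy j pre.length with h | h | h
    · simp [Function.update, tapeOf, h.ne, List.getElem?_append_left h]
    · subst h; simp [tapeOf]
    · have : j - pre.length = (j - pre.length - 1) + 1 := by omega
      simp only [Function.update, Nat.add_right_cancel_iff, h.ne', tapeOf, eq_rec_constant,
        dite_eq_ite, if_false, List.getElem?_append_right h.le]
      rw [this]; simp

theorem update_tapeOf_end (l : List Bool) (c : Bool) :
    Function.update (tapeOf l) (l.length + 1) (.bit c) = tapeOf (l ++ [c]) := by
  funext j
  rcases j with _ | j
  · simp [Function.update, tapeOf]
  · rcases lt_trichotomy j l.length with h | h | h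
    · simp [Function.update, tapeOf, h.ne, List.getElem?_append_left h]
    · subst h; simp [tapeOf]
    · have h2 : l.length + 1 ≤ j := h
      simp [Function.update, tapeOf, h.ne', h.le, List.getElem?_eq_none, h2]

theorem bitsVal_inc (j : ℕ) (rest : List Bool) :
    bitsVal (List.replicate j false ++ true :: rest) =
      bitsVal (List.replicate j true ++ false :: rest) + 1 := by
  induction j with
  | zero => simp [bitsVal]; omega
  | succ j ih => simp [List.replicate_succ, bitsVal, ih]; omega

theorem bitsVal_inc_end (j : ℕ) :
    bitsVal (List.replicate j false ++ [true]) = bitsVal (List.replicate j true) + 1 := by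
  induction j with
  | zero => simp [bitsVal]
  | succ j ih => simp [List.replicate_succ, bitsVal, ih]; omega

/-- A counter gets a new digit only when all its digits are 1. This value then bounds the length of
the tape by the logarithm of the register bound, even though leading zeros are never removed. -/
theorem bitsVal_replicate_true (j : ℕ) : bitsVal (List.replicate j true) + 1 = 2 ^ j := by
  induction j with
  | zero => simp [bitsVal]
  | succ j ih => simp [List.replicate_succ, bitsVal, pow_succ]; omega

theorem bitsVal_replicate_false (j : ℕ) : bitsVal (List.replicate j false) = 0 := by
  induction j with
  | zero => simp [bitsVal]
  | succ j ih => simp [List.replicate_succ, bitsVal, ih]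

theorem bitsVal_pos (j : ℕ) (rest : List Bool) :
    0 < bitsVal (List.replicate j false ++ true :: rest) := by
  induction j with
  | zero => simp [bitsVal]
  | succ j ih => simpa [List.replicate_succ, bitsVal] using ih

/-- A carry (c = 1) or a borrow (c = 0) propagates through the initial run of c and stops at the
first other digit, if there is one. -/
theorem exists_eq_replicate_append (c : Bool) (l : List Bool) :
    ∃ j, l = List.replicate j c ∨ ∃ rest, l = List.replicate j c ++ (!c) :: rest := by
  induction l with
  | nil => exact ⟨0, .inl rfl⟩
  | cons b l ih =>
    by_cases hb : b = c
    · obtain ⟨j, rfl | ⟨rest, rfl⟩⟩ := ih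
      · exact ⟨j + 1, .inl (by simp [List.replicate_succ, hb])⟩
      · exact ⟨j + 1, .inr ⟨rest, by simp [List.replicate_succ, hb]⟩⟩
    · exact ⟨0, .inr ⟨l, by simp [Bool.eq_not_of_ne hb]⟩⟩

/-- `d` is reached from `c`, all intermediate configurations after `c` being `Good`. -/
def GoodPath {σ : Type} (f : σ → Option σ) (Good : σ → Prop) : σ → σ → Prop :=
  Relation.ReflTransGen fun c d => f c = some d ∧ Good d

/-- The run is deterministic and ends in `d`, so everything reachable lies on the given path. One
explicit halting run therefore bounds the space of all reachable configurations. -/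
theorem GoodPath.good_of_reaches {σ : Type} {f : σ → Option σ} {Good : σ → Prop} {c d e : σ}
    (h : GoodPath f Good c d) (hc : Good c) (hd : f d = none)
    (he : StateTransition.Reaches f c e) : Good e := by
  induction h using Relation.ReflTransGen.head_induction_on with
  | refl =>
    rcases Relation.ReflTransGen.cases_head he with rfl | ⟨e', h, -⟩
    · exact hc
    · simp [hd] at h
  | head h _ ih =>
    rcases Relation.ReflTransGen.cases_head he with rfl | ⟨e', h', h''⟩
    · exact hc
    · have h' : f _ = some e' := h'
      rw [h.1] at h'
      cases h'
      exact ih h.2 h''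

theorem GoodPath.reaches {σ : Type} {f : σ → Option σ} {Good : σ → Prop} {c d : σ}
    (h : GoodPath f Good c d) : StateTransition.Reaches f c d :=
  Relation.ReflTransGen.mono (fun _ _ h => h.1) _ _ h

variable [Finite Q] (start : Q) (acc : Q → Prop)

/-- A configuration of the simulating machine. -/
def simCfg (st : Option (Q × Phase)) (p : ℕ) (ls : Fin (N + 1) → List Bool) (i : Fin (N + 1))
    (j : ℕ) (o : List Bool) : (simMachine I N start acc).Config where
  state := st
  inHead := p
  head := (Function.update (fun _ => 1) i j : Fin (N + 1) → ℕ)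
  cell := fun i => tapeOf (ls i)
  out := o

variable {I N start acc}

theorem val_tapeIdx {r : ℕ} (h : r ≤ N) : (tapeIdx N r : ℕ) = r := by
  simp [tapeIdx]; omega

theorem tapeIdx_val (i : Fin (N + 1)) : tapeIdx N i = i := by
  ext; simp [tapeIdx]

/-- Between instructions every head rests in cell 1, just after the mark, so no tape is singled out
and the next instruction may choose its own. -/
theorem simCfg_one (st : Option (Q × Phase)) (p : ℕ) (ls : Fin (N + 1) → List Bool)
    (i i' : Fin (N + 1)) (o : List Bool) :
    simCfg I N start acc st p ls i 1 o = simCfg I N start acc st p ls i' 1 o := by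
  simp [simCfg]

/-- The effect of an action on one work tape. -/
theorem step_workAction {x : List Bool} {q : Q} {ph : Phase} {p : ℕ}
    {ls : Fin (N + 1) → List Bool} {i : Fin (N + 1)} {j : ℕ} {o : List Bool}
    (hp : p ≤ x.length + 1) {st : Option (Q × Phase)} {a : Sym} {mv : Move} {l' : List Bool}
    (h : simTrans I N start (some (q, ph)) (inputSym x p)
      (fun k => tapeOf (ls k) (Function.update (fun _ => 1) i j k)) =
      some (workAction N st (fun k => tapeOf (ls k) (Function.update (fun _ => 1) i j k)) i a mv))
    (hl : Function.update (tapeOf (ls i)) j a = tapeOf l') :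
    (simMachine I N start acc).step x (simCfg I N start acc (some (q, ph)) p ls i j o) =
      some (simCfg I N start acc st p (Function.update ls i l') i (mv.apply j) o) := by
  have h' : (simMachine I N start acc).trans (some (q, ph)) (inputSym x p)
      (fun k => tapeOf (ls k) (Function.update (fun _ => 1) i j k)) = _ := h
  simp only [Machine.step, simCfg]
  rw [h']
  refine congrArg some (?_ : Machine.Config.mk _ _ _ _ _ = Machine.Config.mk _ _ _ _ _)
  simp only [workAction]
  congr 1
  · simpa [Move.apply] using hp
  · refine funext fun (k : Fin (N + 1)) => ?_
    by_cases hk : k = i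
    · subst hk; simp
    · simp [hk, Move.apply]
  · refine funext fun (k : Fin (N + 1)) => ?_
    by_cases hk : k = i
    · subst hk; simp only [Function.update_self]; exact hl
    · simp only [ne_eq, hk, not_false_eq_true, Function.update_of_ne]
      exact Function.update_eq_self _ _
  · simp

theorem step_plainAction {x : List Bool} {q : Q} {ph : Phase} {p : ℕ}
    {ls : Fin (N + 1) → List Bool} {i : Fin (N + 1)} {j : ℕ} {o : List Bool}
    {st : Option (Q × Phase)} {mv : Move} {b : Option Bool}
    (h : simTrans I N start (some (q, ph)) (inputSym x p)
      (fun k => tapeOf (ls k) (Function.update (fun _ => 1) i j k)) =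
      some (plainAction N st (fun k => tapeOf (ls k) (Function.update (fun _ => 1) i j k)) mv b)) :
    (simMachine I N start acc).step x (simCfg I N start acc (some (q, ph)) p ls i j o) =
      some (simCfg I N start acc st (min (mv.apply p) (x.length + 1)) ls i j (o ++ b.toList)) := by
  have h' : (simMachine I N start acc).trans (some (q, ph)) (inputSym x p)
      (fun k => tapeOf (ls k) (Function.update (fun _ => 1) i j k)) = _ := h
  simp only [Machine.step, simCfg]
  rw [h']
  refine congrArg some (?_ : Machine.Config.mk _ _ _ _ _ = Machine.Config.mk _ _ _ _ _)
  simp only [plainAction]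
  congr 1
  funext k
  exact Function.update_eq_self _ _

/-- No head is beyond the first `S` cells. -/
def HeadsBelow (S : ℕ) (c : (simMachine I N start acc).Config) : Prop := ∀ i, c.head i < S

theorem headsBelow_simCfg {S : ℕ} {st : Option (Q × Phase)} {p : ℕ}
    {ls : Fin (N + 1) → List Bool} {i : Fin (N + 1)} {j : ℕ} {o : List Bool} (h1 : 1 < S)
    (hj : j < S) : HeadsBelow S (simCfg I N start acc st p ls i j o) := by
  intro (k : Fin (N + 1))
  change (Function.update (fun _ => 1) i j : Fin (N + 1) → ℕ) k < S
  by_cases hk : k = i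
  · subst hk; simpa using hj
  · simpa [hk] using h1

/-! ### One increment or decrement of a counter. -/

section Counter

variable {x : List Bool} {q : Q} {p : ℕ} {i : Fin (N + 1)} {o : List Bool} {S : ℕ} {c : Bool}
  {atEnd : Sym × Bool} {next : Bool → Q}

theorem scan_path
    (hq : ∀ ph a σ, simTrans I N start (some (q, ph)) a σ =
      some (counterTrans N i c atEnd next q ph σ))
    (hp : p ≤ x.length + 1) {ls : Fin (N + 1) → List Bool} {j : ℕ} {rest : List Bool}
    (hl : ls i = List.replicate j c ++ rest) (h1 : 1 < S) (hj : j + 1 < S) :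
    GoodPath ((simMachine I N start acc).step x) (HeadsBelow S)
      (simCfg I N start acc (some (q, .run)) p ls i 1 o)
      (simCfg I N start acc (some (q, .scan)) p ls i (j + 1) o) := by
  induction j generalizing rest with
  | zero =>
    refine .single ⟨?_, headsBelow_simCfg h1 hj⟩
    rw [step_plainAction (st := some (q, .scan)) (mv := .stay) (b := none)]
    · simp [Move.apply, hp]
    · rw [hq]; rfl
  | succ j ih =>
    refine .tail (ih (rest := c :: rest) (by
      rw [hl, List.replicate_succ', List.append_assoc]; rfl) (by omega)) ⟨?_, headsBelow_simCfg h1 hj⟩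
    have hl' : ls i = List.replicate j c ++ c :: rest := by
      rw [hl, List.replicate_succ', List.append_assoc]; rfl
    have hj' : (List.replicate j c).length = j := by simp
    have ht : tapeOf (ls i) (j + 1) = .bit c := by
      have := tapeOf_append_cons (List.replicate j c) rest c
      rwa [hj', ← hl'] at this
    rw [step_workAction hp (st := some (q, .scan)) (a := .bit c) (mv := .right) (l' := ls i)]
    · simp [Move.apply]
    · rw [hq]; simp [counterTrans, ht]
    · rw [← ht, Function.update_eq_self]

/-- The way back to the mark does the arithmetic: with flag `true` it flips the run of skipped
digits, with flag `false` it leaves them alone. -/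
theorem ret_path
    (hq : ∀ ph a σ, simTrans I N start (some (q, ph)) a σ =
      some (counterTrans N i c atEnd next q ph σ))
    (hp : p ≤ x.length + 1) {fl : Bool} {ls : Fin (N + 1) → List Bool} {j : ℕ} {rest : List Bool}
    (hl : ls i = List.replicate j c ++ rest) (h1 : 1 < S) (hj : j < S) :
    GoodPath ((simMachine I N start acc).step x) (HeadsBelow S)
      (simCfg I N start acc (some (q, .ret fl)) p ls i j o)
      (simCfg I N start acc (some (next fl, .run)) p
        (Function.update ls i (List.replicate j (xor c fl) ++ rest)) i 1 o) := by
  induction j generalizing rest ls with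
  | zero =>
    refine .single ⟨?_, headsBelow_simCfg h1 h1⟩
    have ht : tapeOf (ls i) 0 = .mark := rfl
    rw [step_workAction hp (st := some (next fl, .run)) (a := .mark) (mv := .right) (l' := ls i)]
    · simp [Move.apply, hl]
    · rw [hq]; simp [counterTrans, ht]
    · rw [← ht, Function.update_eq_self]
  | succ j ih =>
    have hl' : ls i = List.replicate j c ++ c :: rest := by
      rw [hl, List.replicate_succ', List.append_assoc]; rfl
    have hj' : (List.replicate j c).length = j := by simp
    have ht : tapeOf (ls i) (j + 1) = .bit c := by
      have := tapeOf_append_cons (List.replicate j c) rest c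
      rwa [hj', ← hl'] at this
    have ih' := ih (ls := Function.update ls i (List.replicate j c ++ (xor c fl) :: rest))
      (rest := (xor c fl) :: rest) (by simp) (by omega)
    refine .head (b := simCfg I N start acc (some (q, .ret fl)) p
        (Function.update ls i (List.replicate j c ++ (xor c fl) :: rest)) i j o)
      ⟨?_, headsBelow_simCfg h1 (by omega)⟩ (?_ : GoodPath _ _ _ _)
    · rw [step_workAction hp (st := some (q, .ret fl)) (a := .bit (xor c fl)) (mv := .left)
        (l' := List.replicate j c ++ (xor c fl) :: rest)]
      · simp [Move.apply]
      · rw [hq]; simp [counterTrans, ht]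
      · have := update_tapeOf (List.replicate j c) rest c (xor c fl)
        rwa [hj', ← hl'] at this
    · have e : List.replicate (j + 1) (xor c fl) ++ rest =
          List.replicate j (xor c fl) ++ (xor c fl) :: rest := by
        rw [List.replicate_succ', List.append_assoc]; rfl
      rw [e]
      simpa using ih'

/-- The scan stopped at a digit other than c, which becomes c, while the run before it is flipped on
the way back. For c = 1 this adds 1, for c = 0 it subtracts 1. -/
theorem found_path
    (hq : ∀ ph a σ, simTrans I N start (some (q, ph)) a σ =
      some (counterTrans N i c atEnd next q ph σ))
    (hp : p ≤ x.length + 1) {ls : Fin (N + 1) → List Bool} {j : ℕ} {rest : List Bool}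
    (hl : ls i = List.replicate j c ++ (!c) :: rest) (h1 : 1 < S) (hj : j + 1 < S) :
    GoodPath ((simMachine I N start acc).step x) (HeadsBelow S)
      (simCfg I N start acc (some (q, .run)) p ls i 1 o)
      (simCfg I N start acc (some (next true, .run)) p
        (Function.update ls i (List.replicate j (!c) ++ c :: rest)) i 1 o) := by
  have hj' : (List.replicate j c).length = j := by simp
  have ht : tapeOf (ls i) (j + 1) = .bit (!c) := by
    have := tapeOf_append_cons (List.replicate j c) rest (!c)
    rwa [hj', ← hl] at this
  refine (scan_path hq hp hl h1 hj).trans (.head (b := simCfg I N start acc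
    (some (q, .ret true)) p (Function.update ls i (List.replicate j c ++ c :: rest)) i j o)
    ⟨?_, headsBelow_simCfg h1 (by omega)⟩ (?_ : GoodPath _ _ _ _))
  · rw [step_workAction hp (st := some (q, .ret true)) (a := .bit c) (mv := .left)
        (l' := List.replicate j c ++ c :: rest)]
    · simp [Move.apply]
    · rw [hq]; simp [counterTrans, ht]
    · have := update_tapeOf (List.replicate j c) rest (!c) c
      rwa [hj', ← hl] at this
  · have := ret_path (S := S) (o := o) (fl := true) (acc := acc) hq hp
      (ls := Function.update ls i (List.replicate j c ++ c :: rest)) (j := j) (rest := c :: rest)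
      (by simp) h1 (by omega)
    simpa using this

/-- The scan met a blank, so all digits are c. An increment then lengthens the number by a digit; a
decrement has found the value 0, restores the tape, and reports this by the flag. -/
theorem end_path
    (hq : ∀ ph a σ, simTrans I N start (some (q, ph)) a σ =
      some (counterTrans N i c atEnd next q ph σ))
    (hp : p ≤ x.length + 1) {ls : Fin (N + 1) → List Bool} {j : ℕ} {rest : List Bool}
    (hl : ls i = List.replicate j c)
    (hr : Function.update (tapeOf (ls i)) (j + 1) atEnd.1 = tapeOf (List.replicate j c ++ rest))
    (h1 : 1 < S) (hj : j + 1 < S) :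
    GoodPath ((simMachine I N start acc).step x) (HeadsBelow S)
      (simCfg I N start acc (some (q, .run)) p ls i 1 o)
      (simCfg I N start acc (some (next atEnd.2, .run)) p
        (Function.update ls i (List.replicate j (xor c atEnd.2) ++ rest)) i 1 o) := by
  have hj' : (List.replicate j c).length = j := by simp
  have ht : tapeOf (ls i) (j + 1) = .blank := by
    have := tapeOf_length (List.replicate j c)
    rwa [hj', ← hl] at this
  refine (scan_path hq hp (rest := []) (by simpa using hl) h1 hj).trans
    (.head (b := simCfg I N start acc (some (q, .ret atEnd.2)) p
        (Function.update ls i (List.replicate j c ++ rest)) i j o)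
      ⟨?_, headsBelow_simCfg h1 (by omega)⟩ (?_ : GoodPath _ _ _ _))
  · rw [step_workAction hp (st := some (q, .ret atEnd.2)) (a := atEnd.1) (mv := .left)
        (l' := List.replicate j c ++ rest)]
    · simp [Move.apply]
    · rw [hq]; simp [counterTrans, ht]
    · exact hr
  · have := ret_path (S := S) (o := o) (fl := atEnd.2) (acc := acc) hq hp
      (ls := Function.update ls i (List.replicate j c ++ rest)) (j := j) (rest := rest)
      (by simp) h1 (by omega)
    simpa using this

end Counter

/-- The configuration `c` represents the state `s` of the flowchart at label `q`. -/
def SimRel (x : List Bool) (B : ℕ) (c : (simMachine I N start acc).Config) (qs : Q × St) : Prop :=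
  ∃ ls, c = simCfg I N start acc (some (qs.1, .run)) qs.2.pos ls 0 1 qs.2.out ∧
    qs.2.pos ≤ x.length + 1 ∧
    ∀ i : Fin (N + 1), bitsVal (ls i) = qs.2.reg i ∧ (ls i).length ≤ Nat.log 2 B + 1

theorem simRel_update {x : List Bool} {B : ℕ} {s : St} {ls : Fin (N + 1) → List Bool} {q : Q}
    {r v : ℕ} {l : List Bool}
    (hp : s.pos ≤ x.length + 1)
    (hls : ∀ i : Fin (N + 1), bitsVal (ls i) = s.reg i ∧ (ls i).length ≤ Nat.log 2 B + 1)
    (hr : r ≤ N) (hv : bitsVal l = v) (hl : l.length ≤ Nat.log 2 B + 1) :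
    SimRel x B (simCfg I N start acc (some (q, .run)) s.pos
      (Function.update ls (tapeIdx N r) l) (tapeIdx N r) 1 s.out)
      (q, s.set r v) := by
  refine ⟨_, simCfg_one _ _ _ _ _ _, hp, fun i => ?_⟩
  by_cases hi : i = tapeIdx N r
  · have : (i : ℕ) = r := by rw [hi, val_tapeIdx hr]
    simp [St.set, ← hi, this, hv, hl]
  · have : (i : ℕ) ≠ r := by
      rintro rfl; exact hi (tapeIdx_val i).symm
    simp [St.set, hi, this, hls]

theorem simRel_same {x : List Bool} {B : ℕ} {s : St} {ls : Fin (N + 1) → List Bool} {q : Q}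
    {r : ℕ} {l : List Bool}
    (hp : s.pos ≤ x.length + 1)
    (hls : ∀ i : Fin (N + 1), bitsVal (ls i) = s.reg i ∧ (ls i).length ≤ Nat.log 2 B + 1)
    (hr : ls (tapeIdx N r) = l) :
    SimRel x B (simCfg I N start acc (some (q, .run)) s.pos
      (Function.update ls (tapeIdx N r) l) (tapeIdx N r) 1 s.out)
      (q, s) := by
  rw [← hr, Function.update_eq_self]
  exact ⟨_, simCfg_one _ _ _ _ _ _, hp, hls⟩

theorem sim_step {x : List Bool} {B S : ℕ} (hS : Nat.log 2 B + 2 < S) (hN : ∀ q, (I q).reg ≤ N)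
    {c : (simMachine I N start acc).Config} {qs qs' : Q × St} (hc : SimRel x B c qs)
    (h : FStep x B I qs qs') :
    ∃ c', GoodPath ((simMachine I N start acc).step x) (HeadsBelow S) c c' ∧ SimRel x B c' qs' := by
  obtain ⟨ls, rfl, hp, hls⟩ := hc
  have h1 : 1 < S := by omega
  cases h with
  | @inc q r q' s hq hB =>
    dsimp only at hp hls ⊢
    have hr : r ≤ N := by simpa [hq, Instr.reg] using hN q
    have hq' : ∀ ph a σ, simTrans I N start (some (q, ph)) a σ =
        some (counterTrans N (tapeIdx N r) true (.bit true, true) (fun _ => q') q ph σ) := by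
      intro ph a σ; simp [simTrans, hq]
    have hlen := (hls (tapeIdx N r)).2
    have hval := (hls (tapeIdx N r)).1
    have hrr : (tapeIdx N r : ℕ) = r := val_tapeIdx hr
    rw [hrr] at hval
    rw [simCfg_one _ _ _ 0 (tapeIdx N r)]
    obtain ⟨j, hj | ⟨rest, hj⟩⟩ := exists_eq_replicate_append true (ls (tapeIdx N r))
    · have hjl : (ls (tapeIdx N r)).length = j := by simp [hj]
      -- Here all j digits are 1, so the old value is 2 ^ j - 1 and is below B; the new length j + 1
      -- respects the invariant.
      have hjB : j ≤ Nat.log 2 B := by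
        have := bitsVal_replicate_true j
        rw [← hj, hval] at this
        exact Nat.le_log_of_pow_le (by norm_num) (by omega)
      refine ⟨_, end_path hq' hp (rest := [true]) hj ?_ h1 (by omega), ?_⟩
      · have := update_tapeOf_end (ls (tapeIdx N r)) true
        rw [hjl, hj] at this
        rw [hj]; exact this
      · refine simRel_update hp hls hr ?_ ?_
        · have := bitsVal_inc_end j
          rw [← hj, hval] at this
          simpa using this
        · simp; omega
    · have hjl : (ls (tapeIdx N r)).length = j + (rest.length + 1) := by simp [hj]
      refine ⟨_, found_path hq' hp hj h1 (by omega), ?_⟩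
      refine simRel_update hp hls hr ?_ ?_
      · have := bitsVal_inc j rest
        rw [show false = !true from rfl, ← hj, hval] at this
        simpa using this
      · simp; omega
  | @dec q r q' q₀ s n hq hn =>
    dsimp only at hp hls ⊢
    have hr : r ≤ N := by simpa [hq, Instr.reg] using hN q
    have hq' : ∀ ph a σ, simTrans I N start (some (q, ph)) a σ =
        some (counterTrans N (tapeIdx N r) false (.blank, false)
          (fun fl => if fl then q' else q₀) q ph σ) := by
      intro ph a σ; simp [simTrans, hq]
    have hlen := (hls (tapeIdx N r)).2
    have hval := (hls (tapeIdx N r)).1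
    have hrr : (tapeIdx N r : ℕ) = r := val_tapeIdx hr
    rw [hrr] at hval
    rw [simCfg_one _ _ _ 0 (tapeIdx N r)]
    obtain ⟨j, hj | ⟨rest, hj⟩⟩ := exists_eq_replicate_append false (ls (tapeIdx N r))
    · have := bitsVal_replicate_false j
      rw [← hj, hval] at this
      omega
    · have hjl : (ls (tapeIdx N r)).length = j + (rest.length + 1) := by simp [hj]
      have := found_path (acc := acc) (o := s.out) hq' hp hj h1 (by omega)
      refine ⟨_, this, ?_⟩
      refine simRel_update hp hls hr ?_ ?_
      · have := bitsVal_inc j rest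
        rw [show true = !false from rfl, ← hj, hval] at this
        simp at this ⊢
        omega
      · simp; omega
  | @zero q r q' q₀ s hq hn =>
    dsimp only at hp hls ⊢
    have hr : r ≤ N := by simpa [hq, Instr.reg] using hN q
    have hq' : ∀ ph a σ, simTrans I N start (some (q, ph)) a σ =
        some (counterTrans N (tapeIdx N r) false (.blank, false)
          (fun fl => if fl then q' else q₀) q ph σ) := by
      intro ph a σ; simp [simTrans, hq]
    have hlen := (hls (tapeIdx N r)).2
    have hval := (hls (tapeIdx N r)).1
    have hrr : (tapeIdx N r : ℕ) = r := val_tapeIdx hr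
    rw [hrr] at hval
    rw [simCfg_one _ _ _ 0 (tapeIdx N r)]
    obtain ⟨j, hj | ⟨rest, hj⟩⟩ := exists_eq_replicate_append false (ls (tapeIdx N r))
    · have hjl : (ls (tapeIdx N r)).length = j := by simp [hj]
      have := end_path (S := S) (acc := acc) (o := s.out) hq' hp (rest := []) hj (by
        have := tapeOf_length (ls (tapeIdx N r))
        rw [hjl] at this
        rw [← this, Function.update_eq_self, hj, List.append_nil]) h1 (by omega)
      exact ⟨_, this, simRel_same hp hls (by simpa using hj)⟩
    · have := bitsVal_pos j rest
      rw [show true = !false from rfl, ← hj, hval] at this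
      omega
  | @inp q f s hq =>
    refine ⟨_, .single ⟨step_plainAction (st := some ((f (inputSym x s.pos)).2, .run))
      (mv := (f (inputSym x s.pos)).1) (b := none) (by simp [simTrans, hq]), headsBelow_simCfg h1 h1⟩,
      ⟨ls, by simp, by simp, hls⟩⟩
  | @emit q b q' s hq =>
    refine ⟨_, .single ⟨step_plainAction (st := some (q', .run))
      (mv := .stay) (b := some b) (by simp [simTrans, hq]), headsBelow_simCfg h1 h1⟩,
      ⟨ls, ?_, hp, hls⟩⟩
    have hp' : s.pos ≤ x.length + 1 := hp
    simp [Move.apply, hp']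

/-- The initial state of a counter machine. -/
def St.initial : St := ⟨fun _ => 0, 0, []⟩

/-- A halting run of the flowchart is simulated in space logarithmic in its register values. -/
theorem sim_run {x : List Bool} {B : ℕ} (hN : ∀ q, (I q).reg ≤ N) {q : Q} {s : St}
    (h : Relation.ReflTransGen (FStep x B I) (start, St.initial) (q, s)) (hq : I q = .halt) :
    (∃ c, (simMachine I N start acc).HaltsIn x c ∧ c.out = s.out ∧
      ((simMachine I N start acc).accepting c.state ↔ acc q)) ∧
    ∀ c, (simMachine I N start acc).Reaches x c → ∀ i, c.head i < Nat.log 2 B + 3 := by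
  have h0 : GoodPath ((simMachine I N start acc).step x) (HeadsBelow (Nat.log 2 B + 3))
      (simMachine I N start acc).init
      (simCfg I N start acc (some (start, .run)) 0 (fun _ => []) 0 1 []) := by
    refine .single ⟨?_, headsBelow_simCfg (by omega) (by omega)⟩
    simp only [Machine.step, Machine.init, simCfg, Option.map_eq_some_iff]
    refine ⟨_, rfl, ?_⟩
    congr 1
    · funext i
      simp [Move.apply]
    · funext i j
      rcases j with _ | j <;> simp [tapeOf, simMachine]
  have h1 : ∃ c, GoodPath ((simMachine I N start acc).step x) (HeadsBelow (Nat.log 2 B + 3))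
      (simMachine I N start acc).init c ∧ SimRel x B c (q, s) := by
    clear hq
    generalize (q, s) = qs at h ⊢
    induction h with
    | refl => exact ⟨_, h0, ⟨fun _ => [], rfl, by simp [St.initial], by simp [bitsVal, St.initial]⟩⟩
    | tail _ h ih =>
      obtain ⟨c, hc, hr⟩ := ih
      obtain ⟨c', hc', hr'⟩ := sim_step (S := Nat.log 2 B + 3) (by omega) hN hr h
      exact ⟨c', hc.trans hc', hr'⟩
  obtain ⟨c, hc, ls, rfl, -, -⟩ := h1
  have hh : (simMachine I N start acc).step x
      (simCfg I N start acc (some (q, .run)) s.pos ls 0 1 s.out) = none := by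
    simp [Machine.step, simCfg, simMachine, simTrans, hq]
  refine ⟨⟨_, ⟨hc.reaches, hh⟩, rfl, ?_⟩, fun d hd => hc.good_of_reaches ?_ hh hd⟩
  · constructor
    · rintro ⟨_, _, h, h'⟩
      cases h
      exact h'
    · exact fun h => ⟨_, _, rfl, h⟩
  · intro i
    simp [Machine.init]

end Simulation

/-! ### Structured counter programs -/

/-- Programs over registers indexed by `ℕ`, with access to the input. -/
inductive Prog where
  | skip : Prog
  /-- Increment a register. -/
  | inc (r : ℕ) : Prog
  | seq (P R : Prog) : Prog
  /-- While the register is not zero, decrement it and run the body. -/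
  | loop (r : ℕ) (P : Prog) : Prog
  /-- Move the input head to the left end. -/
  | rewind : Prog
  /-- Move the input head one cell to the right. -/
  | right : Prog
  /-- Add the value of the symbol under the input head to the register. -/
  | read (r : ℕ) : Prog
  /-- Move the input head to the right end, counting the moves in the register. -/
  | measure (r : ℕ) : Prog
  /-- Output one bit, namely whether the register is nonzero, and decrement it. -/
  | emit (r : ℕ) : Prog

/-- The number contributed by `Prog.read`. -/
def InSym.val : InSym → ℕ
  | .bit b => b.toNat
  | _ => 2

/-- `Exec x B P s t`: on input `x` and from the state `s`, the program `P` terminates in the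
state `t`, with all registers at most `B` after increments. -/
inductive Exec (x : List Bool) (B : ℕ) : Prog → St → St → Prop
  | skip {s} : Exec x B .skip s s
  | inc {r s} : s.reg r < B → Exec x B (.inc r) s (s.set r (s.reg r + 1))
  | seq {P R s t u} : Exec x B P s t → Exec x B R t u → Exec x B (.seq P R) s u
  | loop_zero {r P s} : s.reg r = 0 → Exec x B (.loop r P) s s
  | loop_succ {r P s t u n} : s.reg r = n + 1 → Exec x B P (s.set r n) t →
      Exec x B (.loop r P) t u → Exec x B (.loop r P) s u
  | rewind {s} : Exec x B .rewind s { s with pos := 0 }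
  | right {s} : Exec x B .right s { s with pos := min (s.pos + 1) (x.length + 1) }
  | read {r s} : s.reg r + (inputSym x s.pos).val ≤ B →
      Exec x B (.read r) s (s.set r (s.reg r + (inputSym x s.pos).val))
  | measure {r s} : s.pos ≤ x.length + 1 → s.reg r + (x.length + 1 - s.pos) ≤ B →
      Exec x B (.measure r) s
        { s.set r (s.reg r + (x.length + 1 - s.pos)) with pos := x.length + 1 }
  | emit {r s} : Exec x B (.emit r) s
      { s.set r (s.reg r - 1) with out := s.out ++ [decide (s.reg r ≠ 0)] }

/-- Labels of the flowchart of a program. -/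
def Prog.Lab : Prog → Type
  | .seq P R => P.Lab ⊕ R.Lab
  | .loop _ P => Unit ⊕ P.Lab
  | _ => Fin 3

instance Prog.finite_lab : (P : Prog) → Finite P.Lab
  | .seq P R => by
    have := P.finite_lab
    have := R.finite_lab
    exact inferInstanceAs (Finite (P.Lab ⊕ R.Lab))
  | .loop _ P => by
    have := P.finite_lab
    exact inferInstanceAs (Finite (Unit ⊕ P.Lab))
  | .skip | .inc _ | .rewind | .right | .read _ | .measure _ | .emit _ =>
    inferInstanceAs (Finite (Fin 3))

/-- The first label of a program. -/
def Prog.entry : (P : Prog) → P.Lab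
  | .seq P _ => .inl P.entry
  | .loop _ _ => .inl ()
  | .skip | .inc _ | .rewind | .right | .read _ | .measure _ | .emit _ => (0 : Fin 3)

/-- The flowchart of a program inside a flowchart with labels `E`, continuing at `exit`. -/
def Prog.code {E : Type} : (P : Prog) → (exit : E) → (emb : P.Lab → E) → P.Lab → Instr E
  | .seq P R, _, emb, .inl l => P.code (emb (.inr R.entry)) (fun l => emb (.inl l)) l
  | .seq _ R, exit, emb, .inr l => R.code exit (fun l => emb (.inr l)) l
  | .loop r P, exit, emb, .inl _ => .dec r (emb (.inr P.entry)) exit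
  | .loop _ P, _, emb, .inr l => P.code (emb (.inl ())) (fun l => emb (.inr l)) l
  | .skip, exit, _, _ => .inp fun _ => (.stay, exit)
  | .inc r, exit, _, _ => .inc r exit
  | .rewind, exit, emb, _ => .inp fun
      | .leftEnd => (.stay, exit)
      | _ => (.left, emb (0 : Fin 3))
  | .right, exit, _, _ => .inp fun _ => (.right, exit)
  | .read r, exit, emb, l => ![.inp fun
      | .bit false => (.stay, exit)
      | .bit true => (.stay, emb (1 : Fin 3))
      | _ => (.stay, emb (2 : Fin 3)), .inc r exit, .inc r (emb (1 : Fin 3))] (show Fin 3 from l)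
  | .measure r, exit, emb, l => ![.inp fun
      | .rightEnd => (.stay, exit)
      | _ => (.right, emb (1 : Fin 3)), .inc r (emb (0 : Fin 3)), .halt] (show Fin 3 from l)
  | .emit r, exit, emb, l =>
    ![.dec r (emb (1 : Fin 3)) (emb (2 : Fin 3)), .emit true exit, .emit false exit]
      (show Fin 3 from l)

theorem inputSym_rightEnd_iff {x : List Bool} {p : ℕ} :
    inputSym x p = .rightEnd ↔ x.length + 1 ≤ p := by
  rcases p with _ | p
  · simp [inputSym]
  · rcases h : x[p]? with _ | b
    · have := List.getElem?_eq_none_iff.1 h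
      simp [inputSym, h]; omega
    · have := (List.getElem?_eq_some_iff.1 h).1
      simp [inputSym, h]; omega

theorem inputSym_leftEnd_iff {x : List Bool} {p : ℕ} : inputSym x p = .leftEnd ↔ p = 0 := by
  rcases p with _ | p
  · simp [inputSym]
  · rcases h : x[p]? with _ | b <;> simp [inputSym, h]

theorem St.set_set (s : St) (r v w : ℕ) : (s.set r v).set r w = s.set r w := by
  simp [St.set]

theorem St.set_reg_self (s : St) (r : ℕ) : s.set r (s.reg r) = s := by
  simp [St.set]

@[simp] theorem St.set_reg (s : St) (r v i : ℕ) :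
    (s.set r v).reg i = if i = r then v else s.reg i := by
  simp [St.set, Function.update_apply]
@[simp] theorem St.set_pos (s : St) (r v : ℕ) : (s.set r v).pos = s.pos := rfl
@[simp] theorem St.set_out (s : St) (r v : ℕ) : (s.set r v).out = s.out := rfl

theorem Exec.pos_le {x : List Bool} {B : ℕ} {P : Prog} {s t : St} (h : Exec x B P s t)
    (hs : s.pos ≤ x.length + 1) : t.pos ≤ x.length + 1 := by
  induction h with
  | seq _ _ ih1 ih2 => exact ih2 (ih1 hs)
  | loop_succ _ _ _ ih1 ih2 => exact ih2 (ih1 hs)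
  | _ => simp_all

/-- Induction on the execution. The exit label and the embedding of the labels are general, so that
the code of a subprogram can sit anywhere inside a larger flowchart. -/
theorem Exec.flow {E : Type} {I : E → Instr E} {x : List Bool} {B : ℕ} {P : Prog} {s t : St}
    (h : Exec x B P s t) (hs : s.pos ≤ x.length + 1) {exit : E} {emb : P.Lab → E}
    (hI : ∀ l, I (emb l) = P.code exit emb l) :
    Relation.ReflTransGen (FStep x B I) (emb P.entry, s) (exit, t) := by
  induction h generalizing exit with
  | @skip s =>
    refine .single ?_
    have := FStep.inp (x := x) (B := B) (s := s) (hI (0 : Fin 3))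
    simp only [Move.apply, min_eq_left hs] at this
    exact this
  | inc h => exact .single (.inc (hI (0 : Fin 3)) h)
  | @seq P R s t u h1 h2 ih1 ih2 =>
    exact (ih1 hs (exit := emb (.inr R.entry)) (emb := fun l => emb (.inl l))
      (fun l => hI (.inl l))).trans (ih2 (h1.pos_le hs) (exit := exit)
        (emb := fun l => emb (.inr l)) (fun l => hI (.inr l)))
  | loop_zero h => exact .single (.zero (hI (.inl ())) h)
  | @loop_succ r P s t u n h h1 h2 ih1 ih2 =>
    refine .head (.dec (hI (.inl ())) h) (.trans (ih1 hs (exit := emb (.inl ()))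
      (emb := fun l => emb (.inr l)) (fun l => hI (.inr l))) ?_)
    exact ih2 (h1.pos_le hs) hI
  | @rewind s =>
    obtain ⟨reg, p, o⟩ := s
    induction p with
    | zero =>
      refine .single ?_
      have := FStep.inp (x := x) (B := B) (s := ⟨reg, 0, o⟩) (hI (0 : Fin 3))
      simp only [inputSym, Move.apply, min_eq_left hs] at this
      exact this
    | succ p ih =>
      refine .head ?_ (ih (by simp at hs ⊢; omega))
      have := FStep.inp (x := x) (B := B) (s := ⟨reg, p + 1, o⟩) (hI (0 : Fin 3))
      dsimp only at hs
      have h0 : inputSym x (p + 1) ≠ .leftEnd := by simp [inputSym_leftEnd_iff]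
      have e : min p (x.length + 1) = p := by omega
      rcases h : inputSym x (p + 1) with _ | b | _
      · exact absurd h h0
      · simp only [h, Move.apply, Nat.add_sub_cancel, e] at this; exact this
      · simp only [h, Move.apply, Nat.add_sub_cancel, e] at this; exact this
  | @right s =>
    exact .single (FStep.inp (x := x) (B := B) (s := s) (hI (0 : Fin 3)))
  | @read r s h =>
    have h0 := FStep.inp (x := x) (B := B) (s := s) (hI (0 : Fin 3))
    have h1 : s.reg r < B → _ := FStep.inc (x := x) (B := B) (s := s) (hI (1 : Fin 3))
    have h1' : _ < B → _ :=
      FStep.inc (x := x) (B := B) (s := s.set r (s.reg r + 1)) (hI (1 : Fin 3))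
    have h2 : s.reg r < B → _ := FStep.inc (x := x) (B := B) (s := s) (hI (2 : Fin 3))
    rcases e : inputSym x s.pos with _ | (_ | _) | _
    · simp [e, Move.apply, hs, InSym.val, St.set_set] at h0 h1 h2 h h1' ⊢
      exact .head h0 (.head (h2 (by omega)) (.single (h1' (by omega))))
    · simp [e, Move.apply, hs, InSym.val, St.set_reg_self] at h0 ⊢
      exact .single h0
    · simp [e, Move.apply, hs, InSym.val] at h0 h1 h ⊢
      exact .head h0 (.single (h1 (by omega)))
    · simp [e, Move.apply, hs, InSym.val, St.set_set] at h0 h1 h2 h h1' ⊢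
      exact .head h0 (.head (h2 (by omega)) (.single (h1' (by omega))))
  | @measure r s hp h =>
    obtain ⟨d, hd⟩ : ∃ d, d = x.length + 1 - s.pos := ⟨_, rfl⟩
    induction d generalizing s with
    | zero =>
      have h0 := FStep.inp (x := x) (B := B) (s := s) (hI (0 : Fin 3))
      have e : s.pos = x.length + 1 := by omega
      have e' := inputSym_rightEnd_iff.2 e.ge
      simp only [e', Move.apply, min_eq_left hs] at h0
      have e2 : ({ s.set r (s.reg r + (x.length + 1 - s.pos)) with pos := x.length + 1 } : St) =
          s := by
        rw [← hd, Nat.add_zero, St.set_reg_self, ← e]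
      rw [e2]
      exact .single h0
    | succ d ih =>
      have h0 := FStep.inp (x := x) (B := B) (s := s) (hI (0 : Fin 3))
      have h1 : s.reg r < B → _ := FStep.inc (x := x) (B := B)
        (s := { s with pos := s.pos + 1 }) (hI (1 : Fin 3))
      have e0 : min (s.pos + 1) (x.length + 1) = s.pos + 1 := by omega
      have hne : inputSym x s.pos ≠ .rightEnd := by
        rw [Ne, inputSym_rightEnd_iff]; omega
      have h0' : FStep x B I (emb (Prog.entry (.measure r)), s)
          (emb (1 : Fin 3), { s with pos := s.pos + 1 }) := by
        rcases e : inputSym x s.pos with _ | b | _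
        · simp only [e, Move.apply, e0] at h0; exact h0
        · simp only [e, Move.apply, e0] at h0; exact h0
        · exact absurd e hne
      have ih' := ih (s := { s with pos := s.pos + 1 }.set r (s.reg r + 1)) (by simp; omega)
        (by simp; omega) (by simp; omega) (by simp; omega)
      refine .head h0' (.head (h1 (by omega)) ?_)
      have e2 : s.reg r + 1 + (x.length - s.pos) = s.reg r + (x.length + 1 - s.pos) := by
        omega
      simp only [St.set, Function.update_self, Function.update_idem, Nat.add_sub_add_right,
        e2] at ih' ⊢
      exact ih'
  | @emit r s =>
    rcases e : s.reg r with _ | n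
    · have h0 := FStep.zero (x := x) (B := B) (s := s) (hI (0 : Fin 3)) e
      have h2 := FStep.emit (x := x) (B := B) (s := s) (hI (2 : Fin 3))
      refine .head h0 (.single ?_)
      convert h2 using 2
      have e2 : s.set r 0 = s := by rw [← e, St.set_reg_self]
      simp [e2]
    · have h0 := FStep.dec (x := x) (B := B) (s := s) (hI (0 : Fin 3)) e
      have h1 := FStep.emit (x := x) (B := B) (s := s.set r n) (hI (1 : Fin 3))
      refine .head h0 (.single ?_)
      simpa [e] using h1

/-- A program that terminates on all inputs is simulated by a Turing machine, accepting when a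
given register is not zero. -/
theorem Prog.exists_machine (P : Prog) (r : ℕ) (B : List Bool → ℕ)
    (t : List Bool → St) (h : ∀ x, Exec x (B x) P St.initial (t x)) :
    ∃ M : Machine, M.RunsInSpace (fun x => Nat.log 2 (B x) + 3) ∧
      ∀ x, ∃ c, M.HaltsIn x c ∧ c.out = (t x).out ∧ (M.accepting c.state ↔ (t x).reg r ≠ 0) := by
  let E := P.Lab ⊕ Fin 3
  -- Three labels are appended: 0 tests the answer register, 1 is the accepting halt, 2 the
  -- rejecting one.
  let I : E → Instr E := fun
    | .inl l => P.code (.inr 0) .inl l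
    | .inr 0 => .dec r (.inr 1) (.inr 2)
    | .inr _ => .halt
  obtain ⟨N, hN⟩ : ∃ N, ∀ q, (I q).reg ≤ N := by
    obtain ⟨N, hN⟩ := (Set.finite_range fun q => (I q).reg).bddAbove
    exact ⟨N, fun q => hN ⟨q, rfl⟩⟩
  let M := simMachine I N (.inl P.entry) (· = .inr 1)
  have key : ∀ x, (∃ c, M.HaltsIn x c ∧ c.out = (t x).out ∧
      (M.accepting c.state ↔ (t x).reg r ≠ 0)) ∧
      ∀ c, M.Reaches x c → ∀ i, c.head i < Nat.log 2 (B x) + 3 := by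
    intro x
    have h1 := (h x).flow (I := I) (by simp [St.initial]) (exit := .inr 0) (emb := .inl)
      (fun l => rfl)
    rcases e : (t x).reg r with _ | n
    · have h2 := FStep.zero (x := x) (B := B x) (I := I) (s := t x) (q := .inr 0) rfl e
      obtain ⟨⟨c, hc, hc', hc''⟩, h3⟩ := sim_run (acc := (· = .inr 1)) hN (h1.tail h2) rfl
      exact ⟨⟨c, hc, hc', hc''.trans (by simp only [ne_eq, not_true_eq_false, iff_false]; rintro ⟨⟩)⟩, h3⟩
    · have h2 := FStep.dec (x := x) (B := B x) (I := I) (s := t x) (q := .inr 0) rfl e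
      obtain ⟨⟨c, hc, hc', hc''⟩, h3⟩ := sim_run (acc := (· = .inr 1)) hN (h1.tail h2) rfl
      exact ⟨⟨c, hc, hc', hc''.trans (by simp)⟩, h3⟩
  exact ⟨M, fun x => (key x).2, fun x => (key x).1⟩

/-! ### Program fragments -/

/-- Loop rule with an explicit invariant: `T k` is the state when k rounds remain, and the body
starts after the counter has already been decremented. -/
theorem Exec.loop_of {x : List Bool} {B : ℕ} {r : ℕ} {P : Prog} (T : ℕ → St) (n : ℕ)
    (hr : ∀ k ≤ n, (T k).reg r = k)
    (h : ∀ k < n, Exec x B P ((T (k + 1)).set r k) (T k)) : Exec x B (.loop r P) (T n) (T 0) := by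
  induction n with
  | zero => exact .loop_zero (hr 0 le_rfl)
  | succ n ih =>
    exact .loop_succ (hr _ le_rfl) (h n (Nat.lt_succ_self n))
      (ih (fun k hk => hr k (hk.trans (Nat.le_succ n))) (fun k hk => h k (hk.trans (Nat.lt_succ_self n))))

theorem St.ext' {s t : St} (h : ∀ i, s.reg i = t.reg i) (hp : s.pos = t.pos)
    (ho : s.out = t.out) : s = t := St.ext (funext h) hp ho

theorem Exec.cast {x : List Bool} {B : ℕ} {P : Prog} {s s' t t' : St} (h : Exec x B P s t)
    (hs : s = s') (ht : t = t') : Exec x B P s' t' := hs ▸ ht ▸ h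

/-- Set a register to zero. -/
def Prog.clear (r : ℕ) : Prog := .loop r .skip

theorem exec_clear (x : List Bool) (B r : ℕ) (s : St) :
    Exec x B (.clear r) s (s.set r 0) := by
  have := Exec.loop_of (x := x) (B := B) (r := r) (P := .skip) (fun k => s.set r k) (s.reg r)
    (by simp) (fun k _ => by simpa only [St.set_set] using Exec.skip)
  exact this.cast (St.set_reg_self s r) rfl

/-- Add one register to another one, setting it to zero. -/
def Prog.move (r r' : ℕ) : Prog := .loop r (.inc r')

theorem exec_move {x : List Bool} {B r r' : ℕ} {s : St} (hne : r ≠ r')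
    (h : s.reg r + s.reg r' ≤ B) :
    Exec x B (.move r r') s ((s.set r' (s.reg r + s.reg r')).set r 0) := by
  have := Exec.loop_of (x := x) (B := B) (r := r) (P := .inc r')
    (fun k => (s.set r' (s.reg r + s.reg r' - k)).set r k) (s.reg r)
    (by simp) (fun k hk => by
      have h1 := Exec.inc (x := x) (B := B) (r := r')
        (s := (((s.set r' (s.reg r + s.reg r' - (k + 1))).set r (k + 1)).set r k))
        (by simp [hne.symm]; omega)
      convert h1 using 1
      refine St.ext' (fun i => ?_) rfl rfl
      simp only [St.set_reg, hne.symm, if_false, if_true]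
      split_ifs <;> omega)
  refine this.cast (St.ext' (fun i => ?_) rfl rfl) (by simp)
  simp only [St.set_reg]
  grind

/-! ### Contexts -/

/-- A context provides an input word and some numbers, and a measure of their size. -/
class Ctx (α : Type) where
  inp : α → List Bool
  num : ℕ
  reg : α → ℕ → ℕ
  size : α → ℕ
  len_le : ∀ a, (inp a).length + 2 ≤ size a
  reg_le : ∀ a, ∀ i < num, reg a i ≤ size a

open Ctx (inp)

/-- An input word, with a number that only contributes to the size. -/
structure Inp where
  word : List Bool
  slack : ℕ

instance : Ctx Inp where
  inp := Inp.word
  num := 0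
  reg _ _ := 0
  size a := a.word.length + 2 + a.slack
  len_le a := by omega
  reg_le a i hi := by omega

/-- The value of the new number counts towards the size. A polynomial bound in the extended context
thus gives one in the original context whenever that value is polynomially bounded there. -/
instance {α : Type} [Ctx α] : Ctx (α × ℕ) where
  inp a := inp a.1
  num := Ctx.num α + 1
  reg a := Function.update (Ctx.reg a.1) (Ctx.num α) a.2
  size a := Ctx.size a.1 + a.2
  len_le a := (Ctx.len_le a.1).trans (Nat.le_add_right _ _)
  reg_le a i hi := by
    by_cases h : i = Ctx.num α
    · subst h; simp
    · simpa [h] using (Ctx.reg_le a.1 i (by omega)).trans (Nat.le_add_right _ _)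

/-- Restricting the context allows a program to be correct, and its values to be bounded, only where
an invariant or a lower bound on the slack holds. -/
instance {α : Type} [Ctx α] {p : α → Prop} : Ctx {a // p a} where
  inp a := inp a.1
  num := Ctx.num α
  reg a := Ctx.reg a.1
  size a := Ctx.size a.1
  len_le a := Ctx.len_le a.1
  reg_le a := Ctx.reg_le a.1

variable {α : Type} [Ctx α]

theorem two_le_size (a : α) : 2 ≤ Ctx.size a := by
  have := Ctx.len_le a
  omega

/-- Polynomially bounded functions. -/
def PolyB (f : α → ℕ) : Prop := ∃ c, ∀ a, f a ≤ Ctx.size a ^ c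

theorem PolyB.mono {f g : α → ℕ} (hg : PolyB g) (h : ∀ a, f a ≤ g a) : PolyB f := by
  obtain ⟨c, hc⟩ := hg
  exact ⟨c, fun a => (h a).trans (hc a)⟩

theorem PolyB.size : PolyB (fun a : α => Ctx.size a) := ⟨1, fun a => by simp⟩

theorem PolyB.const (n : ℕ) : PolyB (fun _ : α => n) :=
  ⟨n, fun a => n.lt_two_pow_self.le.trans (Nat.pow_le_pow_left (two_le_size a) n)⟩

theorem PolyB.mul {f g : α → ℕ} (hf : PolyB f) (hg : PolyB g) : PolyB (fun a => f a * g a) := by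
  obtain ⟨c, hc⟩ := hf
  obtain ⟨c', hc'⟩ := hg
  exact ⟨c + c', fun a => by rw [pow_add]; exact Nat.mul_le_mul (hc a) (hc' a)⟩

theorem PolyB.pow {f : α → ℕ} (hf : PolyB f) (n : ℕ) : PolyB (fun a => f a ^ n) := by
  obtain ⟨c, hc⟩ := hf
  exact ⟨c * n, fun a => by rw [pow_mul]; exact Nat.pow_le_pow_left (hc a) n⟩

theorem PolyB.add {f g : α → ℕ} (hf : PolyB f) (hg : PolyB g) : PolyB (fun a => f a + g a) := by
  obtain ⟨c, hc⟩ := hf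
  obtain ⟨c', hc'⟩ := hg
  refine ⟨c + c' + 1, fun a => ?_⟩
  have h2 := two_le_size a
  have h0 : 0 < Ctx.size a := by omega
  have h1 : Ctx.size a ^ c ≤ Ctx.size a ^ (c + c') := Nat.pow_le_pow_right h0 (by omega)
  have h3 : Ctx.size a ^ c' ≤ Ctx.size a ^ (c + c') := Nat.pow_le_pow_right h0 (by omega)
  have := hc a
  have := hc' a
  rw [pow_succ]
  nlinarith

theorem PolyB.comp {β : Type} [Ctx β] {f : β → ℕ} (hf : PolyB f) {g : α → β}
    (hg : PolyB fun a => Ctx.size (g a)) : PolyB (fun a => f (g a)) := by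
  obtain ⟨c, hc⟩ := hf
  exact (hg.pow c).mono fun a => hc (g a)

/-! ### Composable programs, bounded recursion and search. -/

/-- The functions computable by programs with polynomially bounded register values. -/
def LS (f : α → ℕ) : Prop :=
  ∃ b : α → ℕ, PolyB b ∧ (∀ a, f a ≤ b a) ∧
    ∀ (σ : ℕ → ℕ) (d : ℕ), (∀ i < Ctx.num α, σ i < d) → ∃ P : Prog, ∀ (a : α) (s : St) (B : ℕ),
      (∀ i < Ctx.num α, s.reg (σ i) = Ctx.reg a i) → (∀ i ≥ d, s.reg i = 0) → s.pos = 0 →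
      b a ≤ B → Exec (inp a) B P s (s.set d (f a))

theorem LS.polyB {f : α → ℕ} (hf : LS f) : PolyB f := by
  obtain ⟨b, hb, h, -⟩ := hf
  exact hb.mono h

theorem LS.congr {f g : α → ℕ} (hf : LS f) (h : ∀ a, f a = g a) : LS g := by
  rwa [← (funext h : f = g)]

theorem LS.wk {f : α → ℕ} (hf : LS f) : LS (fun p : α × ℕ => f p.1) := by
  obtain ⟨b, hb, hfb, H⟩ := hf
  refine ⟨fun p => b p.1, hb.comp (PolyB.size.mono fun p => Nat.le_add_right _ _), fun p => hfb p.1,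
    fun σ d hσ => ?_⟩
  obtain ⟨P, hP⟩ := H σ d fun i hi => hσ i (Nat.lt_succ_of_lt hi)
  refine ⟨P, fun p s B hs hd hp hB => hP p.1 s B (fun i hi => ?_) hd hp hB⟩
  rw [hs i (Nat.lt_succ_of_lt hi)]
  simp [Ctx.reg, hi.ne]

theorem LS.restrict {f : α → ℕ} (hf : LS f) (p : α → Prop) : LS (fun a : {a // p a} => f a.1) := by
  obtain ⟨b, hb, hfb, H⟩ := hf
  refine ⟨fun a => b a.1, hb.comp PolyB.size, fun a => hfb a.1, fun σ d hσ => ?_⟩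
  obtain ⟨P, hP⟩ := H σ d hσ
  exact ⟨P, fun a s B hs hd hp hB => hP a.1 s B hs hd hp hB⟩

theorem LS.zero : LS (fun _ : α => 0) := by
  refine ⟨fun _ => 0, .const 0, fun _ => le_rfl, fun σ d _ => ⟨.skip, fun a s B _ hd _ _ => ?_⟩⟩
  have : s.set d 0 = s := by rw [← hd d le_rfl, St.set_reg_self]
  rw [this]
  exact .skip

theorem LS.succ {f : α → ℕ} (hf : LS f) : LS (fun a => f a + 1) := by
  obtain ⟨b, hb, hfb, H⟩ := hf
  refine ⟨fun a => b a + 1, hb.add (.const 1), fun a => Nat.succ_le_succ (hfb a),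
    fun σ d hσ => ?_⟩
  obtain ⟨P, hP⟩ := H σ d hσ
  refine ⟨.seq P (.inc d), fun a s B hs hd hp (hB : b a + 1 ≤ B) =>
    .seq (hP a s B hs hd hp (by omega)) ?_⟩
  have := hfb a
  have h := Exec.inc (x := inp a) (B := B) (r := d) (s := s.set d (f a)) (by simp; omega)
  simpa [St.set_set] using h

theorem LS.const (n : ℕ) : LS (fun _ : α => n) := by
  induction n with
  | zero => exact .zero
  | succ n ih => exact ih.succ

/-- Pattern for combining programs: the second one is instantiated with result register d + 1, so
the first result is outside its scratch space; moving the second result into d leaves d + 1 clean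
again. -/
theorem LS.add {f g : α → ℕ} (hf : LS f) (hg : LS g) : LS (fun a => f a + g a) := by
  obtain ⟨b, hb, hfb, H⟩ := hf
  obtain ⟨b', hb', hgb, H'⟩ := hg
  refine ⟨fun a => b a + b' a, hb.add hb', fun a => Nat.add_le_add (hfb a) (hgb a), fun σ d hσ => ?_⟩
  obtain ⟨P, hP⟩ := H σ d hσ
  obtain ⟨P', hP'⟩ := H' σ (d + 1) fun i hi => (hσ i hi).trans (Nat.lt_succ_self d)
  refine ⟨.seq P (.seq P' (.move (d + 1) d)), fun a s B hs hd hp (hB : b a + b' a ≤ B) =>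
    .seq (hP a s B hs hd hp (by omega)) (.seq (hP' a _ B (fun i hi => ?_) (fun i hi => ?_) hp
      (by omega)) ?_)⟩
  · simpa [(hσ i hi).ne] using hs i hi
  · have : i ≠ d := by omega
    simpa [this] using hd i (by omega)
  · have := hfb a
    have := hgb a
    have h := exec_move (x := inp a) (B := B) (r := d + 1) (r' := d)
      (s := (s.set d (f a)).set (d + 1) (g a)) (by omega) (by simp; omega)
    refine h.cast rfl (St.ext' (fun i => ?_) rfl rfl)
    have := hd (d + 1) (by omega)
    simp only [St.set_reg]
    grind

/-- Reading a counter destroys it. It is therefore emptied into two registers at once, and one of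
the copies is moved back. -/
theorem LS.var : LS (fun p : α × ℕ => p.2) := by
  refine ⟨fun p => p.2, PolyB.size.mono fun p => Nat.le_add_left _ _, fun _ => le_rfl,
    fun σ d hσ => ?_⟩
  have hσn := hσ (Ctx.num α) (Nat.lt_succ_self _)
  set r := σ (Ctx.num α) with hr
  refine ⟨.seq (.loop r (.seq (.inc d) (.inc (d + 1)))) (.move (d + 1) r),
    fun p s B hs hd hp (hB : p.2 ≤ B) => ?_⟩
  have hsr : s.reg r = p.2 := by
    rw [hs _ (Nat.lt_succ_self _)]
    simp [Ctx.reg]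
  have h0 := hd d le_rfl
  have h0' := hd (d + 1) (by omega)
  have h1 := Exec.loop_of (x := inp p) (B := B) (r := r) (P := .seq (.inc d) (.inc (d + 1)))
    (fun k => ((s.set d (p.2 - k)).set (d + 1) (p.2 - k)).set r k) p.2
    (by simp) (fun k hk => by
      refine .seq (.inc ?_) ?_
      · simp [hσn.ne']; omega
      · have h1 := Exec.inc (x := inp p) (B := B) (r := d + 1)
          (s := (((((s.set d (p.2 - (k + 1))).set (d + 1) (p.2 - (k + 1))).set r (k + 1)).set r k).set d
            (p.2 - k)))
          (by simp [(Nat.lt_succ_of_lt hσn).ne']; omega)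
        have e : ((((s.set d (p.2 - (k + 1))).set (d + 1) (p.2 - (k + 1))).set r (k + 1)).set r k).reg d
            + 1 = p.2 - k := by
          simp [hσn.ne']; omega
        rw [e]
        convert h1 using 1
        refine St.ext' (fun i => ?_) rfl rfl
        simp only [St.set_reg]
        split_ifs <;> omega)
  have h2 := exec_move (x := inp p) (B := B) (r := d + 1) (r' := r)
    (s := ((s.set d p.2).set (d + 1) p.2).set r 0) (by omega) (by
      simp [(Nat.lt_succ_of_lt hσn).ne']; omega)
  refine .seq (t := ((s.set d p.2).set (d + 1) p.2).set r 0) ?_ ?_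
  · refine h1.cast (St.ext' (fun i => ?_) rfl rfl) (by simp)
    simp only [St.set_reg]
    grind
  · refine h2.cast rfl (St.ext' (fun i => ?_) rfl rfl)
    simp only [St.set_reg]
    grind

theorem inputSym_min (x : List Bool) (p : ℕ) :
    inputSym x (min p (x.length + 1)) = inputSym x p := by
  by_cases h : p ≤ x.length + 1
  · rw [min_eq_left h]
  · rw [min_eq_right (by omega), inputSym_rightEnd_iff.2 le_rfl,
      inputSym_rightEnd_iff.2 (by omega)]

/-- The symbol at position `i` of a word: `0`, `1`, or `2` at positions beyond the end. -/
def symAt (x : List Bool) (i : ℕ) : ℕ := (inputSym x (i + 1)).val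

theorem symAt_le (x : List Bool) (i : ℕ) : symAt x i ≤ 2 := by
  unfold symAt
  rcases inputSym x (i + 1) with _ | (_ | _) | _ <;> simp [InSym.val]

theorem LS.symAt {f : α → ℕ} (hf : LS f) : LS (fun a => symAt (inp a) (f a)) := by
  obtain ⟨b, hb, hfb, H⟩ := hf
  refine ⟨fun a => b a + 2, hb.add (.const 2), fun a => (symAt_le _ _).trans (Nat.le_add_left _ _),
    fun σ d hσ => ?_⟩
  obtain ⟨P, hP⟩ := H σ d hσ
  -- The extra move to the right skips the left end marker. The loop leaves register d at 0, ready
  -- to receive the symbol, and the final rewind restores the head position required by `LS`.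
  refine ⟨.seq P (.seq .right (.seq (.loop d .right) (.seq (.read d) .rewind))),
    fun a s B hs hd hp (hB : b a + 2 ≤ B) => .seq (hP a s B hs hd hp (by omega)) (.seq .right
      (.seq (t := { s with pos := min (f a + 1) ((inp a).length + 1) }) ?_ (.seq (.read ?_) ?_)))⟩
  · have h1 := Exec.loop_of (x := inp a) (B := B) (r := d) (P := .right)
      (fun k => { s.set d k with pos := min (f a - k + 1) ((inp a).length + 1) }) (f a)
      (by simp) (fun k hk => by
        have h1 := Exec.right (x := inp a) (B := B) (s := { s.set d k with
          pos := min (f a - (k + 1) + 1) ((inp a).length + 1) })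
        convert h1 using 1
        · simp [St.set]
        · simp [St.set]; omega)
    refine h1.cast ?_ ?_
    · simp [St.set, hp]
    · have e := St.set_reg_self s d
      rw [hd d le_rfl] at e
      simp [e]
  · have := symAt_le (inp a) (f a)
    have h0 := hd d le_rfl
    unfold ParaEmb.symAt at this
    simp only [inputSym_min]
    omega
  · refine Exec.rewind.cast rfl ?_
    simp only [St.set, hd d le_rfl, inputSym_min, ParaEmb.symAt, hp, Nat.zero_add]

theorem LS.length_succ : LS (fun a : α => (inp a).length + 1) := by
  refine ⟨fun a => Ctx.size a, .size, fun a => (Nat.le_succ _).trans (Ctx.len_le a),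
    fun σ d hσ => ?_⟩
  refine ⟨.seq (.measure d) .rewind, fun a s B hs hd hp (hB : Ctx.size a ≤ B) => .seq (.measure ?_ ?_) ?_⟩
  · omega
  · have := Ctx.len_le a
    rw [hd d le_rfl]; omega
  · refine Exec.rewind.cast rfl ?_
    simp [St.set, hd d le_rfl, hp]

theorem reg_extend {s : St} {σ : ℕ → ℕ} {a : α} {r v : ℕ}
    (h : ∀ i < Ctx.num α, s.reg (σ i) = Ctx.reg a i) (hv : s.reg r = v) :
    ∀ i < Ctx.num (α × ℕ),
      s.reg (Function.update σ (Ctx.num α) r i) = Ctx.reg ((a, v) : α × ℕ) i := by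
  intro i hi
  have hi : i < Ctx.num α + 1 := hi
  by_cases h' : i = Ctx.num α
  · simp [Ctx.reg, h', hv]
  · simp [Ctx.reg, h', h i (by omega)]

theorem lt_extend {σ : ℕ → ℕ} {d r d' : ℕ} (h : ∀ i < Ctx.num α, σ i < d) (hd : d ≤ d')
    (hr : r < d') : ∀ i < Ctx.num (α × ℕ), Function.update σ (Ctx.num α) r i < d' := by
  intro i hi
  have hi : i < Ctx.num α + 1 := hi
  by_cases h' : i = Ctx.num α
  · simpa [h'] using hr
  · simpa [h'] using (h i (by omega)).trans_le hd

/-- Contexts for the step of a recursion: a context, the number of steps done, and the value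
reached. -/
abbrev StepCtx (n : α → ℕ) (R : α → ℕ → ℕ) : Type :=
  {c : (α × ℕ) × ℕ // c.1.2 < n c.1.1 ∧ c.2 = R c.1.1 c.1.2}

/-- Recursion keeps only the current value, the index, and the number of remaining rounds. The
polynomial bound on all intermediate values is a hypothesis, as iterating a polynomial step could
make them grow too fast. The step need be correct only on contexts that actually occur, which is the
role of `StepCtx`. -/
theorem LS.rec {n : α → ℕ} {R : α → ℕ → ℕ} (hn : LS n) (h0 : LS fun a => R a 0)
    (hR : ∃ r, PolyB r ∧ ∀ a, ∀ i ≤ n a, R a i ≤ r a)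
    (hs : LS fun c : StepCtx n R => R c.1.1.1 (c.1.1.2 + 1)) : LS fun a => R a (n a) := by
  obtain ⟨bn, hbn, hnb, Hn⟩ := hn
  obtain ⟨b0, hb0, h0b, H0⟩ := h0
  obtain ⟨bs, ⟨e, hbs⟩, hsb, Hs⟩ := hs
  obtain ⟨r, hr, hrb⟩ := hR
  have hn' : PolyB n := hbn.mono hnb
  -- The last base bounds the size of every step context, where the index and the current value are
  -- counted too.
  refine ⟨fun a => bn a + b0 a + r a + (Ctx.size a + n a + r a) ^ e,
    ((hbn.add hb0).add hr).add (((PolyB.size.add hn').add hr).pow e),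
    fun a => (hrb a (n a) le_rfl).trans (by dsimp only; omega), fun σ d hσ => ?_⟩
  obtain ⟨P0, hP0⟩ := H0 σ d hσ
  obtain ⟨Pn, hPn⟩ := Hn σ (d + 1) fun i hi => (hσ i hi).trans (Nat.lt_succ_self d)
  -- Register d holds the value, d + 1 the rounds left, d + 2 the index passed to the step; the new
  -- value is computed in d + 3.
  obtain ⟨Ps, hPs⟩ := Hs (Function.update (Function.update σ (Ctx.num α) (d + 2))
    (Ctx.num α + 1) d) (d + 3)
    (lt_extend (d := d + 3) (lt_extend hσ (by omega) (by omega)) le_rfl (by omega))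
  refine ⟨.seq P0 (.seq Pn (.seq (.loop (d + 1) (.seq Ps (.seq (.clear d)
    (.seq (.move (d + 3) d) (.inc (d + 2)))))) (.clear (d + 2)))),
    fun a s B hsr hd hp (hB : bn a + b0 a + r a + (Ctx.size a + n a + r a) ^ e ≤ B) => ?_⟩
  set T : ℕ → St := fun k => ((s.set d (R a (n a - k))).set (d + 1) k).set (d + 2) (n a - k) with hT
  have d1 := hd (d + 1) (by omega)
  have d2 := hd (d + 2) (by omega)
  have d3 := hd (d + 3) (by omega)
  refine .seq (hP0 a s B hsr hd hp (by omega)) (.seq (hPn a _ B (fun i hi => ?_) (fun i hi => ?_) hp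
    (by omega)) (.seq (t := T 0) ((Exec.loop_of T (n a) (fun k _ => ?_) (fun k hk => ?_)).cast ?_ rfl)
    ((exec_clear _ _ _ _).cast rfl ?_)))
  · have := hσ i hi
    rw [St.set_reg, if_neg (by omega), hsr i hi]
  · rw [St.set_reg, if_neg (by omega), hd i (by omega)]
  · simp [hT]
  · have hi : n a - (k + 1) < n a := by omega
    have hi' : n a - (k + 1) + 1 = n a - k := by omega
    have hRi := hrb a (n a - (k + 1)) (by omega)
    have hRi' := hrb a (n a - k) (by omega)
    have hk' := hnb a
    have h1 := hPs ⟨((a, n a - (k + 1)), R a (n a - (k + 1))), hi, rfl⟩ ((T (k + 1)).set (d + 1) k) B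
      (reg_extend (a := ((a, n a - (k + 1)) : α × ℕ)) (reg_extend (fun i hi => by
        have := hσ i hi
        simp only [hT, St.set_reg]
        rw [if_neg (by omega), if_neg (by omega), if_neg (by omega), if_neg (by omega), hsr i hi])
        (by simp [hT])) (by simp [hT]))
      (fun i hi => by
        simp only [hT, St.set_reg]
        rw [if_neg (by omega), if_neg (by omega), if_neg (by omega), if_neg (by omega),
          hd i (by omega)]) hp
      (by
        refine ((hbs _).trans (Nat.pow_le_pow_left (m := Ctx.size a + n a + r a) ?_ e)).trans
          (le_trans ?_ hB)
        · change Ctx.size a + (n a - (k + 1)) + R a (n a - (k + 1)) ≤ _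
          omega
        · omega)
    refine .seq h1 (.seq (exec_clear _ _ _ _) (.seq (exec_move (by omega) ?_) ((Exec.inc ?_).cast rfl ?_)))
    · simp only [St.set_reg, hi']
      simp; omega
    · simp only [hT, St.set_reg]
      simp; omega
    · refine St.ext' (fun i => ?_) rfl rfl
      simp only [hT, St.set_reg, hi']
      grind
  · refine St.ext' (fun i => ?_) rfl rfl
    simp only [hT, St.set_reg, Nat.sub_self]
    grind
  · refine St.ext' (fun i => ?_) rfl rfl
    simp only [hT, St.set_reg, Nat.sub_zero]
    grind

/-- Unbounded search: `s₀ a` is computable if it can be recognized when reached from below. -/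
theorem LS.search {s₀ : α → ℕ} (h0 : PolyB s₀)
    (hs : LS fun c : {c : α × ℕ // c.2 ≤ s₀ c.1} => if c.1.2 = s₀ c.1.1 then 0 else 1) : LS s₀ := by
  obtain ⟨bs, ⟨e, hbs⟩, hsb, Hs⟩ := hs
  refine ⟨fun a => s₀ a + 2 + (Ctx.size a + s₀ a) ^ e,
    (h0.add (.const 2)).add ((PolyB.size.add h0).pow e),
    fun a => by dsimp only; omega, fun σ d hσ => ?_⟩
  obtain ⟨Ps, hPs⟩ := Hs (Function.update σ (Ctx.num α) d) (d + 2)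
    (lt_extend hσ (by omega) (by omega))
  -- Register d is the candidate, d + 1 the request for another round, d + 2 the outcome of the
  -- test. The inner loop serves as a conditional, as the outcome is 0 or 1.
  refine ⟨.seq (.inc (d + 1)) (.loop (d + 1) (.seq Ps (.loop (d + 2) (.seq (.inc d) (.inc (d + 1)))))),
    fun a s B hsr hd hp (hB : s₀ a + 2 + (Ctx.size a + s₀ a) ^ e ≤ B) => ?_⟩
  have d1 := hd (d + 1) (by omega)
  have d2 := hd (d + 2) (by omega)
  have dd := hd d le_rfl
  refine .seq (.inc (by omega)) ?_
  have key : ∀ k ≤ s₀ a, Exec (inp a) B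
      (.loop (d + 1) (.seq Ps (.loop (d + 2) (.seq (.inc d) (.inc (d + 1))))))
      ((s.set d (s₀ a - k)).set (d + 1) 1) (s.set d (s₀ a)) := by
    have step : ∀ k ≤ s₀ a, Exec (inp a) B Ps (((s.set d (s₀ a - k)).set (d + 1) 1).set (d + 1) 0)
        ((((s.set d (s₀ a - k)).set (d + 1) 1).set (d + 1) 0).set (d + 2)
          (if s₀ a - k = s₀ a then 0 else 1)) := by
      intro k hk
      refine hPs ⟨(a, s₀ a - k), Nat.sub_le _ _⟩ _ B
        (reg_extend (fun i hi => ?_) (by simp)) (fun i hi => ?_) hp ?_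
      · have := hσ i hi
        simp only [St.set_reg]
        rw [if_neg (by omega), if_neg (by omega), if_neg (by omega), hsr i hi]
      · simp only [St.set_reg]
        rw [if_neg (by omega), if_neg (by omega), if_neg (by omega), hd i (by omega)]
      · refine ((hbs _).trans (Nat.pow_le_pow_left (m := Ctx.size a + s₀ a) ?_ e)).trans
          (le_trans ?_ hB)
        · change Ctx.size a + (s₀ a - k) ≤ _
          omega
        · omega
    intro k hk
    have h1 := step k hk
    induction k with
    | zero =>
      refine (Exec.loop_succ (n := 0) (by simp) (.seq h1 (.loop_zero (by simp)))
        (.loop_zero (by simp))).cast rfl (St.ext' (fun i => ?_) rfl rfl)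
      simp only [St.set_reg]
      grind
    | succ k ih =>
      have ih := ih (by omega) (step k (by omega))
      rw [if_neg (by omega)] at h1
      refine .loop_succ (n := 0) (by simp) (.seq h1 (.loop_succ (n := 0) (by simp)
        (.seq (.inc ?_) (.inc ?_)) (.loop_zero ?_))) (ih.cast ?_ rfl)
      · simp; omega
      · simp; omega
      · simp
      · refine St.ext' (fun i => ?_) rfl rfl
        simp only [St.set_reg]
        grind
  refine (key (s₀ a) le_rfl).cast ?_ rfl
  refine St.ext' (fun i => ?_) rfl rfl
  simp only [St.set_reg]
  grind

/-! ### Arithmetic and predicates -/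

/-- A case distinction is a recursion of length n a that starts with f and takes the value g after
every step. -/
theorem LS.condNat {n f g : α → ℕ} (hn : LS n) (hf : LS f) (hg : LS g) :
    LS fun a => if n a = 0 then f a else g a := by
  refine LS.rec (R := fun a i => if i = 0 then f a else g a) hn (hf.congr fun a => by simp)
    ⟨_, hf.polyB.add hg.polyB, fun a i _ => ?_⟩
    ((hg.wk.wk.restrict _).congr fun c => by simp)
  split_ifs <;> omega

theorem LS.pred {f : α → ℕ} (hf : LS f) : LS fun a => f a - 1 :=
  LS.rec (R := fun _ i => i - 1) hf .zero ⟨_, hf.polyB, fun a i _ => by omega⟩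
    ((LS.var.wk.restrict _).congr fun c => by simp)

theorem LS.sub {f g : α → ℕ} (hf : LS f) (hg : LS g) : LS fun a => f a - g a :=
  LS.rec (R := fun a i => f a - i) hg hf ⟨_, hf.polyB, fun a i _ => by omega⟩
    ((LS.var.pred.restrict _).congr fun c => by rw [c.2.2]; dsimp only; omega)

theorem LS.mul {f g : α → ℕ} (hf : LS f) (hg : LS g) : LS fun a => f a * g a :=
  LS.rec (R := fun a i => f a * i) hg .zero
    ⟨_, hf.polyB.mul hg.polyB, fun a i hi => Nat.mul_le_mul_left _ hi⟩
    (((LS.var.add hf.wk.wk).restrict _).congr fun c => by rw [c.2.2]; ring)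

theorem LS.sum {n : α → ℕ} {f : α × ℕ → ℕ} (hn : LS n) (hf : LS f) :
    LS fun a => ∑ j ∈ Finset.range (n a), f (a, j) := by
  obtain ⟨e, he⟩ := hf.polyB
  refine LS.rec (R := fun a i => ∑ j ∈ Finset.range i, f (a, j)) hn .zero
    ⟨_, hn.polyB.mul ((PolyB.size.add hn.polyB).pow e), fun a i hi => ?_⟩
    (((LS.var.add hf.wk).restrict _).congr fun c => by
      rw [c.2.2, Finset.sum_range_succ])
  refine (Finset.sum_le_card_nsmul _ _ ((Ctx.size a + n a) ^ e) fun j hj => ?_).trans ?_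
  · refine (he (a, j)).trans (Nat.pow_le_pow_left ?_ e)
    have := Finset.mem_range.1 hj
    change Ctx.size a + j ≤ _
    omega
  · simpa using Nat.mul_le_mul_right _ hi

/-- Predicates with computable characteristic function. -/
def LSP (p : α → Prop) : Prop := LS fun a => open Classical in if p a then 1 else 0

theorem LSP.congr {p q : α → Prop} (hp : LSP p) (h : ∀ a, p a ↔ q a) : LSP q := by
  rwa [← (funext fun a => propext (h a) : p = q)]

theorem LS.ite {p : α → Prop} [DecidablePred p] {f g : α → ℕ} (hp : LSP p) (hf : LS f)
    (hg : LS g) : LS fun a => if p a then f a else g a :=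
  (LS.condNat hp hg hf).congr fun a => by by_cases h : p a <;> simp [h]

theorem LSP.restrict {p : α → Prop} (hp : LSP p) (q : α → Prop) :
    LSP fun c : {a // q a} => p c.1 := LS.restrict hp q

theorem LSP.not {p : α → Prop} (hp : LSP p) : LSP fun a => ¬ p a :=
  (LS.condNat hp (.const 1) .zero).congr fun a => by by_cases h : p a <;> simp [h]

theorem LSP.and {p q : α → Prop} (hp : LSP p) (hq : LSP q) : LSP fun a => p a ∧ q a :=
  (LS.condNat hp .zero hq).congr fun a => by by_cases h : p a <;> by_cases h' : q a <;> simp [h, h']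

theorem LSP.or {p q : α → Prop} (hp : LSP p) (hq : LSP q) : LSP fun a => p a ∨ q a :=
  (hp.not.and hq.not).not.congr fun a => by tauto

theorem LSP.imp {p q : α → Prop} (hp : LSP p) (hq : LSP q) : LSP fun a => p a → q a :=
  (hp.not.or hq).congr fun a => by tauto

theorem LSP.iff {p q : α → Prop} (hp : LSP p) (hq : LSP q) : LSP fun a => p a ↔ q a :=
  ((hp.imp hq).and (hq.imp hp)).congr fun a => by tauto

theorem LSP.eq_zero {f : α → ℕ} (hf : LS f) : LSP fun a => f a = 0 :=
  (LS.condNat hf (.const 1) .zero).congr fun a => by by_cases h : f a = 0 <;> simp [h]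

theorem LSP.le {f g : α → ℕ} (hf : LS f) (hg : LS g) : LSP fun a => f a ≤ g a :=
  (LSP.eq_zero (hf.sub hg)).congr fun a => by omega

theorem LSP.lt {f g : α → ℕ} (hf : LS f) (hg : LS g) : LSP fun a => f a < g a :=
  LSP.le hf.succ hg

theorem LSP.eq {f g : α → ℕ} (hf : LS f) (hg : LS g) : LSP fun a => f a = g a :=
  ((LSP.le hf hg).and (LSP.le hg hf)).congr fun a => by omega

theorem LSP.trivial : LSP fun _ : α => True := (LSP.eq_zero .zero).congr fun _ => by simp

theorem LSP.bex {n : α → ℕ} {p : α × ℕ → Prop} (hn : LS n) (hp : LSP p) :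
    LSP fun a => ∃ j < n a, p (a, j) :=
  (LSP.eq_zero (LS.sum hn hp)).not.congr
    fun a => by simp

theorem LSP.ball {n : α → ℕ} {p : α × ℕ → Prop} (hn : LS n) (hp : LSP p) :
    LSP fun a => ∀ j < n a, p (a, j) :=
  (LSP.bex hn hp.not).not.congr fun a => by simp

/-- A bounded function with computable graph is computable. -/
theorem LS.of_graph {n F : α → ℕ} (hn : LS n) (hF : ∀ a, F a ≤ n a)
    (hg : LSP fun c : α × ℕ => c.2 = F c.1) : LS F := by
  classical
  refine (LS.sum (f := fun c : α × ℕ => if c.2 = F c.1 then c.2 else 0) hn.succ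
    (LS.ite (p := fun c : α × ℕ => c.2 = F c.1) hg LS.var .zero)).congr fun a => ?_
  have := hF a
  simp; omega

theorem LS.div {f g : α → ℕ} (hf : LS f) (hg : LS g) : LS fun a => f a / g a := by
  refine LS.of_graph hf (fun a => Nat.div_le_self _ _)
    ((((LSP.eq_zero hg.wk).and (LSP.eq_zero LS.var)).or ((LSP.lt .zero hg.wk).and
      ((LSP.le (LS.var.mul hg.wk) hf.wk).and (LSP.lt hf.wk (LS.var.succ.mul hg.wk))))).congr
      fun c => ?_)
  rcases Nat.eq_zero_or_pos (g c.1) with h | h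
  · simp [h]
  · rw [eq_comm (a := c.2) (b := f c.1 / g c.1), Nat.div_eq_iff h]
    simp only [h.ne', false_and, h, true_and, false_or]
    have : (c.2 + 1) * g c.1 = c.2 * g c.1 + g c.1 := by ring
    omega

theorem LS.mod {f g : α → ℕ} (hf : LS f) (hg : LS g) : LS fun a => f a % g a :=
  (hf.sub (hg.mul (hf.div hg))).congr fun a => by
    have := Nat.div_add_mod (f a) (g a)
    omega

theorem LS.div_two_pow {f g : α → ℕ} (hf : LS f) (hg : LS g) : LS fun a => f a / 2 ^ g a :=
  LS.rec (R := fun a i => f a / 2 ^ i) hg (hf.congr fun a => by simp)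
    ⟨_, hf.polyB, fun a i _ => Nat.div_le_self _ _⟩
    (((LS.var.div (.const 2)).restrict _).congr fun c => by
      rw [c.2.2, Nat.div_div_eq_div_mul, pow_succ])

theorem LSP.testBit {f g : α → ℕ} (hf : LS f) (hg : LS g) :
    LSP fun a => (f a).testBit (g a) = true :=
  (LSP.eq ((hf.div_two_pow hg).mod (.const 2)) (.const 1)).congr fun a => by
    rw [Nat.testBit_eq_decide_div_mod_eq]; simp

theorem LS.natSize {f : α → ℕ} (hf : LS f) : LS fun a => Nat.size (f a) := by
  refine LS.of_graph hf (fun a => Nat.size_le.2 Nat.lt_two_pow_self)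
    (((LSP.eq_zero (hf.wk.div_two_pow LS.var)).and ((LSP.eq_zero LS.var).or
      (LSP.eq_zero (hf.wk.div_two_pow LS.var.pred)).not)).congr fun c => ?_)
  rw [Nat.div_eq_zero_iff, Nat.div_eq_zero_iff]
  simp only [Nat.pow_eq_zero, OfNat.ofNat_ne_zero, false_and, false_or,
    ← Nat.size_le, ne_eq]
  constructor
  · rintro ⟨h1, h2 | h2⟩
    · omega
    · omega
  · intro h
    refine ⟨h.ge, ?_⟩
    by_cases h0 : c.2 = 0
    · exact .inl h0
    · right
      omega

theorem LS.pair {f g : α → ℕ} (hf : LS f) (hg : LS g) : LS fun a => Nat.pair (f a) (g a) :=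
  LS.ite (LSP.lt hf hg) ((hg.mul hg).add hf) (((hf.mul hf).add hf).add hg)

theorem LS.unpair_left {f : α → ℕ} (hf : LS f) : LS fun a => (f a).unpair.1 :=
  LS.of_graph hf (fun a => Nat.unpair_left_le _)
    ((LSP.bex hf.wk.succ (LSP.eq (LS.var.wk.pair LS.var) hf.wk.wk)).congr fun c => by
      constructor
      · rintro ⟨j, -, h⟩
        rw [← h, Nat.unpair_pair]
      · intro h
        refine ⟨(f c.1).unpair.2, Nat.lt_succ_of_le (Nat.unpair_right_le _), ?_⟩
        simp only [h, Nat.pair_unpair])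

theorem LS.unpair_right {f : α → ℕ} (hf : LS f) : LS fun a => (f a).unpair.2 :=
  LS.of_graph hf (fun a => Nat.unpair_right_le _)
    ((LSP.bex hf.wk.succ (LSP.eq (LS.var.pair LS.var.wk) hf.wk.wk)).congr fun c => by
      constructor
      · rintro ⟨j, -, h⟩
        rw [← h, Nat.unpair_pair]
      · intro h
        refine ⟨(f c.1).unpair.1, Nat.lt_succ_of_le (Nat.unpair_left_le _), ?_⟩
        simp only [h, Nat.pair_unpair])

theorem LS.iterate {n f : α → ℕ} {F : α → ℕ → ℕ} (hn : LS n) (hf : LS f)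
    (hF : LS fun c : (α × ℕ) × ℕ => F c.1.1 c.2)
    (hb : ∃ r, PolyB r ∧ ∀ a, ∀ i ≤ n a, (F a)^[i] (f a) ≤ r a) :
    LS fun a => (F a)^[n a] (f a) :=
  LS.rec (R := fun a i => (F a)^[i] (f a)) hn hf hb
    ((hF.restrict _).congr fun c => by rw [c.2.2, Function.iterate_succ_apply'])

/-! ### Computable functions, in contexts with enough slack -/

/-- `f` is computable in contexts whose size is bounded from below by some computable `g`. -/
def SlackLS (f : ℕ → ℕ) : Prop :=
  ∃ g : ℕ → ℕ, Computable g ∧ ∀ (α : Type) [Ctx α] (h : α → ℕ), LS h →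
    (∀ a, g (h a) ≤ Ctx.size a) → LS fun a => f (h a)

theorem computable_sum {g : ℕ → ℕ → ℕ} {n : ℕ → ℕ} (hg : Computable₂ g) (hn : Computable n) :
    Computable fun v => ∑ i ∈ Finset.range (n v), g v i := by
  have h : Computable fun v => Nat.rec (motive := fun _ => ℕ) 0 (fun i acc => acc + g v i) (n v) :=
    Computable.nat_rec hn (.const 0)
      (Primrec.nat_add.to_comp.comp (Computable.snd.comp Computable.snd)
        (hg.comp Computable.fst (Computable.fst.comp Computable.snd))).to₂
  refine h.of_eq fun v => ?_
  induction n v with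
  | zero => rfl
  | succ k ih => rw [Finset.sum_range_succ, ← ih]

theorem computable_add {f g : ℕ → ℕ} (hf : Computable f) (hg : Computable g) :
    Computable fun v => f v + g v := Primrec.nat_add.to_comp.comp hf hg

/-- Primitive recursion is `LS.rec` once its intermediate values are polynomially bounded. A slack
that is at least the sum of all of them, and of the slack needed by each step, achieves this and is
itself computable. -/
theorem slackLS_of_primrec {f : ℕ → ℕ} (hf : Nat.Primrec f) : SlackLS f := by
  induction hf with
  | zero => exact ⟨fun _ => 0, .const 0, fun α _ h _ _ => .zero⟩
  | succ => exact ⟨fun _ => 0, .const 0, fun α _ h hh _ => hh.succ⟩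
  | left => exact ⟨fun _ => 0, .const 0, fun α _ h hh _ => hh.unpair_left⟩
  | right => exact ⟨fun _ => 0, .const 0, fun α _ h hh _ => hh.unpair_right⟩
  | pair _ _ ih1 ih2 =>
    obtain ⟨g1, hg1, H1⟩ := ih1
    obtain ⟨g2, hg2, H2⟩ := ih2
    exact ⟨_, computable_add hg1 hg2, fun α _ h hh hs =>
      (H1 α h hh fun a => (Nat.le_add_right _ _).trans (hs a)).pair
        (H2 α h hh fun a => (Nat.le_add_left _ _).trans (hs a))⟩
  | @comp f g hf hg ih1 ih2 =>
    obtain ⟨g1, hg1, H1⟩ := ih1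
    obtain ⟨g2, hg2, H2⟩ := ih2
    have hg' : Computable g := (Primrec.nat_iff.2 hg).to_comp
    exact ⟨_, computable_add (hg1.comp hg') hg2, fun α _ h hh hs =>
      H1 α (fun a => g (h a)) (H2 α h hh fun a => (Nat.le_add_left _ _).trans (hs a))
        fun a => (Nat.le_add_right _ _).trans (hs a)⟩
  | @prec f g hf hg ih1 ih2 =>
    obtain ⟨g1, hg1, H1⟩ := ih1
    obtain ⟨g2, hg2, H2⟩ := ih2
    have hf' : Computable f := (Primrec.nat_iff.2 hf).to_comp
    have hg' : Computable g := (Primrec.nat_iff.2 hg).to_comp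
    have hl : Computable fun v : ℕ => v.unpair.1 := Computable.fst.comp Computable.unpair
    have hr : Computable fun v : ℕ => v.unpair.2 := Computable.snd.comp Computable.unpair
    have hpair : Computable₂ Nat.pair := Primrec₂.natPair.to_comp
    set R : ℕ → ℕ → ℕ := fun v i => Nat.rec (motive := fun _ => ℕ) (f v.unpair.1)
      (fun y IH => g (Nat.pair v.unpair.1 (Nat.pair y IH))) i with hR
    have hRc : Computable₂ R := by
      refine Computable.nat_rec (f := fun p : ℕ × ℕ => p.2) (g := fun p : ℕ × ℕ => f p.1.unpair.1)
        (h := fun (p : ℕ × ℕ) (q : ℕ × ℕ) => g (Nat.pair p.1.unpair.1 (Nat.pair q.1 q.2)))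
        Computable.snd (hf'.comp (hl.comp Computable.fst)) ?_
      exact hg'.comp (hpair.comp (hl.comp (Computable.fst.comp Computable.fst))
        (hpair.comp (Computable.fst.comp Computable.snd) (Computable.snd.comp Computable.snd)))
    refine ⟨fun v => g1 v.unpair.1 + ∑ i ∈ Finset.range (v.unpair.2 + 1),
      (R v i + g2 (Nat.pair v.unpair.1 (Nat.pair i (R v i)))), computable_add (hg1.comp hl)
        (computable_sum (g := fun v i => R v i + g2 (Nat.pair v.unpair.1 (Nat.pair i (R v i)))) ?_
          (Computable.succ.comp hr)), fun α _ h hh hs => ?_⟩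
    · exact Primrec.nat_add.to_comp.comp hRc (hg2.comp (hpair.comp (hl.comp Computable.fst)
        (hpair.comp Computable.snd hRc)))
    · have hb : ∀ a, ∀ i ≤ (h a).unpair.2,
          R (h a) i + g2 (Nat.pair (h a).unpair.1 (Nat.pair i (R (h a) i))) ≤ Ctx.size a := by
        intro a i hi
        refine le_trans ?_ ((Nat.le_add_left _ _).trans (hs a))
        exact Finset.single_le_sum (f := fun i => R (h a) i +
          g2 (Nat.pair (h a).unpair.1 (Nat.pair i (R (h a) i)))) (fun _ _ => Nat.zero_le _)
          (Finset.mem_range.2 (Nat.lt_succ_of_le hi))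
      refine LS.rec (n := fun a => (h a).unpair.2) (R := fun a i => R (h a) i) hh.unpair_right
        (H1 α _ hh.unpair_left fun a => (Nat.le_add_right _ _).trans (hs a))
        ⟨_, PolyB.size, fun a i hi => (Nat.le_add_right _ _).trans (hb a i hi)⟩ ?_
      refine (H2 _ (fun c : StepCtx _ _ => Nat.pair (h c.1.1.1).unpair.1 (Nat.pair c.1.1.2 c.1.2))
        ((hh.unpair_left.wk.wk.pair (LS.var.wk.pair LS.var)).restrict _) fun c => ?_).congr
        fun c => by rw [c.2.2]
      have := hb c.1.1.1 c.1.1.2 c.2.1.le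
      have h2 := c.2.2
      simp only at h2
      rw [h2]
      change _ ≤ Ctx.size c.1.1.1 + c.1.1.2 + c.1.2
      omega

/-- Kleene normal form: evaluation with a step bound is primitive recursive, so `LS.search` finds
the least sufficient step bound. The slack dominates this bound and the cost of every test made on
the way. -/
theorem slackLS_of_computable {f : ℕ → ℕ} (hf : Computable f) : SlackLS f := by
  obtain ⟨c, hc⟩ := Nat.Partrec.Code.exists_code.1 (Partrec.nat_iff.1 hf)
  set e : ℕ → ℕ := fun v => Encodable.encode (Nat.Partrec.Code.evaln v.unpair.1 c v.unpair.2) with he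
  have hep : Primrec e := by
    refine Primrec.encode.comp (Nat.Partrec.Code.primrec_evaln.comp
      (Primrec.pair (Primrec.pair ?_ (Primrec.const c)) ?_))
    · exact Primrec.fst.comp Primrec.unpair
    · exact Primrec.snd.comp Primrec.unpair
  obtain ⟨ge, hge, He⟩ := slackLS_of_primrec (Primrec.nat_iff.1 hep)
  have hmem : ∀ k v, v ∈ Nat.Partrec.Code.eval c k ↔ v = f k := by
    intro k v
    have := congrFun hc k
    rw [this]; simp [Part.mem_some_iff]
  have hex : ∀ k, ∃ s, e (Nat.pair s k) ≠ 0 := by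
    intro k
    obtain ⟨s, hs⟩ := Nat.Partrec.Code.evaln_complete.1 ((hmem k (f k)).2 rfl)
    refine ⟨s, ?_⟩
    rw [Option.mem_def] at hs
    simp [he, hs]
  have hval : ∀ k s, e (Nat.pair s k) ≠ 0 → e (Nat.pair s k) = f k + 1 := by
    intro k s hs
    rcases h : Nat.Partrec.Code.evaln s c k with _ | v
    · simp [he, h] at hs
    · have := (hmem k v).1 (Nat.Partrec.Code.evaln_sound (k := s) h)
      simp [he, h, this]
  set s₀ : ℕ → ℕ := fun k => Nat.find (hex k) with hs₀
  have hpair : Computable₂ Nat.pair := Primrec₂.natPair.to_comp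
  have hs₀c : Computable s₀ := by
    have hp : Computable₂ fun (k s : ℕ) => decide (e (Nat.pair s k) ≠ 0) := by
      have h1 : PrimrecPred fun p : ℕ × ℕ => ¬ e (Nat.pair p.2 p.1) = 0 :=
        (Primrec.eq.comp (hep.comp (Primrec₂.natPair.comp Primrec.snd Primrec.fst))
          (Primrec.const 0)).not
      exact h1.decide.to_comp
    have h2 := Partrec.rfind hp.partrec₂
    refine h2.of_eq fun k => ?_
    refine Part.eq_some_iff.2 (Nat.mem_rfind.2 ⟨?_, fun {m} hm => ?_⟩)
    · simpa using Nat.find_spec (hex k)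
    · have := Nat.find_min (hex k) hm
      simpa using this
  refine ⟨fun k => s₀ k + ∑ s ∈ Finset.range (s₀ k + 1), ge (Nat.pair s k),
    computable_add hs₀c (computable_sum (g := fun k s => ge (Nat.pair s k))
      (hge.comp (hpair.comp Computable.snd Computable.fst)) (Computable.succ.comp hs₀c)),
    fun α _ h hh hs => ?_⟩
  have hb : ∀ a, ∀ s ≤ s₀ (h a), ge (Nat.pair s (h a)) ≤ Ctx.size a := by
    intro a s hsa
    refine le_trans ?_ ((Nat.le_add_left _ _).trans (hs a))
    exact Finset.single_le_sum (f := fun s => ge (Nat.pair s (h a))) (fun _ _ => Nat.zero_le _)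
      (Finset.mem_range.2 (Nat.lt_succ_of_le hsa))
  have hsearch : LS fun a => s₀ (h a) := by
    refine LS.search ⟨1, fun a => by
      rw [pow_one]; exact (Nat.le_add_right _ _).trans (hs a)⟩ ?_
    have h1 := He {c : α × ℕ // c.2 ≤ s₀ (h c.1)} (fun c => Nat.pair c.1.2 (h c.1.1))
      ((LS.var.pair hh.wk).restrict _) fun c => (hb c.1.1 c.1.2 c.2).trans (Nat.le_add_right _ _)
    refine (LS.condNat h1 (.const 1) .zero).congr fun c => ?_
    have hc := c.2
    by_cases hlt : c.1.2 < s₀ (h c.1.1)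
    · have := Nat.find_min (hex _) hlt
      simp only [ne_eq, not_not] at this
      rw [if_pos this, if_neg hlt.ne]
    · have heq : c.1.2 = s₀ (h c.1.1) := by omega
      have := Nat.find_spec (hex (h c.1.1))
      rw [if_pos heq, heq, if_neg this]
  refine (He α (fun a => Nat.pair (s₀ (h a)) (h a)) (hsearch.pair hh)
    fun a => hb a _ le_rfl).pred.congr fun a => ?_
  rw [hval _ _ (Nat.find_spec (hex (h a)))]
  rfl

/-! ### From computable functions to machines -/

/-- Logarithms turn the exponent c into a factor. The slack g could be logarithmic too, but a linear
term suffices since f may be any computable function. -/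
theorem log_bound (n g c : ℕ) :
    Nat.log 2 ((n + 2 + g) ^ c) + 3 ≤ (c + 3) * (g + 4 + Nat.log 2 n) := by
  have h1 : n < 2 ^ (Nat.log 2 n + 1) := Nat.lt_pow_succ_log_self (by norm_num) n
  have h2 : g + 2 < 2 ^ (g + 2) := Nat.lt_two_pow_self
  have h3 : n + 2 + g < 2 ^ (Nat.log 2 n + g + 4) := by
    have e : Nat.log 2 n + g + 4 = (Nat.log 2 n + 1) + (g + 2) + 1 := by ring
    rw [e, pow_succ, pow_add]
    have h4 : 1 ≤ 2 ^ (Nat.log 2 n + 1) := Nat.one_le_two_pow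
    nlinarith
  have h5 : Nat.log 2 ((n + 2 + g) ^ c) ≤ c * (Nat.log 2 n + g + 4) := by
    refine (Nat.log_mono_right (Nat.pow_le_pow_left h3.le c)).trans ?_
    rw [← pow_mul, Nat.log_pow (by norm_num), Nat.mul_comm]
  nlinarith

/-- Deciding machines for problems with computable characteristic function. -/
theorem exists_decider {κ F : List Bool → ℕ} {G : ℕ → ℕ} (hG : Computable G)
    (hF : LS fun a : {a : Inp // G (κ a.word) ≤ a.slack} => F a.1.word) :
    ∃ (M : Machine) (f : ℕ → ℕ) (C : ℕ), Computable f ∧ M.Decides {x | F x ≠ 0} ∧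
      M.RunsInSpace fun x => C * (f (κ x) + Nat.log 2 x.length) := by
  obtain ⟨b, ⟨c, hb⟩, -, H⟩ := hF
  obtain ⟨P, hP⟩ := H id 0 (fun i hi => absurd hi (Nat.not_lt_zero i))
  -- The slack is set to its least admissible value. It occurs in the space analysis only: no
  -- register holds it.
  obtain ⟨M, hM, hM'⟩ := Prog.exists_machine P 0 (fun x => (x.length + 2 + G (κ x)) ^ c)
    (fun x => St.initial.set 0 (F x)) (fun x => hP ⟨⟨x, G (κ x)⟩, le_rfl⟩ _ _
      (fun i hi => absurd hi (Nat.not_lt_zero i)) (fun _ _ => rfl) rfl (hb _))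
  refine ⟨M, fun k => G k + 4, c + 3, Primrec.nat_add.to_comp.comp hG (.const 4), fun x => ?_,
    fun x d hd i => (hM x d hd i).trans_le (log_bound _ _ _)⟩
  obtain ⟨d, hd, -, hd'⟩ := hM' x
  exact ⟨d, hd, by simpa using hd'⟩

theorem bits_of_pos {v : ℕ} (hv : v ≠ 0) : v.bits = decide (v % 2 ≠ 0) :: (v / 2).bits := by
  obtain ⟨b, n, rfl⟩ : ∃ b n, v = Nat.bit b n := ⟨_, _, (Nat.bit_bodd_div2 v).symm⟩
  rw [Nat.bits_append_bit n b fun h => by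
    cases b
    · exact absurd (by simp [h]) hv
    · rfl]
  have h1 : Nat.bit b n / 2 = n := by
    rw [← Nat.div2_val, Nat.div2_bit]
  have h2 : Nat.bit b n % 2 = b.toNat := by
    rw [Nat.bit_val]; cases b <;> simp
  rw [h1, h2]
  cases b <;> rfl

/-- Functions computable in logarithmic space, with output in binary. -/
theorem logspaceComputable_of_LS {κ : List Bool → ℕ} (h : LS fun a : Inp => κ a.word) :
    LogspaceComputable κ := by
  obtain ⟨b, hb, hκb, H⟩ := h
  obtain ⟨b1, ⟨e1, hb1⟩, -, H1⟩ := (LS.var (α := Inp)).mod (.const 2)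
  obtain ⟨b2, ⟨e2, hb2⟩, -, H2⟩ := (LS.var (α := Inp)).div (.const 2)
  have hκ : PolyB fun a : Inp => κ a.word := hb.mono hκb
  obtain ⟨c, hc⟩ : PolyB fun a : Inp => b a + (Ctx.size a + κ a.word) ^ e1 +
      (Ctx.size a + κ a.word) ^ e2 := (hb.add ((PolyB.size.add hκ).pow e1)).add
        ((PolyB.size.add hκ).pow e2)
  obtain ⟨P, hP⟩ := H id 0 (fun i hi => absurd hi (Nat.not_lt_zero i))
  obtain ⟨P1, hP1⟩ := H1 (fun _ => 0) 1 (fun i hi => Nat.one_pos)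
  obtain ⟨P2, hP2⟩ := H2 (fun _ => 0) 1 (fun i hi => Nat.one_pos)
  -- Each round outputs v mod 2 and replaces v by v / 2. The increment undoes the decrement made by
  -- the loop test, and `emit`, which decrements, leaves the scratch register 1 at 0.
  set L : Prog := .loop 0 (.seq (.inc 0) (.seq P1 (.seq (.emit 1) (.seq P2 (.seq (.clear 0)
    (.move 1 0)))))) with hL
  have hreg : ∀ (x : List Bool) (s : St) (v : ℕ), s.reg 0 = v →
      ∀ i < Ctx.num (Inp × ℕ), s.reg ((fun _ => 0) i) = Ctx.reg ((⟨x, 0⟩, v) : Inp × ℕ) i := by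
    intro x s v hs i hi
    have hi : i < 0 + 1 := hi
    obtain rfl : i = 0 := by omega
    change s.reg 0 = Function.update (fun _ => 0 : ℕ → ℕ) 0 v 0
    rw [hs, Function.update_self]
  have key : ∀ (x : List Bool) (v : ℕ) (o : List Bool), v ≤ κ x → ∀ s : St, s.reg 0 = v →
      (∀ i ≥ 1, s.reg i = 0) → s.pos = 0 → s.out = o →
      Exec x ((x.length + 2) ^ c) L s { s.set 0 0 with out := o ++ v.bits } := by
    intro x v
    induction v using Nat.strong_induction_on with
    | _ v ih =>
      intro o hv s h0 hs hp ho
      have hB := hc ⟨x, 0⟩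
      change b ⟨x, 0⟩ + (x.length + 2 + 0 + κ x) ^ e1 + (x.length + 2 + 0 + κ x) ^ e2 ≤
        (x.length + 2) ^ c at hB
      have hκB : κ x ≤ b ⟨x, 0⟩ := hκb ⟨x, 0⟩
      rcases Nat.eq_zero_or_pos v with rfl | hpos
      · refine (Exec.loop_zero h0).cast rfl ?_
        have := St.set_reg_self s 0
        rw [h0] at this
        simp [this, ← ho]
      · have hb1' : b1 (⟨x, 0⟩, v) ≤ (x.length + 2) ^ c := by
          refine (hb1 _).trans ((Nat.pow_le_pow_left (m := x.length + 2 + 0 + κ x) ?_ e1).trans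
            (by omega))
          exact Nat.add_le_add_left hv _
        have hb2' : b2 (⟨x, 0⟩, v) ≤ (x.length + 2) ^ c := by
          refine (hb2 _).trans ((Nat.pow_le_pow_left (m := x.length + 2 + 0 + κ x) ?_ e2).trans
            (by omega))
          exact Nat.add_le_add_left hv _
        have hv1 : v - 1 + 1 = v := by omega
        have s0 : (s.set 0 (v - 1)).set 0 ((s.set 0 (v - 1)).reg 0 + 1) = s := by
          rw [St.set_set, St.set_reg, if_pos rfl, hv1, ← h0, St.set_reg_self]
        have x1 := hP1 (⟨x, 0⟩, v) s _ (hreg x s v h0) hs hp hb1'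
        have x2 := Exec.emit (x := x) (B := (x.length + 2) ^ c) (r := 1) (s := s.set 1 (v % 2))
        have e2' : ({ (s.set 1 (v % 2)).set 1 ((s.set 1 (v % 2)).reg 1 - 1) with
            out := (s.set 1 (v % 2)).out ++ [decide ((s.set 1 (v % 2)).reg 1 ≠ 0)] } : St) =
            { s with out := o ++ [decide (v % 2 ≠ 0)] } := by
          have h1 := hs 1 le_rfl
          have : v % 2 - 1 = 0 := by omega
          have h2 := St.set_reg_self s 1
          rw [h1] at h2
          simp [St.set_set, this, h2, ho]
        set s' : St := { s with out := o ++ [decide (v % 2 ≠ 0)] } with hs'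
        have x3 := hP2 (⟨x, 0⟩, v) s' _ (hreg x s' v h0) hs hp hb2'
        have x4 := exec_move (x := x) (B := (x.length + 2) ^ c) (r := 1) (r' := 0)
          (s := (s'.set 1 (v / 2)).set 0 0) (by omega) (by simp; omega)
        have x5 := ih (v / 2) (by omega) (o ++ [decide (v % 2 ≠ 0)]) (by omega)
          (s'.set 0 (v / 2)) (by simp) (fun i hi => by
            rw [St.set_reg, if_neg (by omega)]; exact hs i hi) hp rfl
        refine .loop_succ (n := v - 1) (by omega) (.seq (.inc (by simp; omega))
          (.seq (x1.cast s0.symm rfl) (.seq (x2.cast rfl e2') (.seq x3 (.seq (exec_clear _ _ _ _)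
            (x4.cast rfl ?_)))))) (x5.cast rfl ?_)
        · refine St.ext' (fun i => ?_) rfl rfl
          have : s'.reg 1 = 0 := hs 1 le_rfl
          simp only [St.set_reg]
          grind
        · rw [bits_of_pos hpos.ne', St.set_set]
          simp [hs', St.set]
  obtain ⟨M, hM, hM'⟩ := Prog.exists_machine (.seq P L) 0 (fun x => (x.length + 2) ^ c)
    (fun x => { St.initial.set 0 0 with out := (κ x).bits }) (fun x => by
      have hB := hc ⟨x, 0⟩
      change b ⟨x, 0⟩ + (x.length + 2 + 0 + κ x) ^ e1 + (x.length + 2 + 0 + κ x) ^ e2 ≤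
        (x.length + 2) ^ c at hB
      refine .seq (hP ⟨x, 0⟩ _ _ (fun i hi => absurd hi (Nat.not_lt_zero i)) (fun _ _ => rfl) rfl
        (by omega)) ((key x (κ x) [] le_rfl _ (by simp) (fun i hi => ?_) rfl rfl).cast rfl ?_)
      · rw [St.set_reg, if_neg (by omega)]; rfl
      · rw [St.set_set]; rfl)
  refine ⟨M, (c + 3) * 4, fun x => ?_, fun x d hd i => (hM x d hd i).trans_le ?_⟩
  · obtain ⟨d, hd, hd', -⟩ := hM' x
    exact ⟨d, hd, hd'⟩
  · have := log_bound x.length 0 c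
    simp only [Nat.add_zero] at this
    refine this.trans ?_
    dsimp only
    rw [Nat.mul_assoc]
    exact Nat.mul_le_mul_left _ (by omega)

/-! ### Reading codes -/

/-- The least number up to `n` with a property, `0` if there is none. -/
noncomputable def least (n : ℕ) (P : ℕ → Prop) : ℕ := sInf {i | i ≤ n ∧ P i}

theorem least_eq {n i : ℕ} {P : ℕ → Prop} (hi : i ≤ n) (hP : P i) (h : ∀ j < i, ¬ P j) :
    least n P = i := by
  refine le_antisymm (Nat.sInf_le ⟨hi, hP⟩) (not_lt.1 fun hlt => ?_)
  exact h _ hlt (Nat.sInf_mem (s := {i | i ≤ n ∧ P i}) ⟨i, hi, hP⟩).2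

theorem least_le (n : ℕ) (P : ℕ → Prop) : least n P ≤ n := by
  by_cases h : ({i | i ≤ n ∧ P i} : Set ℕ).Nonempty
  · exact (Nat.sInf_mem h).1
  · rw [Set.not_nonempty_iff_eq_empty] at h
    simp [least, h]

theorem not_of_lt_least {n i : ℕ} {P : ℕ → Prop} (h : i < least n P) : ¬ P i := fun hP =>
  absurd (Nat.sInf_le (s := {i | i ≤ n ∧ P i}) ⟨h.le.trans (least_le n P), hP⟩) (not_le.2 h)

/-- The word `w` occurs in `x` at position `p`. -/
def OccursAt (x : List Bool) (p : ℕ) (w : List Bool) : Prop := w <+: x.drop p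

theorem symAt_eq (x : List Bool) (p : ℕ) :
    symAt x p = match x[p]? with | some b => b.toNat | none => 2 := by
  unfold symAt
  rcases h : x[p]? with _ | b <;> simp [inputSym, InSym.val, h]

theorem symAt_eq_iff {x : List Bool} {p : ℕ} {b : Bool} :
    symAt x p = b.toNat ↔ x[p]? = some b := by
  rw [symAt_eq]
  rcases h : x[p]? with _ | b'
  · cases b <;> simp
  · cases b <;> cases b' <;> simp

theorem symAt_eq_one {x : List Bool} {p : ℕ} : symAt x p = 1 ↔ x[p]? = some true :=
  symAt_eq_iff (b := true)

theorem occursAt_nil (x : List Bool) (p : ℕ) : OccursAt x p [] := List.nil_prefix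

theorem occursAt_cons {x : List Bool} {p : ℕ} {b : Bool} {w : List Bool} :
    OccursAt x p (b :: w) ↔ symAt x p = b.toNat ∧ OccursAt x (p + 1) w := by
  rw [symAt_eq_iff]
  unfold OccursAt
  by_cases h : p < x.length
  · rw [List.drop_eq_getElem_cons h, List.cons_prefix_cons, List.getElem?_eq_getElem h]
    simp [eq_comm]
  · rw [List.drop_eq_nil_of_le (by omega), List.getElem?_eq_none (by omega)]
    simp

theorem occursAt_append {x : List Bool} {p : ℕ} {u v : List Bool} :
    OccursAt x p (u ++ v) ↔ OccursAt x p u ∧ OccursAt x (p + u.length) v := by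
  induction u generalizing p with
  | nil => simp [occursAt_nil]
  | cons b u ih =>
    rw [List.cons_append, occursAt_cons, ih, occursAt_cons, and_assoc]
    simp [Nat.add_assoc, Nat.add_comm 1]

theorem OccursAt.length_le {x : List Bool} {p : ℕ} {w : List Bool} (h : OccursAt x p w)
    (hp : p ≤ x.length) : p + w.length ≤ x.length := by
  have := List.IsPrefix.length_le h
  rw [List.length_drop] at this
  omega

theorem OccursAt.length_le' {x : List Bool} {p : ℕ} {w : List Bool} (h : OccursAt x p w)
    (hw : w ≠ []) : p + w.length ≤ x.length := by
  have := List.IsPrefix.length_le h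
  have := List.length_pos_of_ne_nil hw
  rw [List.length_drop] at *
  omega

/-- The function `e` finds the end of the codes of the elements of `D`, and `V` recognizes the
positions with such codes. -/
structure ParserFor {β : Type} (x : List Bool) (c : β → List Bool) (D : β → Prop) (V : ℕ → Prop)
    (e : ℕ → ℕ) : Prop where
  occurs : ∀ p b, D b → OccursAt x p (c b) → V p ∧ e p = p + (c b).length
  exists_code : ∀ p, V p → ∃ b, D b ∧ OccursAt x p (c b)

/-! #### Unary numbers -/

/-- The number with unary code at `p`. -/
noncomputable def unaryVal (x : List Bool) (p : ℕ) : ℕ :=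
  least x.length fun k => symAt x (p + k) ≠ 1

theorem occursAt_replicate {x : List Bool} {p k : ℕ} :
    OccursAt x p (List.replicate k true) ↔ ∀ i < k, symAt x (p + i) = 1 := by
  induction k with
  | zero => simp [occursAt_nil]
  | succ k ih =>
    rw [List.replicate_succ', occursAt_append, ih, List.length_replicate, occursAt_cons]
    simp only [Bool.toNat_true, occursAt_nil, and_true]
    constructor
    · rintro ⟨h1, h2⟩ i hi
      rcases Nat.lt_succ_iff_lt_or_eq.1 hi with h | rfl
      exacts [h1 i h, h2]
    · exact fun h => ⟨fun i hi => h i (by omega), h k (by omega)⟩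

theorem occursAt_unaryCode {x : List Bool} {p k : ℕ} :
    OccursAt x p (unaryCode k) ↔ (∀ i < k, symAt x (p + i) = 1) ∧ symAt x (p + k) = 0 := by
  rw [unaryCode, occursAt_append, occursAt_replicate, List.length_replicate, occursAt_cons]
  simp [occursAt_nil]

theorem unaryVal_eq {x : List Bool} {p k : ℕ} (h : OccursAt x p (unaryCode k)) :
    unaryVal x p = k := by
  have hl := h.length_le' (by simp [unaryCode])
  rw [occursAt_unaryCode] at h
  simp only [unaryCode, List.length_append, List.length_replicate, List.length_singleton] at hl
  exact least_eq (by omega) (by rw [h.2]; simp) fun j hj => by simp [h.1 j hj]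

theorem parser_unary (x : List Bool) : ParserFor x unaryCode (fun _ => True)
    (fun p => symAt x (p + unaryVal x p) = 0) (fun p => p + unaryVal x p + 1) where
  occurs p k _ h := by
    rw [unaryVal_eq h]
    exact ⟨(occursAt_unaryCode.1 h).2, by simp [unaryCode]; omega⟩
  exists_code p h := ⟨unaryVal x p, trivial, occursAt_unaryCode.2
    ⟨fun i hi => not_not.1 (not_of_lt_least hi), h⟩⟩

/-! #### Binary numbers -/

/-- The binary code of `v` occurs at position `p`. -/
def IsBin (x : List Bool) (p v : ℕ) : Prop :=
  (∀ j < v.size, symAt x (p + 2 * j) = 1 ∧ (v.testBit j = true → symAt x (p + 2 * j + 1) = 1) ∧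
    (¬ v.testBit j = true → symAt x (p + 2 * j + 1) = 0)) ∧ symAt x (p + 2 * v.size) = 0

theorem occursAt_listCode_bits {x : List Bool} {p : ℕ} {l : List Bool} :
    OccursAt x p (listCode (fun b => [b]) l) ↔
      (∀ j b, l[j]? = some b → symAt x (p + 2 * j) = 1 ∧ symAt x (p + 2 * j + 1) = b.toNat) ∧
        symAt x (p + 2 * l.length) = 0 := by
  induction l generalizing p with
  | nil => simp [listCode, occursAt_cons, occursAt_nil]
  | cons b l ih =>
    have e : listCode (fun b => [b]) (b :: l) = true :: b :: listCode (fun b => [b]) l := by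
      simp [listCode]
    rw [e, occursAt_cons, occursAt_cons, ih]
    constructor
    · rintro ⟨h1, h2, h3, h4⟩
      refine ⟨fun j b' hj => ?_, ?_⟩
      · rcases j with _ | j
        · simp only [List.getElem?_cons_zero, Option.some.injEq] at hj
          subst hj
          exact ⟨h1, h2⟩
        · have := h3 j b' (by simpa using hj)
          rw [show p + 2 * (j + 1) = p + 1 + 1 + 2 * j by ring]
          exact this
      · rw [show p + 2 * (b :: l).length = p + 1 + 1 + 2 * l.length by simp; ring]
        exact h4
    · rintro ⟨h1, h2⟩
      refine ⟨(h1 0 b rfl).1, (h1 0 b rfl).2, fun j b' hj => ?_, ?_⟩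
      · have := h1 (j + 1) b' (by simpa using hj)
        rw [show p + 2 * (j + 1) = p + 1 + 1 + 2 * j by ring] at this
        exact this
      · rw [show p + 2 * (b :: l).length = p + 1 + 1 + 2 * l.length by simp; ring] at h2
        exact h2

theorem bits_getElem? {v j : ℕ} (h : j < v.size) : v.bits[j]? = some (v.testBit j) := by
  have hl : j < v.bits.length := by rwa [← Nat.size_eq_bits_len] at h
  rw [List.getElem?_eq_getElem hl, Nat.testBit_eq_inth, List.getI_eq_getElem _ hl]

theorem occursAt_binCode {x : List Bool} {p v : ℕ} : OccursAt x p (binCode v) ↔ IsBin x p v := by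
  have hsz := Nat.size_eq_bits_len v
  rw [binCode, occursAt_listCode_bits, IsBin, hsz]
  refine and_congr_left fun _ => ⟨fun h j hj => ?_, fun h j b hb => ?_⟩
  · have := h j _ (bits_getElem? hj)
    refine ⟨this.1, fun h1 => ?_, fun h1 => ?_⟩
    · simpa [h1] using this.2
    · simpa [h1] using this.2
  · have hj : j < v.size := by
      rw [← hsz]; exact (List.getElem?_eq_some_iff.1 hb).1
    rw [bits_getElem? hj] at hb
    obtain rfl := Option.some.inj hb
    refine ⟨(h j hj).1, ?_⟩
    cases hv : v.testBit j
    · exact (h j hj).2.2 (by simp [hv])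
    · exact (h j hj).2.1 hv

theorem length_binCode (v : ℕ) : (binCode v).length = 2 * v.size + 1 := by
  rw [← Nat.size_eq_bits_len, binCode, listCode]
  simp [List.length_flatMap]
  ring

/-- The number below `n` with binary code at `p`. -/
noncomputable def elVal (x : List Bool) (n p : ℕ) : ℕ := least n (IsBin x p)

/-- The end of the binary code at `p`. -/
noncomputable def elEnd (x : List Bool) (n p : ℕ) : ℕ := p + (2 * (elVal x n p).size + 1)

theorem isBin_inj {x : List Bool} {p v w : ℕ} (hv : IsBin x p v) (hw : IsBin x p w) : v = w := by
  rw [← occursAt_binCode] at hv hw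
  obtain ⟨u, hu⟩ := hv
  obtain ⟨u', hu'⟩ := hw
  exact (binCode_prefix v w u u' (hu.trans hu'.symm)).1

theorem elVal_eq {x : List Bool} {n p v : ℕ} (hv : v < n) (h : OccursAt x p (binCode v)) :
    elVal x n p = v := by
  rw [occursAt_binCode] at h
  exact least_eq hv.le h fun j hj hj' => hj.ne (isBin_inj hj' h)

theorem parser_bin (x : List Bool) (n : ℕ) :
    ParserFor x binCode (· < n) (fun p => ∃ v < n, IsBin x p v) (elEnd x n) where
  occurs p v hv h := ⟨⟨v, hv, occursAt_binCode.1 h⟩, by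
    rw [elEnd, elVal_eq hv h, length_binCode]⟩
  exists_code p := fun ⟨v, hv, h⟩ => ⟨v, hv, occursAt_binCode.2 h⟩

/-! #### Lists -/

/-- The position of item `i` in the code of a list at `p`. -/
def listPos (x : List Bool) (e : ℕ → ℕ) (p i : ℕ) : ℕ :=
  (fun q => min (e (q + 1)) (x.length + 1))^[i] p

/-- The number of items in the code of a list at `p`. -/
noncomputable def listCount (x : List Bool) (e : ℕ → ℕ) (p : ℕ) : ℕ :=
  least x.length fun i => symAt x (listPos x e p i) ≠ 1

/-- There is a code of a list at `p`. -/
def ListOk (x : List Bool) (V : ℕ → Prop) (e : ℕ → ℕ) (p : ℕ) : Prop :=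
  symAt x (listPos x e p (listCount x e p)) = 0 ∧
    ∀ i < listCount x e p, V (listPos x e p i + 1)

/-- The end of the code of a list at `p`. -/
noncomputable def listEnd (x : List Bool) (e : ℕ → ℕ) (p : ℕ) : ℕ :=
  listPos x e p (listCount x e p) + 1

section List

variable {β : Type} {x : List Bool} {c : β → List Bool} {D : β → Prop} {V : ℕ → Prop} {e : ℕ → ℕ}

theorem listCode_cons (b : β) (l : List β) : listCode c (b :: l) = true :: (c b ++ listCode c l) := by
  simp [listCode]

theorem occursAt_listCode_cons {p : ℕ} {b : β} {l : List β} :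
    OccursAt x p (listCode c (b :: l)) ↔ symAt x p = 1 ∧ OccursAt x (p + 1) (c b) ∧
      OccursAt x (p + 1 + (c b).length) (listCode c l) := by
  rw [listCode_cons, occursAt_cons, occursAt_append]
  rfl

/-- On a genuine code the cap on positions in `listPos` is inactive, because the item ends inside
the word. -/
theorem ParserFor.next (H : ParserFor x c D V e) {p : ℕ} {b : β} (hb : D b)
    (hp : symAt x p = 1) (h : OccursAt x (p + 1) (c b)) :
    min (e (p + 1)) (x.length + 1) = p + 1 + (c b).length := by
  rw [(H.occurs _ _ hb h).2, min_eq_left]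
  rw [symAt_eq_one] at hp
  have := (List.getElem?_eq_some_iff.1 hp).1
  exact (h.length_le this).trans (Nat.le_succ _)

theorem ParserFor.listPos_spec (H : ParserFor x c D V e) {l : List β} {p : ℕ}
    (hl : ∀ b ∈ l, D b) (h : OccursAt x p (listCode c l)) :
    (∀ i b, l[i]? = some b → symAt x (listPos x e p i) = 1 ∧
      OccursAt x (listPos x e p i + 1) (c b)) ∧
    symAt x (listPos x e p l.length) = 0 ∧
    listPos x e p l.length + 1 = p + (listCode c l).length := by
  induction l generalizing p with
  | nil => simpa [listPos, listCode, occursAt_cons, occursAt_nil] using h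
  | cons b l ih =>
    rw [occursAt_listCode_cons] at h
    obtain ⟨h1, h2, h3⟩ := h
    have hn := H.next (hl b (by simp)) h1 h2
    have hs : ∀ i, listPos x e p (i + 1) = listPos x e (p + 1 + (c b).length) i := fun i => by
      rw [listPos, Function.iterate_succ_apply, hn, listPos]
    obtain ⟨h4, h5, h6⟩ := ih (fun b hb => hl b (by simp [hb])) h3
    refine ⟨fun i b' hb' => ?_, ?_, ?_⟩
    · rcases i with _ | i
      · simp only [List.getElem?_cons_zero, Option.some.injEq] at hb'
        subst hb'
        exact ⟨h1, h2⟩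
      · rw [hs]
        exact h4 i b' (by simpa using hb')
    · rw [List.length_cons, hs]; exact h5
    · rw [List.length_cons, hs, h6, listCode_cons]
      simp; ring

theorem length_le_listCode (l : List β) : l.length < (listCode c l).length := by
  induction l with
  | nil => simp [listCode]
  | cons b l ih => rw [listCode_cons]; simp; omega

theorem ParserFor.listCount_eq (H : ParserFor x c D V e) {l : List β} {p : ℕ}
    (hl : ∀ b ∈ l, D b) (h : OccursAt x p (listCode c l)) : listCount x e p = l.length := by
  obtain ⟨h1, h2, -⟩ := H.listPos_spec hl h
  have h3 := h.length_le' (by simp [listCode])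
  have h4 := length_le_listCode (c := c) l
  refine least_eq (by omega) (by rw [h2]; simp) fun j hj => ?_
  rw [not_not]
  exact (h1 j _ (List.getElem?_eq_getElem hj)).1

theorem ParserFor.exists_list (H : ParserFor x c D V e) {k p : ℕ}
    (h1 : ∀ i < k, symAt x (listPos x e p i) = 1 ∧ V (listPos x e p i + 1))
    (h2 : symAt x (listPos x e p k) = 0) :
    ∃ l, (∀ b ∈ l, D b) ∧ OccursAt x p (listCode c l) := by
  induction k generalizing p with
  | zero => exact ⟨[], by simp, by simpa [listCode, occursAt_cons, occursAt_nil, listPos] using h2⟩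
  | succ k ih =>
    obtain ⟨h3, h4⟩ := h1 0 (Nat.succ_pos k)
    obtain ⟨b, hb, h5⟩ := H.exists_code _ h4
    simp only [listPos, Function.iterate_zero, id] at h3 h5
    have hn := H.next hb h3 h5
    have hs : ∀ i, listPos x e p (i + 1) = listPos x e (p + 1 + (c b).length) i := fun i => by
      rw [listPos, Function.iterate_succ_apply, hn, listPos]
    obtain ⟨l, hl, h6⟩ := ih (p := p + 1 + (c b).length)
      (fun i hi => by rw [← hs]; exact h1 (i + 1) (by omega)) (by rw [← hs]; exact h2)
    exact ⟨b :: l, by simpa [hb] using hl, occursAt_listCode_cons.2 ⟨h3, h5, h6⟩⟩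

theorem ParserFor.list (H : ParserFor x c D V e) :
    ParserFor x (listCode c) (fun l => ∀ b ∈ l, D b) (ListOk x V e) (listEnd x e) where
  occurs p l hl h := by
    obtain ⟨h1, h2, h3⟩ := H.listPos_spec hl h
    rw [listEnd, ListOk, H.listCount_eq hl h]
    refine ⟨⟨h2, fun i hi => ?_⟩, h3⟩
    have hi' := List.getElem?_eq_getElem hi
    exact (H.occurs _ _ (hl _ (List.getElem_mem hi)) (h1 i _ hi').2).1
  exists_code p h := H.exists_list
    (fun i hi => ⟨not_not.1 (not_of_lt_least hi), h.2 i hi⟩) h.1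

end List

/-! #### Tuples -/

/-- The code of a tuple given as a list of numbers. -/
def tupCode (t : List ℕ) : List Bool := t.flatMap binCode

/-- The position of entry `j` of the tuple at `p`. -/
noncomputable def elPos (x : List Bool) (n p j : ℕ) : ℕ :=
  (fun q => min (elEnd x n q) (x.length + 1))^[j] p

/-- There is a code of a tuple of length `r` at `p`. -/
def TupOk (x : List Bool) (n r p : ℕ) : Prop := ∀ j < r, ∃ v < n, IsBin x (elPos x n p j) v

section Tuple

variable {x : List Bool} {n : ℕ}

theorem elEnd_min {p v : ℕ} (hv : v < n) (h : OccursAt x p (binCode v)) :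
    min (elEnd x n p) (x.length + 1) = p + (binCode v).length := by
  rw [((parser_bin x n).occurs _ _ hv h).2, min_eq_left]
  exact (h.length_le' (by simp [binCode, listCode])).trans (Nat.le_succ _)

theorem elPos_spec {t : List ℕ} {p : ℕ} (ht : ∀ v ∈ t, v < n) (h : OccursAt x p (tupCode t)) :
    (∀ j v, t[j]? = some v → OccursAt x (elPos x n p j) (binCode v)) ∧
      elPos x n p t.length = p + (tupCode t).length := by
  induction t generalizing p with
  | nil => simp [elPos, tupCode]
  | cons v t ih =>
    rw [tupCode, List.flatMap_cons, occursAt_append] at h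
    have hn := elEnd_min (ht v (by simp)) h.1
    have hs : ∀ i, elPos x n p (i + 1) = elPos x n (p + (binCode v).length) i := fun i => by
      rw [elPos, Function.iterate_succ_apply, hn, elPos]
    obtain ⟨h1, h2⟩ := ih (fun b hb => ht b (by simp [hb])) h.2
    refine ⟨fun j w hw => ?_, ?_⟩
    · rcases j with _ | j
      · simp only [List.getElem?_cons_zero, Option.some.injEq] at hw
        subst hw
        exact h.1
      · rw [hs]
        exact h1 j w (by simpa using hw)
    · rw [List.length_cons, hs, h2, tupCode, tupCode, List.flatMap_cons]
      simp; ring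

theorem parser_tup (x : List Bool) (n r : ℕ) :
    ParserFor x tupCode (fun t => t.length = r ∧ ∀ v ∈ t, v < n) (TupOk x n r)
      (fun p => elPos x n p r) where
  occurs p t ht h := by
    obtain ⟨rfl, ht⟩ := ht
    obtain ⟨h1, h2⟩ := elPos_spec ht h
    refine ⟨fun j hj => ⟨t[j], ht _ (List.getElem_mem hj), ?_⟩, h2⟩
    exact occursAt_binCode.1 (h1 j _ (List.getElem?_eq_getElem hj))
  exists_code p h := by
    induction r generalizing p with
    | zero => exact ⟨[], by simp, occursAt_nil _ _⟩
    | succ r ih =>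
      obtain ⟨v, hv, h1⟩ := h 0 (Nat.succ_pos r)
      rw [← occursAt_binCode] at h1
      simp only [elPos, Function.iterate_zero, id] at h1
      have hn := elEnd_min hv h1
      obtain ⟨t, ht, h2⟩ := ih (p + (binCode v).length) fun j hj => by
        have := h (j + 1) (by omega)
        rwa [elPos, Function.iterate_succ_apply, hn] at this
      refine ⟨v :: t, by simpa [hv] using ht, ?_⟩
      rw [tupCode, List.flatMap_cons, occursAt_append]
      exact ⟨h1, h2⟩

end Tuple

/-! #### Relations -/

/-- The position after the arity in the code of a relation at `p`. -/
noncomputable def relStart (x : List Bool) (p : ℕ) : ℕ := p + unaryVal x p + 1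

/-- The end of a tuple of the relation with code at `p`. -/
noncomputable def relTupEnd (x : List Bool) (n p q : ℕ) : ℕ := elPos x n q (unaryVal x p)

/-- The number of tuples of the relation with code at `p`. -/
noncomputable def relCount (x : List Bool) (n p : ℕ) : ℕ :=
  listCount x (relTupEnd x n p) (relStart x p)

/-- The end of the code of a relation at `p`. -/
noncomputable def relEnd (x : List Bool) (n p : ℕ) : ℕ :=
  listEnd x (relTupEnd x n p) (relStart x p)

/-- Entry `l` of tuple `j` of the relation with code at `p`. -/
noncomputable def relEntry (x : List Bool) (n p j l : ℕ) : ℕ :=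
  elVal x n (elPos x n (listPos x (relTupEnd x n p) (relStart x p) j + 1) l)

/-- There is a code of a relation at `p`. -/
def RelOk (x : List Bool) (n p : ℕ) : Prop :=
  symAt x (p + unaryVal x p) = 0 ∧
    ListOk x (TupOk x n (unaryVal x p)) (relTupEnd x n p) (relStart x p) ∧
    ∀ j < relCount x n p, ∀ i < j, ∃ l < unaryVal x p, relEntry x n p i l ≠ relEntry x n p j l

/-- The code of a relation given by its arity and its tuples. -/
def relCode (R : ℕ × List (List ℕ)) : List Bool := unaryCode R.1 ++ listCode tupCode R.2

/-- `R` lists the tuples of a relation on the numbers below `n`. -/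
def IsRel (n : ℕ) (R : ℕ × List (List ℕ)) : Prop :=
  R.2.Nodup ∧ ∀ t ∈ R.2, t.length = R.1 ∧ ∀ v ∈ t, v < n

section Relation

variable {x : List Bool} {n p : ℕ} {R : ℕ × List (List ℕ)}

theorem occursAt_relCode (h : OccursAt x p (relCode R)) :
    unaryVal x p = R.1 ∧ OccursAt x (relStart x p) (listCode tupCode R.2) := by
  rw [relCode, occursAt_append] at h
  have h1 := unaryVal_eq h.1
  refine ⟨h1, ?_⟩
  rw [relStart, h1]
  simpa [unaryCode, add_assoc] using h.2

theorem parser_relTup (x : List Bool) (n p : ℕ) : ParserFor x tupCode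
    (fun t => t.length = unaryVal x p ∧ ∀ v ∈ t, v < n) (TupOk x n (unaryVal x p))
    (relTupEnd x n p) := parser_tup x n _

theorem relCount_eq (hR : ∀ t ∈ R.2, t.length = R.1 ∧ ∀ v ∈ t, v < n)
    (h : OccursAt x p (relCode R)) : relCount x n p = R.2.length := by
  obtain ⟨h1, h2⟩ := occursAt_relCode h
  rw [← h1] at hR
  exact (parser_relTup x n p).listCount_eq hR h2

theorem relEntry_eq (hR : ∀ t ∈ R.2, t.length = R.1 ∧ ∀ v ∈ t, v < n)
    (h : OccursAt x p (relCode R)) {j l v : ℕ} {t : List ℕ} (hj : R.2[j]? = some t)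
    (hl : t[l]? = some v) : relEntry x n p j l = v := by
  obtain ⟨h1, h2⟩ := occursAt_relCode h
  rw [← h1] at hR
  have ht := hR t (List.mem_of_getElem? hj)
  exact elVal_eq (ht.2 v (List.mem_of_getElem? hl)) ((elPos_spec ht.2
    (((parser_relTup x n p).listPos_spec hR h2).1 j t hj).2).1 l v hl)

/-- All tuples have the same length, so two of them are equal iff their entries agree. Absence of
repetitions becomes a condition with bounded quantifiers over data that can be read off the input.
-/
theorem nodup_iff_relEntry (hR : ∀ t ∈ R.2, t.length = R.1 ∧ ∀ v ∈ t, v < n)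
    (h : OccursAt x p (relCode R)) : R.2.Nodup ↔ ∀ j < relCount x n p, ∀ i < j,
      ∃ l < unaryVal x p, relEntry x n p i l ≠ relEntry x n p j l := by
  rw [relCount_eq hR h, (occursAt_relCode h).1, List.nodup_iff_getElem?_ne_getElem?]
  have key : ∀ i j (hi : i < R.2.length) (hj : j < R.2.length), R.2[i]? ≠ R.2[j]? ↔
      ∃ l < R.1, relEntry x n p i l ≠ relEntry x n p j l := fun i j hi hj => by
    rw [← not_iff_not]
    push Not
    have hi' := hR _ (List.getElem_mem hi)
    have hj' := hR _ (List.getElem_mem hj)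
    rw [List.getElem?_eq_getElem hi, List.getElem?_eq_getElem hj, Option.some.injEq]
    have e : ∀ l (hl : l < R.1), relEntry x n p i l = (R.2[i])[l]'(by omega) ∧
        relEntry x n p j l = (R.2[j])[l]'(by omega) := fun l hl =>
      ⟨relEntry_eq hR h (List.getElem?_eq_getElem hi) (List.getElem?_eq_getElem (by omega)),
       relEntry_eq hR h (List.getElem?_eq_getElem hj) (List.getElem?_eq_getElem (by omega))⟩
    constructor
    · intro h' l hl
      rw [(e l hl).1, (e l hl).2]
      simp [h']
    · intro h'
      refine List.ext_getElem (by omega) fun l hl _ => ?_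
      have := h' l (by omega)
      rwa [(e l (by omega)).1, (e l (by omega)).2] at this
  constructor
  · intro H j hj i hij
    exact (key i j (hij.trans hj) hj).1 (H i j hij hj)
  · intro H i j hij hj
    exact (key i j (hij.trans hj) hj).2 (H j hj i hij)

theorem parser_rel (x : List Bool) (n : ℕ) :
    ParserFor x relCode (IsRel n) (RelOk x n) (relEnd x n) where
  occurs p R hR h := by
    obtain ⟨h1, h2⟩ := occursAt_relCode h
    have hR' := hR.2
    rw [← h1] at hR'
    obtain ⟨h3, h4⟩ := (parser_relTup x n p).list.occurs _ _ hR' h2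
    have h5 := h
    rw [relCode, occursAt_append] at h5
    refine ⟨⟨((parser_unary x).occurs _ _ trivial h5.1).1, h3,
      (nodup_iff_relEntry hR.2 h).1 hR.1⟩, ?_⟩
    · rw [relEnd, h4, relStart, h1, relCode]
      simp [unaryCode]; ring
  exists_code p h := by
    obtain ⟨h1, h2, h3⟩ := h
    obtain ⟨l, hl, h4⟩ := (parser_relTup x n p).list.exists_code _ h2
    have h5 : OccursAt x p (relCode (unaryVal x p, l)) := by
      obtain ⟨r, -, hr⟩ := (parser_unary x).exists_code _ h1
      rw [relCode, occursAt_append]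
      rw [← unaryVal_eq hr] at hr
      refine ⟨hr, ?_⟩
      rw [relStart] at h4
      simpa [unaryCode, add_assoc] using h4
    exact ⟨_, ⟨(nodup_iff_relEntry (R := (unaryVal x p, l)) hl h5).2 h3, hl⟩, h5⟩

end Relation

/-! #### Structures -/

/-- The position after the cardinality in the code of a structure at `p`. -/
noncomputable def strStart (x : List Bool) (p : ℕ) : ℕ := p + unaryVal x p + 1

/-- The number of relations of the structure with code at `p`. -/
noncomputable def strCount (x : List Bool) (p : ℕ) : ℕ :=
  listCount x (relEnd x (unaryVal x p)) (strStart x p)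

/-- The position of the code of relation `i` of the structure with code at `p`. -/
noncomputable def strRel (x : List Bool) (p i : ℕ) : ℕ :=
  listPos x (relEnd x (unaryVal x p)) (strStart x p) i + 1

/-- The end of the code of a structure at `p`. -/
noncomputable def strEnd (x : List Bool) (p : ℕ) : ℕ :=
  listEnd x (relEnd x (unaryVal x p)) (strStart x p)

/-- There is a code of a structure at `p`. -/
def StrOk (x : List Bool) (p : ℕ) : Prop :=
  symAt x (p + unaryVal x p) = 0 ∧ 0 < unaryVal x p ∧
    ListOk x (RelOk x (unaryVal x p)) (relEnd x (unaryVal x p)) (strStart x p)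

/-- Numerical data of a structure: its cardinality, the number of relations, their arities,
the numbers of tuples in the relations, and the entries of the tuples. -/
structure Table where
  card : ℕ
  count : ℕ
  ar : ℕ → ℕ
  cnt : ℕ → ℕ
  entry : ℕ → ℕ → ℕ → ℕ

/-- The data of the structure with code at `p`. -/
noncomputable def tableAt (x : List Bool) (p : ℕ) : Table where
  card := unaryVal x p
  count := strCount x p
  ar i := unaryVal x (strRel x p i)
  cnt i := relCount x (unaryVal x p) (strRel x p i)
  entry i j l := relEntry x (unaryVal x p) (strRel x p i) j l

/-- `T` is the data of the structure `A`. -/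
structure Table.Presents (T : Table) {τ : Vocab} (A : FinStr τ) : Prop where
  card_eq : T.card = A.card
  count_eq : T.count = τ.length
  ar_eq : ∀ i : Fin τ.length, T.ar i = τ.get i
  cnt_eq : ∀ i : Fin τ.length, T.cnt i = (A.rel i).card
  entry_lt : ∀ i : Fin τ.length, ∀ j < T.cnt i, ∀ l < τ.get i, T.entry i j l < A.card
  mem_iff : ∀ (i : Fin τ.length) (t : Fin (τ.get i) → Fin A.card),
    t ∈ A.rel i ↔ ∃ j < T.cnt i, ∀ l : Fin (τ.get i), T.entry i j l = t l

theorem listCode_map {α β : Type} (c : β → List Bool) (f : α → β) (l : List α) :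
    listCode c (l.map f) = listCode (fun a => c (f a)) l := by
  simp [listCode, List.flatMap_map]

theorem tupleCode_eq {r n : ℕ} (t : Fin r → Fin n) :
    tupleCode t = tupCode (List.ofFn fun i => (t i : ℕ)) := by
  simp only [tupleCode, tupCode, bind_pure_comp, List.map_eq_map, List.map_ofFn]
  rfl

/-- The lists of the tuples of the relations of a structure. -/
def rawRels (τ : Vocab) (n : ℕ) (L : (i : Fin τ.length) → List (Fin (τ.get i) → Fin n)) :
    List (ℕ × List (List ℕ)) :=
  (List.finRange τ.length).map fun i =>
    (τ.get i, (L i).map fun t => List.ofFn fun j => (t j : ℕ))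

theorem strCode_eq (τ : Vocab) (n : ℕ) (L : (i : Fin τ.length) → List (Fin (τ.get i) → Fin n)) :
    strCode τ n L = unaryCode n ++ listCode relCode (rawRels τ n L) := by
  rw [strCode, rawRels, listCode_map]
  have h : ∀ r, @tupleCode r n = fun t => tupCode (List.ofFn fun i => (t i : ℕ)) :=
    fun r => funext tupleCode_eq
  simp only [relCode, listCode_map, h]

theorem isRel_of_mem_rawRels {τ : Vocab} {n : ℕ}
    {L : (i : Fin τ.length) → List (Fin (τ.get i) → Fin n)} (hL : ∀ i, (L i).Nodup) :
    ∀ R ∈ rawRels τ n L, IsRel n R := by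
  intro R hR
  obtain ⟨i, -, rfl⟩ := List.mem_map.1 hR
  refine ⟨(hL i).map fun t t' h => ?_, fun t ht => ?_⟩
  · funext j
    exact Fin.ext (congrFun (List.ofFn_injective h) j)
  · obtain ⟨t, -, rfl⟩ := List.mem_map.1 ht
    refine ⟨by simp, fun v hv => ?_⟩
    obtain ⟨j, rfl⟩ := (List.mem_ofFn' _ _).1 hv
    exact (t j).2

theorem rawRels_getElem? (τ : Vocab) (n : ℕ)
    (L : (i : Fin τ.length) → List (Fin (τ.get i) → Fin n)) (i : Fin τ.length) :
    (rawRels τ n L)[(i : ℕ)]? =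
      some (τ.get i, (L i).map fun t => List.ofFn fun j => (t j : ℕ)) := by
  have h : (List.finRange τ.length)[(i : ℕ)]? = some i := by
    rw [List.getElem?_eq_getElem (by simp)]
    simp
  rw [rawRels, List.getElem?_map, h]
  rfl

/-- Correctness of the nested parsers on genuine codes. From here on, structures are handled only
through numbers read from the input, with no dependence on a type of vocabularies. -/
theorem FinStr.Encodes.reads {τ : Vocab} {A : FinStr τ} {x u : List Bool} {p : ℕ}
    (hA : A.Encodes u) (h : OccursAt x p u) :
    StrOk x p ∧ strEnd x p = p + u.length ∧ (tableAt x p).Presents A := by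
  obtain ⟨L, hL, rfl⟩ := hA
  rw [strCode_eq] at h
  rw [occursAt_append] at h
  obtain ⟨h1, h2⟩ := h
  have hv := unaryVal_eq h1
  have h2 : OccursAt x (strStart x p) (listCode relCode (rawRels τ A.card L)) := by
    rw [strStart, hv]
    simpa [unaryCode, add_assoc] using h2
  have H := parser_rel x (unaryVal x p)
  have hD : ∀ R ∈ rawRels τ A.card L, IsRel (unaryVal x p) R := by
    rw [hv]
    exact isRel_of_mem_rawRels fun i => (hL i).1
  obtain ⟨h3, h4⟩ := H.list.occurs _ _ hD h2
  have h5 : ∀ i : Fin τ.length, OccursAt x (strRel x p i)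
      (relCode (τ.get i, (L i).map fun t => List.ofFn fun j => (t j : ℕ))) := fun i =>
    ((H.listPos_spec hD h2).1 i _ (rawRels_getElem? τ _ L i)).2
  have h6 : ∀ i : Fin τ.length, IsRel (unaryVal x p)
      (τ.get i, (L i).map fun t => List.ofFn fun j => (t j : ℕ)) := fun i =>
    hD _ (List.mem_of_getElem? (rawRels_getElem? τ _ L i))
  have hcnt : ∀ i : Fin τ.length, (tableAt x p).cnt i = (L i).length := fun i =>
    (relCount_eq (h6 i).2 (h5 i)).trans (by simp)
  have hent : ∀ (i : Fin τ.length) (j : ℕ) (hj : j < (L i).length) (l : Fin (τ.get i)),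
      (tableAt x p).entry i j l = (L i)[j] l := fun i j hj l =>
    relEntry_eq (h6 i).2 (h5 i) (t := List.ofFn fun j' => ((L i)[j] j' : ℕ)) (by simp [hj])
      (by simp)
  refine ⟨⟨((parser_unary x).occurs _ _ trivial h1).1, by rw [hv]; exact A.card_pos, h3⟩, ?_, ?_⟩
  · rw [strEnd, h4, strStart, hv, strCode_eq]
    simp [unaryCode]; ring
  · refine ⟨hv, ?_, fun i => (occursAt_relCode (h5 i)).1, fun i => ?_, fun i j hj l hl => ?_,
      fun i t => ?_⟩
    · exact (H.listCount_eq hD h2).trans (by simp [rawRels])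
    · rw [hcnt, ← List.toFinset_card_of_nodup (hL i).1]
      congr 1
      ext t
      rw [List.mem_toFinset, (hL i).2]
    · rw [hcnt] at hj
      rw [hent i j hj ⟨l, hl⟩]
      exact ((L i)[j] ⟨l, hl⟩).2
    · rw [← (hL i).2, List.mem_iff_getElem, hcnt]
      constructor
      · rintro ⟨j, hj, rfl⟩
        exact ⟨j, hj, fun l => hent i j hj l⟩
      · rintro ⟨j, hj, h⟩
        refine ⟨j, hj, funext fun l => Fin.ext ?_⟩
        rw [← h l, hent i j hj]

/-- Converse direction: the parser accepts nothing but codes. The vocabulary is the list of arities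
that were read, and the relations are the lists of tuples that were read. -/
theorem StrOk.exists_encodes {x : List Bool} {p : ℕ} (h : StrOk x p) :
    ∃ (τ : Vocab) (A : FinStr τ) (u : List Bool), A.Encodes u ∧ OccursAt x p u := by
  obtain ⟨h1, hn, h2⟩ := h
  obtain ⟨l, hl, h3⟩ := (parser_rel x (unaryVal x p)).list.exists_code _ h2
  have hr : OccursAt x p (unaryCode (unaryVal x p)) := by
    obtain ⟨r, -, hr⟩ := (parser_unary x).exists_code _ h1
    rwa [← unaryVal_eq hr] at hr
  generalize hnn : unaryVal x p = n at *
  let τ : Vocab := l.map Prod.fst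
  have hlen : τ.length = l.length := List.length_map _
  let row : (i : Fin τ.length) → ℕ × List (List ℕ) := fun i => l[(i : ℕ)]'(by omega)
  have hrow : ∀ i, τ.get i = (row i).1 := fun i => by simp [τ, row]
  have hmem : ∀ i, row i ∈ l := fun i => List.getElem_mem _
  -- The default 0 and the reduction mod n only make the conversion total; on the tuples that occur,
  -- both are inactive.
  let conv : (i : Fin τ.length) → List ℕ → Fin (τ.get i) → Fin n := fun i t j =>
    ⟨t.getD j 0 % n, Nat.mod_lt _ hn⟩
  have hconv : ∀ i, ∀ t ∈ (row i).2, (List.ofFn fun j => (conv i t j : ℕ)) = t := fun i t ht => by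
    obtain ⟨h4, h5⟩ := (hl _ (hmem i)).2 t ht
    refine List.ext_getElem (by rw [List.length_ofFn, h4, hrow]) fun j hj hj' => ?_
    rw [List.getElem_ofFn]
    simp only [conv, List.getD_eq_getElem?_getD, List.getElem?_eq_getElem hj', Option.getD_some]
    exact Nat.mod_eq_of_lt (h5 _ (List.getElem_mem hj'))
  let L : (i : Fin τ.length) → List (Fin (τ.get i) → Fin n) := fun i => (row i).2.map (conv i)
  have hL : ∀ i, ((L i).map fun t => List.ofFn fun j => (t j : ℕ)) = (row i).2 := fun i => by
    simp only [L, List.map_map]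
    conv_rhs => rw [← List.map_id (row i).2]
    exact List.map_congr_left fun t ht => hconv i t ht
  have hraw : rawRels τ n L = l := by
    refine List.ext_getElem (by simp [rawRels, hlen]) fun i hi hi' => ?_
    simp only [rawRels, List.getElem_map, List.getElem_finRange, hL]
    exact Prod.ext (hrow _) rfl
  refine ⟨τ, ⟨n, hn, fun i => (L i).toFinset⟩, strCode τ n L, ⟨L, fun i => ⟨?_, by simp⟩, rfl⟩, ?_⟩
  · have := (hl _ (hmem i)).1
    rw [← hL i] at this
    exact List.Nodup.of_map _ this
  · rw [strCode_eq, hraw, occursAt_append]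
    refine ⟨hr, ?_⟩
    rw [strStart, hnn] at h3
    simpa [unaryCode, add_assoc] using h3

/-! #### Pairs of structures -/

/-- `x` encodes a pair of structures. -/
def PairOk (x : List Bool) : Prop :=
  StrOk x 0 ∧ StrOk x (strEnd x 0) ∧ strEnd x (strEnd x 0) = x.length

theorem occursAt_self_append (u v : List Bool) : OccursAt (u ++ v) u.length v := by
  simp [OccursAt]

theorem EncodesPair.reads {τ σ : Vocab} {A : FinStr τ} {B : FinStr σ} {x : List Bool}
    (h : EncodesPair A B x) : PairOk x ∧ (tableAt x 0).Presents A ∧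
      (tableAt x (strEnd x 0)).Presents B ∧ A.Encodes (x.take (strEnd x 0)) := by
  obtain ⟨u, v, hu, hv, rfl⟩ := h
  obtain ⟨h1, h2, h3⟩ := hu.reads (p := 0) (x := u ++ v) (by simp [OccursAt])
  rw [zero_add] at h2
  obtain ⟨h4, h5, h6⟩ := hv.reads (occursAt_self_append u v)
  rw [PairOk, h2]
  refine ⟨⟨h1, h4, by simp [h5]⟩, h3, h6, by simpa using hu⟩

theorem PairOk.exists_encodes {x : List Bool} (h : PairOk x) :
    ∃ (τ σ : Vocab) (A : FinStr τ) (B : FinStr σ), EncodesPair A B x := by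
  obtain ⟨h1, h2, h3⟩ := h
  obtain ⟨τ, A, u, hA, hu⟩ := h1.exists_encodes
  obtain ⟨σ, B, v, hB, hv⟩ := h2.exists_encodes
  have h4 := (hA.reads hu).2.1
  rw [h4, zero_add] at hv h3
  have h5 := (hB.reads hv).2.1
  refine ⟨τ, σ, A, B, u, v, hA, hB, ?_⟩
  obtain ⟨w, hw⟩ := hu
  rw [List.drop_zero] at hw
  subst hw
  rw [OccursAt, List.drop_left] at hv
  rw [h5, List.length_append] at h3
  rw [hv.eq_of_length (by omega)]

theorem EncodesPair.unique {τ σ τ' σ' : Vocab} {A : FinStr τ} {B : FinStr σ} {A' : FinStr τ'}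
    {B' : FinStr σ'} {x : List Bool} (h : EncodesPair A B x) (h' : EncodesPair A' B' x) :
    (⟨τ, A⟩ : Σ τ, FinStr τ) = ⟨τ', A'⟩ ∧ (⟨σ, B⟩ : Σ τ, FinStr τ) = ⟨σ', B'⟩ := by
  obtain ⟨u, v, hu, hv, rfl⟩ := h
  obtain ⟨u', v', hu', hv', e⟩ := h'
  obtain ⟨h1, rfl⟩ := Encodes_inj hu hu' e
  exact ⟨h1, (Encodes_inj (u := []) (v := []) hv hv' rfl).1⟩

/-- The size of the structure with data `T`. -/
def Table.size (T : Table) : ℕ :=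
  T.count + T.card + ∑ i ∈ Finset.range T.count, T.cnt i * T.ar i

theorem Table.Presents.size_eq {T : Table} {τ : Vocab} {A : FinStr τ} (h : T.Presents A) :
    T.size = A.size := by
  rw [Table.size, FinStr.size, h.card_eq, h.count_eq, Finset.sum_range]
  simp only [h.cnt_eq, h.ar_eq]

open Classical in
theorem embParam_eq_ite (x : List Bool) :
    embParam x = if PairOk x then (tableAt x 0).size else 0 := by
  rw [embParam]
  split_ifs with h
  · obtain ⟨τ, σ, A, B, hx⟩ := h.exists_encodes
    have : {k | ∃ (τ σ : Vocab) (A : FinStr τ) (B : FinStr σ), EncodesPair A B x ∧ A.size = k} =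
        {A.size} := by
      ext k
      constructor
      · rintro ⟨τ', σ', A', B', hx', rfl⟩
        obtain ⟨e, -⟩ := hx.unique hx'
        cases e
        rfl
      · rintro rfl
        exact ⟨τ, σ, A, B, hx, rfl⟩
    rw [this, csInf_singleton, hx.reads.2.1.size_eq]
  · convert Nat.sInf_empty
    ext k
    simp only [Set.mem_ofPred_eq, Set.mem_empty_iff_false, iff_false]
    rintro ⟨τ, σ, A, B, hx, -⟩
    exact h hx.reads.1

/-! ### Reading codes in logarithmic space -/

/-- `β` extends the context `α`. -/
def Extends {α β : Type} [Ctx α] [Ctx β] (π : β → α) : Prop :=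
  (∀ b, inp (π b) = inp b) ∧ ∀ f : α → ℕ, LS f → LS fun b => f (π b)

theorem Extends.id : Extends fun a : α => a := ⟨fun _ => rfl, fun _ hf => hf⟩

theorem Extends.fst : Extends fun c : α × ℕ => c.1 := ⟨fun _ => rfl, fun _ hf => hf.wk⟩

theorem Extends.comp {β γ : Type} [Ctx β] [Ctx γ] {π : β → α} {ρ : γ → β} (hπ : Extends π)
    (hρ : Extends ρ) : Extends fun c => π (ρ c) :=
  ⟨fun c => (hπ.1 _).trans (hρ.1 c), fun f hf => hρ.2 _ (hπ.2 f hf)⟩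

/-- Functions that are computable together with their argument. -/
def LSF (e : α → ℕ → ℕ) : Prop :=
  ∀ (β : Type) [Ctx β] (π : β → α), Extends π → ∀ f : β → ℕ, LS f → LS fun b => e (π b) (f b)

/-- Predicates that are computable together with their argument. -/
def LSPF (V : α → ℕ → Prop) : Prop :=
  ∀ (β : Type) [Ctx β] (π : β → α), Extends π → ∀ f : β → ℕ, LS f → LSP fun b => V (π b) (f b)

theorem LSF.wk {e : α → ℕ → ℕ} (he : LSF e) : LSF fun c : α × ℕ => e c.1 :=
  fun β _ π hπ f hf => he β (fun b => (π b).1) (Extends.fst.comp hπ) f hf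

theorem LSPF.wk {V : α → ℕ → Prop} (hV : LSPF V) : LSPF fun c : α × ℕ => V c.1 :=
  fun β _ π hπ f hf => hV β (fun b => (π b).1) (Extends.fst.comp hπ) f hf

theorem LSPF.app {V : α → ℕ → Prop} (hV : LSPF V) {f : α → ℕ} (hf : LS f) :
    LSP fun a => V a (f a) := hV α _ .id f hf

theorem LS.length : LS fun a : α => (inp a).length := LS.length_succ.pred

theorem least_mem {n i : ℕ} {P : ℕ → Prop} (hi : i ≤ n) (hP : P i) : P (least n P) :=
  (Nat.sInf_mem (s := {i | i ≤ n ∧ P i}) ⟨i, hi, hP⟩).2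

theorem least_eq_zero {n : ℕ} {P : ℕ → Prop} (h : ∀ i ≤ n, ¬ P i) : least n P = 0 := by
  rw [least, Nat.sInf_eq_zero]
  right
  ext i
  simpa using h i

/-- Search for the least witness, or for n + 1 if there is none. A candidate not beyond this target
equals it iff it is a witness or is n + 1, so the target is recognized from below without being
known. -/
theorem LS.least {n : α → ℕ} {p : α × ℕ → Prop} (hn : LS n) (hp : LSP p) :
    LS fun a => least (n a) fun j => p (a, j) := by
  classical
  have hs : LS fun a => if ∃ j < n a + 1, p (a, j) then ParaEmb.least (n a) fun j => p (a, j)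
      else n a + 1 := by
    refine LS.search (hn.succ.polyB.mono fun a => ?_) (LS.congr (LSP.restrict
      (((LSP.le LS.var hn.wk).and hp).or (LSP.eq LS.var hn.succ.wk)).not _) fun c => ?_)
    · have := least_le (n a) fun j => p (a, j)
      split_ifs <;> omega
    · obtain ⟨⟨a, j⟩, hc⟩ := c
      have hl := least_le (n a) fun j => p (a, j)
      have key : (j ≤ n a ∧ p (a, j) ∨ j = n a + 1) ↔
          j = if ∃ j < n a + 1, p (a, j) then ParaEmb.least (n a) fun j => p (a, j)
            else n a + 1 := by
        dsimp only at hc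
        split_ifs at hc ⊢ with h1
        · constructor
          · rintro (h | h)
            · exact le_antisymm hc (Nat.sInf_le h)
            · omega
          · rintro rfl
            obtain ⟨i, hi, hi'⟩ := h1
            exact .inl ⟨hl, least_mem (P := fun j => p (a, j)) (Nat.lt_succ_iff.1 hi) hi'⟩
        · exact ⟨fun h => h.resolve_left fun h => h1 ⟨j, by omega, h.2⟩, .inr⟩
      dsimp only at key ⊢
      by_cases h : j ≤ n a ∧ p (a, j) ∨ j = n a + 1
      · rw [if_neg (not_not.2 h), if_pos (key.1 h)]
      · rw [if_pos h, if_neg (mt key.2 h)]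
  refine (LS.ite (LSP.bex hn.succ hp) hs .zero).congr fun a => ?_
  split_ifs with h
  · rfl
  · exact (least_eq_zero fun i hi h' => h ⟨i, by omega, h'⟩).symm

theorem LS.unaryVal {p : α → ℕ} (hp : LS p) : LS fun a => unaryVal (inp a) (p a) :=
  LS.least (p := fun c : α × ℕ => ParaEmb.symAt (inp c) (p c.1 + c.2) ≠ 1) .length
    (LSP.eq (hp.wk.add .var).symAt (.const 1)).not

theorem LSP.isBin {p v : α → ℕ} (hp : LS p) (hv : LS v) :
    LSP fun a => IsBin (inp a) (p a) (v a) := by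
  have h1 : LS fun c : α × ℕ => symAt (inp c) (p c.1 + 2 * c.2 + 1) :=
    (hp.wk.add ((LS.const 2).mul .var)).succ.symAt
  have h2 := LSP.testBit hv.wk LS.var
  exact (LSP.ball (p := fun c : α × ℕ => symAt (inp c) (p c.1 + 2 * c.2) = 1 ∧
      ((v c.1).testBit c.2 = true → symAt (inp c) (p c.1 + 2 * c.2 + 1) = 1) ∧
      (¬ (v c.1).testBit c.2 = true → symAt (inp c) (p c.1 + 2 * c.2 + 1) = 0)) hv.natSize
    ((LSP.eq (hp.wk.add ((LS.const 2).mul .var)).symAt (.const 1)).and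
      ((h2.imp (LSP.eq h1 (.const 1))).and (h2.not.imp (LSP.eq_zero h1))))).and
    (LSP.eq_zero (hp.add ((LS.const 2).mul hv.natSize)).symAt)

theorem LS.elVal {n p : α → ℕ} (hn : LS n) (hp : LS p) :
    LS fun a => elVal (inp a) (n a) (p a) :=
  LS.least (p := fun c : α × ℕ => IsBin (inp c) (p c.1) c.2) hn (LSP.isBin hp.wk .var)

theorem LS.elEnd {n p : α → ℕ} (hn : LS n) (hp : LS p) :
    LS fun a => elEnd (inp a) (n a) (p a) :=
  hp.add (((LS.const 2).mul (LS.elVal hn hp).natSize).add (.const 1))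

theorem LS.min {f g : α → ℕ} (hf : LS f) (hg : LS g) : LS fun a => min (f a) (g a) :=
  (LS.ite (LSP.le hf hg) hf hg).congr fun a => by rw [min_def]

/-- The cap is what bounds all iterates, and it does so on malformed inputs as well, where the end
of an item may be meaningless. -/
theorem LS.iterate_min {F : α → ℕ → ℕ} {p i : α → ℕ} (hF : LSF F) (hp : LS p) (hi : LS i) :
    LS fun a => (fun q => Min.min (F a q) ((inp a).length + 1))^[i a] (p a) := by
  refine LS.iterate (F := fun a q => Min.min (F a q) ((inp a).length + 1)) hi hp
    (LS.min (hF _ (fun c : (α × ℕ) × ℕ => c.1.1) (Extends.fst.comp .fst) _ .var)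
      LS.length_succ.wk.wk) ⟨_, hp.polyB.add LS.length_succ.polyB, fun a k _ => ?_⟩
  rcases k with _ | k
  · exact Nat.le_add_right _ _
  · rw [Function.iterate_succ_apply']
    exact (min_le_right _ _).trans (Nat.le_add_left _ _)

theorem LS.listPos {e : α → ℕ → ℕ} {p i : α → ℕ} (he : LSF e) (hp : LS p) (hi : LS i) :
    LS fun a => listPos (inp a) (e a) (p a) (i a) :=
  LS.iterate_min (F := fun a q => e a (q + 1)) (fun β _ π hπ _ hf => he β π hπ _ hf.succ) hp hi

theorem LS.listCount {e : α → ℕ → ℕ} {p : α → ℕ} (he : LSF e) (hp : LS p) :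
    LS fun a => listCount (inp a) (e a) (p a) :=
  LS.least (p := fun c : α × ℕ => ParaEmb.symAt (inp c) (ParaEmb.listPos (inp c) (e c.1) (p c.1) c.2) ≠ 1)
    .length (LSP.eq (LS.listPos he.wk hp.wk .var).symAt (.const 1)).not

theorem LS.listEnd {e : α → ℕ → ℕ} {p : α → ℕ} (he : LSF e) (hp : LS p) :
    LS fun a => listEnd (inp a) (e a) (p a) :=
  (LS.listPos he hp (LS.listCount he hp)).succ

theorem LSP.listOk {V : α → ℕ → Prop} {e : α → ℕ → ℕ} {p : α → ℕ} (hV : LSPF V) (he : LSF e)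
    (hp : LS p) : LSP fun a => ListOk (inp a) (V a) (e a) (p a) :=
  (LSP.eq_zero (LS.listPos he hp (LS.listCount he hp)).symAt).and
    (LSP.ball (p := fun c : α × ℕ => V c.1 (listPos (inp c) (e c.1) (p c.1) c.2 + 1))
      (LS.listCount he hp) (hV.wk.app (LS.listPos he.wk hp.wk .var).succ))

theorem LS.elPos {n p j : α → ℕ} (hn : LS n) (hp : LS p) (hj : LS j) :
    LS fun a => elPos (inp a) (n a) (p a) (j a) :=
  LS.iterate_min (F := fun a q => ParaEmb.elEnd (inp a) (n a) q) (fun β _ π hπ f hf => by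
    simp only [hπ.1]
    exact LS.elEnd (hπ.2 n hn) hf) hp hj

theorem LSP.tupOk {n r p : α → ℕ} (hn : LS n) (hr : LS r) (hp : LS p) :
    LSP fun a => TupOk (inp a) (n a) (r a) (p a) :=
  LSP.ball (p := fun c : α × ℕ => ∃ v < n c.1, IsBin (inp c) (elPos (inp c) (n c.1) (p c.1) c.2) v)
    hr (LSP.bex (p := fun d : (α × ℕ) × ℕ =>
      IsBin (inp d) (elPos (inp d.1) (n d.1.1) (p d.1.1) d.1.2) d.2) hn.wk
      (LSP.isBin (LS.elPos hn.wk hp.wk .var).wk .var))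

theorem LS.relStart {p : α → ℕ} (hp : LS p) : LS fun a => relStart (inp a) (p a) :=
  (hp.add hp.unaryVal).succ

theorem LSF.relTupEnd {n p : α → ℕ} (hn : LS n) (hp : LS p) :
    LSF fun a => relTupEnd (inp a) (n a) (p a) := fun β _ π hπ f hf => by
  simp only [hπ.1]
  exact LS.elPos (hπ.2 n hn) hf (hπ.2 p hp).unaryVal

theorem LS.relCount {n p : α → ℕ} (hn : LS n) (hp : LS p) :
    LS fun a => relCount (inp a) (n a) (p a) :=
  LS.listCount (LSF.relTupEnd hn hp) hp.relStart

theorem LS.relEnd {n p : α → ℕ} (hn : LS n) (hp : LS p) :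
    LS fun a => relEnd (inp a) (n a) (p a) :=
  LS.listEnd (LSF.relTupEnd hn hp) hp.relStart

theorem LS.relEntry {n p j l : α → ℕ} (hn : LS n) (hp : LS p) (hj : LS j) (hl : LS l) :
    LS fun a => relEntry (inp a) (n a) (p a) (j a) (l a) :=
  LS.elVal hn (LS.elPos hn (LS.listPos (LSF.relTupEnd hn hp) hp.relStart hj).succ hl)

theorem LSP.relOk {n p : α → ℕ} (hn : LS n) (hp : LS p) :
    LSP fun a => RelOk (inp a) (n a) (p a) := by
  refine (LSP.eq_zero (hp.add hp.unaryVal).symAt).and ((LSP.listOk (fun β _ π hπ f hf => ?_)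
    (LSF.relTupEnd hn hp) hp.relStart).and ?_)
  · simp only [hπ.1]
    exact LSP.tupOk (hπ.2 n hn) (hπ.2 p hp).unaryVal hf
  · refine LSP.ball (p := fun c : α × ℕ => ∀ i < c.2, ∃ l < ParaEmb.unaryVal (inp c) (p c.1),
      ParaEmb.relEntry (inp c) (n c.1) (p c.1) i l ≠ ParaEmb.relEntry (inp c) (n c.1) (p c.1) c.2 l)
      (LS.relCount hn hp) ?_
    refine LSP.ball (p := fun c : (α × ℕ) × ℕ => ∃ l < ParaEmb.unaryVal (inp c) (p c.1.1),
      ParaEmb.relEntry (inp c) (n c.1.1) (p c.1.1) c.2 l ≠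
        ParaEmb.relEntry (inp c) (n c.1.1) (p c.1.1) c.1.2 l) .var ?_
    refine LSP.bex (p := fun c : ((α × ℕ) × ℕ) × ℕ =>
      ParaEmb.relEntry (inp c) (n c.1.1.1) (p c.1.1.1) c.1.2 c.2 ≠
        ParaEmb.relEntry (inp c) (n c.1.1.1) (p c.1.1.1) c.1.1.2 c.2) hp.wk.wk.unaryVal ?_
    exact (LSP.eq (LS.relEntry hn.wk.wk.wk hp.wk.wk.wk LS.var.wk .var)
      (LS.relEntry hn.wk.wk.wk hp.wk.wk.wk LS.var.wk.wk .var)).not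

theorem LSF.relEnd {n : α → ℕ} (hn : LS n) : LSF fun a => relEnd (inp a) (n a) :=
  fun β _ π hπ f hf => by
    simp only [hπ.1]
    exact LS.relEnd (hπ.2 n hn) hf

theorem LS.strStart {p : α → ℕ} (hp : LS p) : LS fun a => strStart (inp a) (p a) :=
  (hp.add hp.unaryVal).succ

theorem LS.strCount {p : α → ℕ} (hp : LS p) : LS fun a => strCount (inp a) (p a) :=
  LS.listCount (LSF.relEnd hp.unaryVal) hp.strStart

theorem LS.strRel {p i : α → ℕ} (hp : LS p) (hi : LS i) :
    LS fun a => strRel (inp a) (p a) (i a) :=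
  (LS.listPos (LSF.relEnd hp.unaryVal) hp.strStart hi).succ

theorem LS.strEnd {p : α → ℕ} (hp : LS p) : LS fun a => strEnd (inp a) (p a) :=
  LS.listEnd (LSF.relEnd hp.unaryVal) hp.strStart

theorem LSP.strOk {p : α → ℕ} (hp : LS p) : LSP fun a => StrOk (inp a) (p a) := by
  refine (LSP.eq_zero (hp.add hp.unaryVal).symAt).and ((LSP.lt .zero hp.unaryVal).and
    (LSP.listOk (fun β _ π hπ f hf => ?_) (LSF.relEnd hp.unaryVal) hp.strStart))
  simp only [hπ.1]
  exact LSP.relOk (hπ.2 p hp).unaryVal hf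

/-- The data of a structure can be computed. -/
structure LSTable (T : α → Table) : Prop where
  card : LS fun a => (T a).card
  count : LS fun a => (T a).count
  ar : LSF fun a => (T a).ar
  cnt : LSF fun a => (T a).cnt
  entry : ∀ (β : Type) [Ctx β] (π : β → α), Extends π → ∀ i j l : β → ℕ, LS i → LS j → LS l →
    LS fun b => (T (π b)).entry (i b) (j b) (l b)

theorem LSTable.tableAt {p : α → ℕ} (hp : LS p) : LSTable fun a => tableAt (inp a) (p a) where
  card := hp.unaryVal
  count := hp.strCount
  ar β _ π hπ f hf := by
    simp only [hπ.1]
    exact (LS.strRel (hπ.2 p hp) hf).unaryVal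
  cnt β _ π hπ f hf := by
    simp only [hπ.1]
    exact LS.relCount (hπ.2 p hp).unaryVal (LS.strRel (hπ.2 p hp) hf)
  entry β _ π hπ i j l hi hj hl := by
    simp only [hπ.1]
    exact LS.relEntry (hπ.2 p hp).unaryVal (LS.strRel (hπ.2 p hp) hi) hj hl

theorem LSTable.size {T : α → Table} (hT : LSTable T) : LS fun a => (T a).size :=
  (hT.count.add hT.card).add (LS.sum (f := fun c : α × ℕ => (T c.1).cnt c.2 * (T c.1).ar c.2)
    hT.count ((hT.cnt _ _ .fst _ .var).mul (hT.ar _ _ .fst _ .var)))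

theorem LSP.pairOk : LSP fun a : α => PairOk (inp a) :=
  (LSP.strOk .zero).and ((LSP.strOk (LS.strEnd .zero)).and
    (LSP.eq (LS.strEnd (LS.strEnd .zero)) .length))

theorem LS.embParam : LS fun a : α => embParam (inp a) := by
  classical
  exact (LS.ite LSP.pairOk (LSTable.tableAt .zero).size .zero).congr fun a => by
    rw [embParam_eq_ite]

/-! ### Colour coding -/

/-- The hash function with parameters `p`, `q` and `t`. -/
def hash (t p q v : ℕ) : ℕ := q * v % p % t

/-- For a collision, the difference of the residues of q v and q u is a positive multiple of t below
p, so it takes at most (p - 1) / t values. It determines q, as v - u is invertible mod p. Ordering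
the residues avoids negative differences. -/
theorem card_hash_collision {p t u v : ℕ} (hp : p.Prime) (hu : u < p) (hv : v < p)
    (huv : u ≠ v) :
    ((Finset.Ico 1 p).filter fun q => q * u % p < q * v % p ∧ hash t p q u = hash t p q v).card ≤
      (p - 1) / t := by
  have := Fact.mk hp
  have key : ∀ q, q * u % p < q * v % p → hash t p q u = hash t p q v →
      (q * v % p - q * u % p) / t * t = q * v % p - q * u % p := fun q hlt h =>
    Nat.div_mul_cancel ((Nat.modEq_iff_dvd' hlt.le).1 h)
  refine (Finset.card_le_card_of_injOn (t := Finset.Icc 1 ((p - 1) / t))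
    (fun q => (q * v % p - q * u % p) / t) (fun q hq => ?_) fun q hq q' hq' h => ?_).trans
      (by simp)
  · obtain ⟨-, hlt, h⟩ := Finset.mem_filter.1 hq
    have := key q hlt h
    have hvp := Nat.mod_lt (q * v) hp.pos
    refine Finset.mem_coe.2 (Finset.mem_Icc.2 ⟨?_, Nat.div_le_div_right (by omega)⟩)
    rcases Nat.eq_zero_or_pos ((q * v % p - q * u % p) / t) with h0 | h0
    · rw [h0] at this; omega
    · exact h0
  · obtain ⟨hq1, hlt, hh⟩ := Finset.mem_filter.1 hq
    obtain ⟨hq1', hlt', hh'⟩ := Finset.mem_filter.1 hq'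
    have e : q * v % p - q * u % p = q' * v % p - q' * u % p := by
      rw [← key q hlt hh, ← key q' hlt' hh']
      exact congrArg (· * t) h
    have e' : q * v % p + q' * u % p = q' * v % p + q * u % p := by omega
    have e'' : ((q : ZMod p) - q') * (v - u) = 0 := by
      have := congrArg (Nat.cast (R := ZMod p)) e'
      push_cast [ZMod.natCast_mod] at this
      linear_combination this
    rw [Finset.mem_Ico] at hq1 hq1'
    rcases mul_eq_zero.1 e'' with h0 | h0
    · rw [sub_eq_zero, ZMod.natCast_eq_natCast_iff'] at h0
      rwa [Nat.mod_eq_of_lt hq1.2, Nat.mod_eq_of_lt hq1'.2] at h0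
    · rw [sub_eq_zero, ZMod.natCast_eq_natCast_iff'] at h0
      rw [Nat.mod_eq_of_lt hv, Nat.mod_eq_of_lt hu] at h0
      exact absurd h0.symm huv

/-- Union bound: at most k² ordered pairs, each spoiling at most (p - 1) / (k² + 1) of the p - 1
multipliers, cannot spoil all. Bertrand's postulate supplies p between n and 2n. -/
theorem exists_hash {n k : ℕ} (hn : n ≠ 0) (S : Finset ℕ) (hS : ∀ v ∈ S, v < n) (hk : S.card ≤ k) :
    ∃ p ≤ 2 * n, ∃ q < p, Set.InjOn (hash (k ^ 2 + 1) p q) S := by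
  obtain ⟨p, hp, hnp, hp2⟩ := Nat.exists_prime_lt_and_le_two_mul n hn
  have h2 := hp.two_le
  set t := k ^ 2 + 1 with ht
  let C : ℕ × ℕ → Finset ℕ := fun c => (Finset.Ico 1 p).filter fun q =>
    q * c.1 % p < q * c.2 % p ∧ hash t p q c.1 = hash t p q c.2
  have hC : (S.offDiag.biUnion C).card < p - 1 := by
    have h1 : (S.offDiag.biUnion C).card ≤ S.offDiag.card * ((p - 1) / t) :=
      Finset.card_biUnion_le_card_mul _ _ _ fun c hc => by
        rw [Finset.mem_offDiag] at hc
        exact card_hash_collision hp ((hS _ hc.1).trans hnp) ((hS _ hc.2.1).trans hnp)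
          hc.2.2
    have h3 : S.offDiag.card ≤ k ^ 2 := by
      rw [Finset.offDiag_card, sq]
      exact (Nat.sub_le _ _).trans (Nat.mul_le_mul hk hk)
    have h4 := Nat.mul_le_mul_right ((p - 1) / t) h3
    have h5 : t * ((p - 1) / t) ≤ p - 1 := Nat.mul_div_le _ _
    rw [ht, add_mul, one_mul, ← ht] at h5
    rcases Nat.eq_zero_or_pos ((p - 1) / t) with h0 | h0
    · rw [h0, mul_zero] at h1
      omega
    · omega
  obtain ⟨q, hq, hq'⟩ : ∃ q ∈ Finset.Ico 1 p, q ∉ S.offDiag.biUnion C :=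
    Finset.exists_mem_notMem_of_card_lt_card (by simpa using hC)
  rw [Finset.mem_Ico] at hq
  refine ⟨p, hp2, q, hq.2, fun u hu v hv h => ?_⟩
  by_contra huv
  have := Fact.mk hp
  -- Multiplication by q is injective mod p because 0 < q < p; so one of the two orderings of the
  -- residues applies.
  have hne : q * u % p ≠ q * v % p := fun h' => by
    have h' : ((q * u : ℕ) : ZMod p) = (q * v : ℕ) := (ZMod.natCast_eq_natCast_iff' _ _ _).2 h'
    push_cast at h'
    rcases mul_eq_mul_left_iff.1 h' with h0 | h0
    · rw [ZMod.natCast_eq_natCast_iff', Nat.mod_eq_of_lt ((hS _ hu).trans hnp),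
        Nat.mod_eq_of_lt ((hS _ hv).trans hnp)] at h0
      exact huv h0
    · rw [ZMod.natCast_eq_zero_iff] at h0
      exact absurd (Nat.le_of_dvd hq.1 h0) (by omega)
  refine hq' ?_
  rcases lt_or_gt_of_ne hne with hlt | hlt
  · exact Finset.mem_biUnion.2 ⟨(u, v), Finset.mem_offDiag.2 ⟨hu, hv, huv⟩,
      Finset.mem_filter.2 ⟨Finset.mem_Ico.2 hq, hlt, h⟩⟩
  · exact Finset.mem_biUnion.2 ⟨(v, u), Finset.mem_offDiag.2 ⟨hv, hu, Ne.symm huv⟩,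
      Finset.mem_filter.2 ⟨Finset.mem_Ico.2 hq, hlt, h.symm⟩⟩

/-! ### Embeddings along a forest -/

/-- The partial map `ρ` preserves the tuples in its domain. -/
def Preserves (S T : Table) (ρ : List (ℕ × ℕ)) : Prop :=
  ∀ i < S.count, ∀ j < S.cnt i, (∀ l < S.ar i, ∃ c ∈ ρ, c.1 = S.entry i j l) →
    ∃ j' < T.cnt i, ∀ l < S.ar i, ∃ c ∈ ρ, c.1 = S.entry i j l ∧ c.2 = T.entry i j' l

/-- The partial map `ρ`, defined on the path from a root to `q`, can be extended to the elements
below `q`, whose distance to `q` is at most `d`, such that the values obey `col` and the tuples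
along each path are preserved. -/
def Extendable (S T : Table) (par : ℕ → ℕ) (col : ℕ → ℕ → Prop) : ℕ → ℕ → List (ℕ × ℕ) → Prop
  | 0, q, _ => ∀ a < S.card, par a ≠ q
  | d + 1, q, ρ => ∀ a < S.card, par a = q → ∃ b < T.card, col a b ∧ Preserves S T ((a, b) :: ρ) ∧
      Extendable S T par col d a ((a, b) :: ρ)

/-- The entries of each tuple lie on a path of a forest of height `D`. -/
def TuplesOnPaths (S : Table) (par : ℕ → ℕ) (D : ℕ) : Prop :=
  ∀ i < S.count, ∀ j < S.cnt i, ∃ c < S.card, ∀ l < S.ar i, ∃ m < D + 1,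
    par^[m] c = S.entry i j l

/-! ### Gluing extensions along paths to an embedding. -/

section Sound

variable (S T : Table) (par : ℕ → ℕ) (col : ℕ → ℕ → Prop) (D : ℕ)

/-- The value at `a` chosen for the extension of `ρ`. -/
noncomputable def chosen (ρ : List (ℕ × ℕ)) (a : ℕ) : ℕ :=
  Classical.epsilon fun b => b < T.card ∧ col a b ∧ Preserves S T ((a, b) :: ρ) ∧
    Extendable S T par col (D - (ρ.length + 1)) a ((a, b) :: ρ)

/-- The chosen partial map on the first `j` elements of the path from `a` to the root. -/
noncomputable def pathMap : ℕ → ℕ → List (ℕ × ℕ)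
  | 0, _ => []
  | j + 1, a => if a < S.card then
      (a, chosen S T par col D (pathMap j (par a)) a) :: pathMap j (par a) else []

variable {S T par col D}

/-- Once the path has reached the virtual root, further steps add nothing. Hence D steps give the
complete path of every element. -/
theorem pathMap_succ (j a : ℕ) (ha : par^[j] a = S.card) :
    pathMap S T par col D (j + 1) a = pathMap S T par col D j a := by
  induction j generalizing a with
  | zero =>
    obtain rfl : a = S.card := ha
    simp [pathMap]
  | succ j ih =>
    have h := ih (par a) (by rwa [← Function.iterate_succ_apply])
    conv_lhs => rw [pathMap]
    conv_rhs => rw [pathMap]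
    rw [h]

/-- The value at a is chosen as a function of the partial map on its proper ancestors, which in turn
is determined by a. The choices on different branches therefore fit together to one map h, with R a
its restriction to the path of a. -/
theorem Extendable.spec (hD : ∀ a ≤ S.card, par^[D] a = S.card)
    (hpar : ∀ a < S.card, par a ≤ S.card) (hE : Extendable S T par col D S.card []) :
    ∃ (R : ℕ → List (ℕ × ℕ)) (h : ℕ → ℕ), ∀ a < S.card, R a = (a, h a) :: R (par a) ∧
      R S.card = [] ∧ h a < T.card ∧ col a (h a) ∧ Preserves S T (R a) := by
  let R := pathMap S T par col D D
  let h := fun a => chosen S T par col D (R (par a)) a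
  have hR : ∀ a < S.card, R a = (a, h a) :: R (par a) := fun a ha => by
    have := pathMap_succ (T := T) (col := col) (D := D) D a (hD a ha.le)
    rw [pathMap, if_pos ha] at this
    exact this.symm
  have hRk : R S.card = [] := by
    simp only [R]
    rcases D with _ | D
    · rfl
    · simp [pathMap]
  have key : ∀ j a, a ≤ S.card → par^[j] a = S.card →
      Extendable S T par col (D - (R a).length) a (R a) ∧ (a < S.card →
        h a < T.card ∧ col a (h a) ∧ Preserves S T (R a)) := by
    intro j
    induction j with
    | zero =>
      rintro a - rfl
      simp only [hRk]
      exact ⟨hE, fun h => absurd h (lt_irrefl _)⟩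
    | succ j ih =>
      intro a ha hj
      rcases ha.eq_or_lt with rfl | ha
      · rw [hRk]
        exact ⟨hE, fun h => absurd h (lt_irrefl _)⟩
      · obtain ⟨h1, -⟩ := ih (par a) (hpar a ha) (by rwa [← Function.iterate_succ_apply])
        rcases hd : D - (R (par a)).length with _ | d
        · rw [hd] at h1
          exact absurd rfl (h1 a ha)
        · rw [hd] at h1
          have hd' : d = D - ((R (par a)).length + 1) := by omega
          rw [hd'] at h1
          have := Classical.epsilon_spec (h1 a ha rfl)
          rw [hR a ha]
          exact ⟨this.2.2.2, fun _ => ⟨this.1, this.2.1, this.2.2.1⟩⟩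
  exact ⟨R, h, fun a ha => ⟨hR a ha, hRk, (key D a ha.le (hD a ha.le)).2 ha⟩⟩

/-- Every tuple of A lies on one path, where h preserves it. Injectivity is enforced by `hcol`: no
value is admissible for two different elements. -/
theorem embeds_of_extendable {τ : Vocab} {A B : FinStr τ} (hS : S.Presents A) (hT : T.Presents B)
    (hk : par S.card = S.card) (hD : ∀ a ≤ S.card, par^[D] a = S.card)
    (hpar : ∀ a < S.card, par a ≤ S.card) (hpath : TuplesOnPaths S par D)
    (hcol : ∀ a < S.card, ∀ a' < a, ∀ b < T.card, col a b → ¬ col a' b)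
    (hE : Extendable S T par col D S.card []) : A.Embeds B := by
  obtain ⟨R, h, hR⟩ := hE.spec hD hpar
  -- `R c` is contained in the graph of h; `hanc` below says that it covers all ancestors of c.
  have hmem : ∀ m c u v, c ≤ S.card → par^[m] c = S.card → (u, v) ∈ R c → v = h u := by
    intro m
    induction m with
    | zero =>
      rintro c u v - rfl hu
      obtain ⟨-, h0, -⟩ := hR 0 (by rw [hS.card_eq]; exact A.card_pos)
      simp [h0] at hu
    | succ m ih =>
      intro c u v hc hm hu
      rcases hc.eq_or_lt with rfl | hc
      · obtain ⟨-, h0, -⟩ := hR 0 (by rw [hS.card_eq]; exact A.card_pos)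
        simp [h0] at hu
      · rw [(hR c hc).1, List.mem_cons] at hu
        rcases hu with hu | hu
        · rw [Prod.mk.injEq] at hu
          rw [hu.1, hu.2]
        · exact ih (par c) u v (hpar c hc) (by rwa [← Function.iterate_succ_apply]) hu
  have hanc : ∀ m c, c < S.card → par^[m] c < S.card → (par^[m] c, h (par^[m] c)) ∈ R c := by
    intro m
    induction m with
    | zero =>
      intro c hc _
      rw [(hR c hc).1]
      simp
    | succ m ih =>
      intro c hc hm
      rw [Function.iterate_succ_apply] at hm ⊢
      rcases (hpar c hc).eq_or_lt with h0 | h0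
      · rw [h0, Function.iterate_fixed hk] at hm
        exact absurd hm (lt_irrefl _)
      · rw [(hR c hc).1]
        exact List.mem_cons_of_mem _ (ih (par c) h0 hm)
  have hlt : ∀ a : Fin A.card, (a : ℕ) < S.card := fun a => by rw [hS.card_eq]; exact a.2
  refine ⟨fun a => ⟨h a, by rw [← hT.card_eq]; exact (hR a (hlt a)).2.2.1⟩, fun i t ht => ?_,
    fun a a' e => ?_⟩
  · have hi : (i : ℕ) < S.count := by rw [hS.count_eq]; exact i.2
    obtain ⟨j, hj, hjt⟩ := (hS.mem_iff i t).1 ht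
    obtain ⟨c, hc, hcl⟩ := hpath i hi j hj
    obtain ⟨j', hj', hl⟩ := (hR c hc).2.2.2.2 i hi j hj fun l hl => by
      obtain ⟨m, -, hm⟩ := hcl l hl
      rw [← hm]
      refine ⟨_, hanc m c hc ?_, rfl⟩
      rw [hm, hS.card_eq]
      exact hS.entry_lt i j hj l (by rwa [← hS.ar_eq])
    refine (hT.mem_iff i _).2 ⟨j', hj', fun l => ?_⟩
    obtain ⟨⟨u, v⟩, hc', h1, h2⟩ := hl l (by rw [hS.ar_eq]; exact l.2)
    dsimp only at h1 h2
    rw [← h2, hmem D c u v hc.le (hD c hc.le) hc', h1, hjt]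
    rfl
  · have e' : h a = h a' := congrArg Fin.val e
    have h1 := (hR a (hlt a)).2.2
    have h2 := (hR a' (hlt a')).2.2
    rcases lt_trichotomy (a : ℕ) a' with h0 | h0 | h0
    · exact absurd h1.2.1 (e' ▸ hcol a' (hlt a') a h0 _ h2.1 h2.2.1)
    · exact Fin.ext h0
    · exact absurd h2.2.1 (e' ▸ hcol a (hlt a) a' h0 _ h1.1 h1.2.1)

end Sound

/-- The given homomorphism answers every existential quantifier. Levels rise by one along each edge
and are at most D, so at remaining depth 0 there are no children left. -/
theorem extendable_of_embeds {S T : Table} {τ : Vocab} {A B : FinStr τ} (hS : S.Presents A)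
    (hT : T.Presents B) {par : ℕ → ℕ} {col : ℕ → ℕ → Prop} {D : ℕ} (lev : ℕ → ℕ)
    (hlev : ∀ a < S.card, lev a = lev (par a) + 1 ∧ lev a ≤ D) {h : Fin A.card → Fin B.card}
    (hh : A.IsHom B h) (hcol : ∀ a : Fin A.card, col a (h a)) (d q : ℕ) (ρ : List (ℕ × ℕ)) (hq : lev q + d = D)
    (hρ : ∀ c ∈ ρ, ∃ a : Fin A.card, c = (↑a, ↑(h a))) : Extendable S T par col d q ρ := by
  induction d generalizing q ρ with
  | zero =>
    rintro a ha rfl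
    have := hlev a ha
    omega
  | succ d ih =>
    rintro a ha rfl
    have ha' : a < A.card := by rwa [← hS.card_eq]
    have hρ' : ∀ c ∈ ((a, (h ⟨a, ha'⟩ : ℕ)) :: ρ), ∃ a : Fin A.card, c = (↑a, ↑(h a)) := by
      intro c hc
      rcases List.mem_cons.1 hc with rfl | hc
      · exact ⟨⟨a, ha'⟩, rfl⟩
      · exact hρ c hc
    refine ⟨h ⟨a, ha'⟩, by rw [hT.card_eq]; exact (h _).2, hcol ⟨a, ha'⟩, ?_,
      ih _ _ (by have := hlev a ha; omega) hρ'⟩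
    intro i hi j hj hl
    rw [hS.count_eq] at hi
    have har := hS.ar_eq ⟨i, hi⟩
    dsimp only at har
    let t : Fin (τ.get ⟨i, hi⟩) → Fin A.card := fun l =>
      ⟨S.entry i j l, hS.entry_lt ⟨i, hi⟩ j hj l l.2⟩
    have ht : t ∈ A.rel ⟨i, hi⟩ := (hS.mem_iff _ _).2 ⟨j, hj, fun l => rfl⟩
    obtain ⟨j', hj', h1⟩ := (hT.mem_iff _ _).1 (hh _ t ht)
    refine ⟨j', hj', fun l hl' => ?_⟩
    obtain ⟨c, hc, hcl⟩ := hl l hl'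
    obtain ⟨u, rfl⟩ := hρ' c hc
    refine ⟨_, hc, hcl, ?_⟩
    have h2 := h1 ⟨l, by rwa [← har]⟩
    dsimp only at h2 hcl ⊢
    rw [h2]
    have : t ⟨l, by rwa [← har]⟩ = u := Fin.ext hcl.symm
    simp only [Function.comp, this]

/-! ### Forests for bounded tree depth -/

/-- If no admissible height were at most w, all of them would be at least w + 1, and so would their
infimum. -/
theorem treeDepthLE_of_treeDepth_le {V : Type} {G : SimpleGraph V} {w : ℕ}
    (h : treeDepth G ≤ w) : ∃ d ≤ w, TreeDepthLE G d := by
  by_contra hc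
  push Not at hc
  have : ((w + 1 : ℕ) : ℕ∞) ≤ treeDepth G := le_iInf₂ fun d hd => by
    have : w < d := not_le.1 fun hdw => hc d hdw hd
    exact_mod_cast this
  have := this.trans h
  norm_cast at this
  omega

/-- Paths in a tree are unique, so p is the initial segment of q ending at u. -/
theorem isTree_support_prefix {W : Type} {T : SimpleGraph W} (hT : T.IsTree) {r u v : W}
    {p : T.Walk r u} {q : T.Walk r v} (hp : p.IsPath) (hq : q.IsPath) (hu : u ∈ q.support) :
    p.support <+: q.support := by
  classical
  have h : p = q.takeUntil u hu := by
    have := (hT.isAcyclic.subsingleton_path r u).elim ⟨p, hp⟩ ⟨_, hq.takeUntil hu⟩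
    exact congrArg Subtype.val this
  rw [h]
  exact q.support_takeUntil_prefix_support hu

/-- Each vertex is represented by the path from the root to its image in the tree of its component,
tagged by the component. The last entry of the path determines the vertex, and the ancestor relation
becomes the prefix relation. The trees themselves are no longer needed. -/
theorem TreeDepthLE.exists_lists {V : Type} {G : SimpleGraph V} {d : ℕ} (h : TreeDepthLE G d) :
    ∃ (X : Type) (L : V → List X), Function.Injective L ∧ (∀ a, (L a).length ≤ d + 1) ∧
      ∀ a b, G.Adj a b → L a <+: L b ∨ L b <+: L a := by
  choose W _ T r hT hd hC using h
  choose P hP hPd using fun C v => (hT C).connected.exists_path_of_dist (r C) v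
  let f := fun C => (hC C).some
  let F : (C : G.ConnectedComponent) → (v : V) → v ∈ C.supp → List (Σ C, W C) := fun C v hv =>
    (P C (f C ⟨v, hv⟩)).support.map (Sigma.mk C)
  let L : V → List (Σ C, W C) := fun v => F (G.connectedComponentMk v) v rfl
  have hL : ∀ C v (hv : v ∈ C.supp), L v = F C v hv := by
    rintro C v rfl
    rfl
  have hlast : ∀ C v (hv : v ∈ C.supp), (F C v hv).getLast? = some ⟨C, f C ⟨v, hv⟩⟩ := by
    intro C v hv
    rw [List.getLast?_map, List.getLast?_eq_some_getLast (SimpleGraph.Walk.support_ne_nil _),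
      SimpleGraph.Walk.getLast_support]
    rfl
  refine ⟨Σ C, W C, L, fun a b hab => ?_, fun a => ?_, fun a b hab => ?_⟩
  · have key : ∀ C C' (ha : a ∈ C.supp) (hb : b ∈ C'.supp),
        (⟨C, f C ⟨a, ha⟩⟩ : Σ C, W C) = ⟨C', f C' ⟨b, hb⟩⟩ → a = b := by
      intro C C' ha hb e
      obtain rfl := congrArg Sigma.fst e
      have := (f C).injective (eq_of_heq (Sigma.mk.inj_iff.1 e).2)
      exact congrArg Subtype.val this
    refine key _ _ rfl rfl ?_
    have := (hlast _ a rfl).symm.trans ((congrArg List.getLast? hab).trans (hlast _ b rfl))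
    exact Option.some.inj this
  · simp only [L, F, List.length_map, SimpleGraph.Walk.length_support, hPd]
    exact Nat.succ_le_succ (hd _ _)
  · obtain ⟨C, ha, hb⟩ : ∃ C : G.ConnectedComponent, a ∈ C.supp ∧ b ∈ C.supp :=
      ⟨_, rfl, (SimpleGraph.ConnectedComponent.eq.2 hab.reachable).symm⟩
    rw [hL _ a ha, hL _ b hb]
    have hadj : C.toSimpleGraph.Adj ⟨a, ha⟩ ⟨b, hb⟩ := hab
    have := (f C).toHom.map_adj hadj
    rcases ((SimpleGraph.fromRel_adj _ _ _).1 this).2 with ⟨p, hp, hmem⟩ | ⟨p, hp, hmem⟩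
    · left
      have h1 := (isTree_support_prefix (hT C) (hP C _) hp hmem).trans
        (isTree_support_prefix (hT C) hp (hP C _) (SimpleGraph.Walk.end_mem_support _))
      exact h1.map _
    · right
      have h1 := (isTree_support_prefix (hT C) (hP C _) hp hmem).trans
        (isTree_support_prefix (hT C) hp (hP C _) (SimpleGraph.Walk.end_mem_support _))
      exact h1.map _

/-- The prefixes of a list form a chain. The parent of a is the element with the longest proper
prefix of `L a`, or the virtual root k if there is none; tree nodes that represent no element are
skipped. The level counts the prefixes that belong to elements. -/
theorem exists_parent {k d : ℕ} {X : Type} (L : Fin k → List X) (hL : Function.Injective L)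
    (hd : ∀ a, (L a).length ≤ d + 1) : ∃ par lev : ℕ → ℕ, par k = k ∧ lev k = 0 ∧
      (∀ a < k, par a ≤ k ∧ lev a = lev (par a) + 1 ∧ lev a ≤ d + 2) ∧
      ∀ a c : Fin k, L a <+: L c → ∃ m < d + 3, par^[m] c = a := by
  classical
  let up : Fin k → Finset (Fin k) := fun a => Finset.univ.filter fun y => L y <+: L a
  have hup : ∀ a y, y ∈ up a ↔ L y <+: L a := fun a y => by simp [up]
  have hq : ∀ a, ∃ q : ℕ, (q = k ∧ up a = {a}) ∨
      ∃ y : Fin k, q = y ∧ y ≠ a ∧ a ∉ up y ∧ up a = insert a (up y) := fun a => by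
    rcases (up a \ {a}).eq_empty_or_nonempty with h | h
    · refine ⟨k, .inl ⟨rfl, ?_⟩⟩
      rw [Finset.sdiff_eq_empty_iff_subset] at h
      exact h.antisymm (by simp [hup])
    -- Maximality of y and comparability of prefixes give `up a = insert a (up y)`, so the level
    -- drops by exactly one.
    · obtain ⟨y, hy, hmax⟩ := Finset.exists_max_image _ (fun y => (L y).length) h
      rw [Finset.mem_sdiff, hup, Finset.mem_singleton] at hy
      refine ⟨y, .inr ⟨y, rfl, hy.2, fun ha => hy.2 (hL ?_), ?_⟩⟩
      · exact hy.1.eq_of_length (le_antisymm hy.1.length_le ((hup _ _).1 ha).length_le)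
      · ext z
        rw [Finset.mem_insert, hup, hup]
        constructor
        · intro hz
          by_cases hza : z = a
          · exact .inl hza
          · exact .inr (List.prefix_of_prefix_length_le hz hy.1 (hmax z (by simp [hup, hz, hza])))
        · rintro (rfl | hz)
          · exact List.prefix_rfl
          · exact hz.trans hy.1
  choose q hq using hq
  have hqk : ∀ a, q a ≤ k := fun a => by
    rcases hq a with ⟨h, -⟩ | ⟨y, h, -⟩
    · exact h.le
    · rw [h]; exact y.2.le
  -- Elements of a chain are separated by their lengths, which range over 0, …, d + 1.
  have hlev : ∀ a, (up a).card ≤ d + 2 := fun a => by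
    refine (Finset.card_le_card_of_injOn (t := Finset.range (d + 2)) (fun y => (L y).length)
      (fun y _ => ?_) fun y hy z hz h => ?_).trans (by simp)
    · have := hd y
      simp; omega
    · rw [Finset.mem_coe, hup] at hy hz
      have h : (L y).length = (L z).length := h
      exact hL ((List.prefix_of_prefix_length_le hy hz h.le).eq_of_length h)
  let par : ℕ → ℕ := fun a => if h : a < k then q ⟨a, h⟩ else k
  let lev : ℕ → ℕ := fun a => if h : a < k then (up ⟨a, h⟩).card else 0
  have hpar : ∀ a : Fin k, par a = q a := fun a => dif_pos a.2
  have hl : ∀ a : Fin k, lev a = (up a).card := fun a => dif_pos a.2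
  have hlk : lev k = 0 := dif_neg (lt_irrefl k)
  refine ⟨par, lev, dif_neg (lt_irrefl k), hlk, fun a ha => ?_, ?_⟩
  · lift a to Fin k using ha
    rw [hpar, hl]
    refine ⟨hqk a, ?_, hlev a⟩
    rcases hq a with ⟨h, h'⟩ | ⟨y, h, -, h1, h'⟩
    · rw [h, h', hlk]
      rfl
    · rw [h, hl, h', Finset.card_insert_of_notMem h1]
  · have key : ∀ n, ∀ a c : Fin k, (up c).card ≤ n → L a <+: L c → ∃ m < n + 1, par^[m] c = a := by
      intro n
      induction n with
      | zero =>
        intro a c hc hac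
        have : c ∈ up c := (hup _ _).2 List.prefix_rfl
        rw [Finset.card_eq_zero.1 (Nat.le_zero.1 hc)] at this
        simp at this
      | succ n ih =>
        intro a c hc hac
        by_cases hne : a = c
        · exact ⟨0, by omega, by rw [hne]; rfl⟩
        · have ha := (hup _ _).2 hac
          rcases hq c with ⟨h, h'⟩ | ⟨y, h, -, h1, h'⟩
          · rw [h', Finset.mem_singleton] at ha
            exact absurd ha hne
          · rw [h', Finset.card_insert_of_notMem h1] at hc
            rw [h', Finset.mem_insert] at ha
            obtain ⟨m, hm, hm'⟩ := ih a y (by omega) ((hup _ _).1 (ha.resolve_left hne))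
            exact ⟨m + 1, by omega, by rw [Function.iterate_succ_apply, hpar, h, hm']⟩
    exact fun a c h => key (d + 2) a c (hlev c) h

/-- The entries of a tuple are pairwise equal or adjacent, so their lists are pairwise comparable.
All of them are prefixes of the longest one, and hence lie on the root path of that entry. -/
theorem exists_forest {τ : Vocab} {A : FinStr τ} {S : Table} (hS : S.Presents A) {w : ℕ}
    (h : treeDepth A.gaifman ≤ w) : ∃ par lev : ℕ → ℕ, par S.card = S.card ∧ lev S.card = 0 ∧
      (∀ a < S.card, par a ≤ S.card ∧ lev a = lev (par a) + 1 ∧ lev a ≤ w + 2) ∧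
      TuplesOnPaths S par (w + 2) := by
  obtain ⟨d, hdw, hd⟩ := treeDepthLE_of_treeDepth_le h
  obtain ⟨X, L, hL, hlen, hadj⟩ := hd.exists_lists
  obtain ⟨par, lev, h1, h2, h3, h4⟩ := exists_parent L hL hlen
  rw [← hS.card_eq] at h1 h2 h3
  refine ⟨par, lev, h1, h2, fun a ha => ⟨(h3 a ha).1, (h3 a ha).2.1, (h3 a ha).2.2.trans (by omega)⟩,
    fun i hi j hj => ?_⟩
  rw [hS.count_eq] at hi
  have har := hS.ar_eq ⟨i, hi⟩
  dsimp only at har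
  let t : Fin (τ.get ⟨i, hi⟩) → Fin A.card := fun l =>
    ⟨S.entry i j l, hS.entry_lt ⟨i, hi⟩ j hj l l.2⟩
  have ht : t ∈ A.rel ⟨i, hi⟩ := (hS.mem_iff _ _).2 ⟨j, hj, fun l => rfl⟩
  rcases Nat.eq_zero_or_pos (τ.get ⟨i, hi⟩) with h0 | h0
  -- A nullary tuple has no entries, so any element serves.
  · exact ⟨0, by rw [hS.card_eq]; exact A.card_pos, fun l hl => by omega⟩
  · obtain ⟨l₀, -, hmax⟩ := Finset.exists_max_image Finset.univ (fun l => (L (t l)).length)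
      ⟨⟨0, h0⟩, Finset.mem_univ _⟩
    refine ⟨t l₀, by rw [hS.card_eq]; exact (t l₀).2, fun l hl => ?_⟩
    rw [har] at hl
    have hpre : L (t ⟨l, hl⟩) <+: L (t l₀) := by
      have hm := hmax ⟨l, hl⟩ (Finset.mem_univ _)
      by_cases he : t ⟨l, hl⟩ = t l₀
      · rw [he]
      · rcases hadj (t ⟨l, hl⟩) (t l₀) ⟨he, ⟨i, hi⟩, t, ht, ⟨_, rfl⟩, ⟨_, rfl⟩⟩ with hp | hp
        · exact hp
        · rw [hp.eq_of_length (le_antisymm hp.length_le hm)]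
    obtain ⟨m, hm, hm'⟩ := h4 _ _ hpre
    exact ⟨m, by omega, hm'⟩

/-! ### Deciding embeddability in logarithmic space -/

theorem LSTable.comp {T : α → Table} (hT : LSTable T) {β : Type} [Ctx β] {π : β → α}
    (hπ : Extends π) : LSTable fun b => T (π b) where
  card := hπ.2 _ hT.card
  count := hπ.2 _ hT.count
  ar γ _ ρ hρ f hf := hT.ar γ (fun c => π (ρ c)) (hπ.comp hρ) f hf
  cnt γ _ ρ hρ f hf := hT.cnt γ (fun c => π (ρ c)) (hπ.comp hρ) f hf
  entry γ _ ρ hρ i j l hi hj hl := hT.entry γ (fun c => π (ρ c)) (hπ.comp hρ) i j l hi hj hl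

/-- Predicates that are computable together with their two arguments. -/
def LSPF₂ (V : α → ℕ → ℕ → Prop) : Prop :=
  ∀ (β : Type) [Ctx β] (π : β → α), Extends π → ∀ f g : β → ℕ, LS f → LS g →
    LSP fun b => V (π b) (f b) (g b)

/-- The values of a list of pairs of functions. -/
def pairsAt {α : Type} (ρ : List ((α → ℕ) × (α → ℕ))) (a : α) : List (ℕ × ℕ) :=
  ρ.map fun c => (c.1 a, c.2 a)

/-- The list consists of functions and its length does not depend on the input, so the quantifier is
a finite disjunction fixed in advance. -/
theorem LSP.exists_pairsAt {α β : Type} [Ctx β] (π : β → α) {ρ : List ((α → ℕ) × (α → ℕ))}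
    {R : β → ℕ × ℕ → Prop} (h : ∀ c ∈ ρ, LSP fun b => R b (c.1 (π b), c.2 (π b))) :
    LSP fun b => ∃ c ∈ pairsAt ρ (π b), R b c := by
  induction ρ with
  | nil => exact LSP.trivial.not.congr fun b => by simp [pairsAt]
  | cons c ρ ih =>
    exact ((h c (by simp)).or (ih fun c hc => h c (by simp [hc]))).congr fun b => by
      simp [pairsAt]

theorem LSP.preserves {S T : α → Table} (hS : LSTable S) (hT : LSTable T)
    {ρ : List ((α → ℕ) × (α → ℕ))} (hρ : ∀ c ∈ ρ, LS c.1 ∧ LS c.2) :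
    LSP fun a => Preserves (S a) (T a) (pairsAt ρ a) := by
  have e1 : Extends fun c : α × ℕ => c.1 := .fst
  have e2 : Extends fun c : (α × ℕ) × ℕ => c.1.1 := e1.comp .fst
  have e3 : Extends fun c : ((α × ℕ) × ℕ) × ℕ => c.1.1.1 := e2.comp .fst
  have e4 : Extends fun c : (((α × ℕ) × ℕ) × ℕ) × ℕ => c.1.1.1.1 := e3.comp .fst
  refine LSP.ball (p := fun c : α × ℕ => ∀ j < (S c.1).cnt c.2,
    (∀ l < (S c.1).ar c.2, ∃ d ∈ pairsAt ρ c.1, d.1 = (S c.1).entry c.2 j l) →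
      ∃ j' < (T c.1).cnt c.2, ∀ l < (S c.1).ar c.2, ∃ d ∈ pairsAt ρ c.1,
        d.1 = (S c.1).entry c.2 j l ∧ d.2 = (T c.1).entry c.2 j' l) hS.count ?_
  refine LSP.ball (p := fun c : (α × ℕ) × ℕ =>
    (∀ l < (S c.1.1).ar c.1.2, ∃ d ∈ pairsAt ρ c.1.1, d.1 = (S c.1.1).entry c.1.2 c.2 l) →
      ∃ j' < (T c.1.1).cnt c.1.2, ∀ l < (S c.1.1).ar c.1.2, ∃ d ∈ pairsAt ρ c.1.1,
        d.1 = (S c.1.1).entry c.1.2 c.2 l ∧ d.2 = (T c.1.1).entry c.1.2 j' l)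
    (hS.cnt _ _ e1 _ .var) ?_
  refine LSP.imp (LSP.ball (p := fun c : ((α × ℕ) × ℕ) × ℕ => ∃ d ∈ pairsAt ρ c.1.1.1,
    d.1 = (S c.1.1.1).entry c.1.1.2 c.1.2 c.2) (hS.ar _ _ e2 _ LS.var.wk) ?_) ?_
  · exact LSP.exists_pairsAt (fun c : ((α × ℕ) × ℕ) × ℕ => c.1.1.1) fun d hd =>
      LSP.eq (e3.2 _ (hρ d hd).1) (hS.entry _ _ e3 _ _ _ LS.var.wk.wk LS.var.wk .var)
  · refine LSP.bex (p := fun c : ((α × ℕ) × ℕ) × ℕ => ∀ l < (S c.1.1.1).ar c.1.1.2,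
      ∃ d ∈ pairsAt ρ c.1.1.1, d.1 = (S c.1.1.1).entry c.1.1.2 c.1.2 l ∧
        d.2 = (T c.1.1.1).entry c.1.1.2 c.2 l) (hT.cnt _ _ e2 _ LS.var.wk) ?_
    refine LSP.ball (p := fun c : (((α × ℕ) × ℕ) × ℕ) × ℕ => ∃ d ∈ pairsAt ρ c.1.1.1.1,
      d.1 = (S c.1.1.1.1).entry c.1.1.1.2 c.1.1.2 c.2 ∧
        d.2 = (T c.1.1.1.1).entry c.1.1.1.2 c.1.2 c.2) (hS.ar _ _ e3 _ LS.var.wk.wk) ?_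
    exact LSP.exists_pairsAt (fun c : (((α × ℕ) × ℕ) × ℕ) × ℕ => c.1.1.1.1) fun d hd =>
      (LSP.eq (e4.2 _ (hρ d hd).1)
        (hS.entry _ _ e4 _ _ _ LS.var.wk.wk.wk LS.var.wk.wk .var)).and
      (LSP.eq (e4.2 _ (hρ d hd).2)
        (hT.entry _ _ e4 _ _ _ LS.var.wk.wk.wk LS.var.wk .var))

/-- Induction on the depth d, which is a constant of the program: each level adds two bounded
quantifiers and two numbers to the context. This is where bounded tree depth yields logarithmic
space. -/
theorem LSP.extendable {S T : α → Table} {par : α → ℕ → ℕ} {col : α → ℕ → ℕ → Prop}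
    (hS : LSTable S) (hT : LSTable T) (hpar : LSF par) (hcol : LSPF₂ col) (d : ℕ) :
    ∀ (β : Type) [Ctx β] (π : β → α), Extends π → ∀ q : β → ℕ, LS q →
      ∀ ρ : List ((β → ℕ) × (β → ℕ)), (∀ c ∈ ρ, LS c.1 ∧ LS c.2) →
        LSP fun b => Extendable (S (π b)) (T (π b)) (par (π b)) (col (π b)) d (q b)
          (pairsAt ρ b) := by
  induction d with
  | zero =>
    intro β _ π hπ q hq ρ _
    exact LSP.ball (p := fun c : β × ℕ => par (π c.1) c.2 ≠ q c.1) (hπ.2 _ hS.card)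
      (LSP.eq (hpar _ (fun c : β × ℕ => π c.1) (hπ.comp .fst) _ .var) hq.wk).not
  | succ d ih =>
    intro β _ π hπ q hq ρ hρ
    have e2 : Extends fun c : (β × ℕ) × ℕ => π c.1.1 := hπ.comp (Extends.fst.comp .fst)
    let ρ' : List (((β × ℕ) × ℕ → ℕ) × ((β × ℕ) × ℕ → ℕ)) :=
      (fun c => c.1.2, fun c => c.2) :: ρ.map fun e => (fun c => e.1 c.1.1, fun c => e.2 c.1.1)
    have hρ' : ∀ c ∈ ρ', LS c.1 ∧ LS c.2 := by
      intro c hc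
      rcases List.mem_cons.1 hc with rfl | hc
      · exact ⟨LS.var.wk, .var⟩
      · obtain ⟨e, he, rfl⟩ := List.mem_map.1 hc
        exact ⟨(hρ e he).1.wk.wk, (hρ e he).2.wk.wk⟩
    have hev : ∀ c, pairsAt ρ' c = (c.1.2, c.2) :: pairsAt ρ c.1.1 := fun c => by
      simp [ρ', pairsAt]
    refine LSP.ball (p := fun c : β × ℕ => par (π c.1) c.2 = q c.1 → ∃ b < (T (π c.1)).card,
      col (π c.1) c.2 b ∧ Preserves (S (π c.1)) (T (π c.1)) ((c.2, b) :: pairsAt ρ c.1) ∧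
        Extendable (S (π c.1)) (T (π c.1)) (par (π c.1)) (col (π c.1)) d c.2
          ((c.2, b) :: pairsAt ρ c.1)) (hπ.2 _ hS.card)
      ((LSP.eq (hpar _ (fun c : β × ℕ => π c.1) (hπ.comp .fst) _ .var) hq.wk).imp ?_)
    refine LSP.bex (p := fun c : (β × ℕ) × ℕ => col (π c.1.1) c.1.2 c.2 ∧
      Preserves (S (π c.1.1)) (T (π c.1.1)) ((c.1.2, c.2) :: pairsAt ρ c.1.1) ∧
        Extendable (S (π c.1.1)) (T (π c.1.1)) (par (π c.1.1)) (col (π c.1.1)) d c.1.2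
          ((c.1.2, c.2) :: pairsAt ρ c.1.1)) ((hπ.comp .fst).2 _ hT.card) ?_
    simp only [← hev]
    exact (hcol _ _ e2 _ _ LS.var.wk .var).and
      ((LSP.preserves (hS.comp e2) (hT.comp e2) hρ').and (ih _ _ e2 _ LS.var.wk ρ' hρ'))

theorem LSP.tuplesOnPaths {S : α → Table} {par : α → ℕ → ℕ} (hS : LSTable S) (hpar : LSF par)
    (hb : ∀ a c, par a c ≤ (S a).card) (D : ℕ) :
    (LSP fun a => ∀ c < (S a).card, (par a)^[D] c = (S a).card) ∧
      LSP fun a => TuplesOnPaths (S a) (par a) D := by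
  have e1 : Extends fun c : α × ℕ => c.1 := .fst
  have e2 : Extends fun c : (α × ℕ) × ℕ => c.1.1 := e1.comp .fst
  have e3 : Extends fun c : ((α × ℕ) × ℕ) × ℕ => c.1.1.1 := e2.comp .fst
  have e4 : Extends fun c : (((α × ℕ) × ℕ) × ℕ) × ℕ => c.1.1.1.1 := e3.comp .fst
  have e5 : Extends fun c : ((((α × ℕ) × ℕ) × ℕ) × ℕ) × ℕ => c.1.1.1.1.1 := e4.comp .fst
  have hit : ∀ (β : Type) [Ctx β] (π : β → α), Extends π → ∀ c m : β → ℕ, LS c → LS m →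
      LS fun b => (par (π b))^[m b] (c b) := by
    intro β _ π hπ c m hc hm
    refine LS.iterate (F := fun b => par (π b)) hm hc
      (hpar _ _ (hπ.comp (Extends.fst.comp .fst)) _ .var)
      ⟨_, hc.polyB.add (hπ.2 _ hS.card).polyB, fun b i _ => ?_⟩
    rcases i with _ | i
    · exact Nat.le_add_right _ _
    · rw [Function.iterate_succ_apply']
      exact (hb _ _).trans (Nat.le_add_left _ _)
  constructor
  · exact LSP.ball (p := fun c : α × ℕ => (par c.1)^[D] c.2 = (S c.1).card) hS.card
      (LSP.eq (hit _ _ e1 _ _ .var (.const D)) hS.card.wk)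
  · refine LSP.ball (p := fun c : α × ℕ => ∀ j < (S c.1).cnt c.2, ∃ u < (S c.1).card,
      ∀ l < (S c.1).ar c.2, ∃ m < D + 1, (par c.1)^[m] u = (S c.1).entry c.2 j l) hS.count ?_
    refine LSP.ball (p := fun c : (α × ℕ) × ℕ => ∃ u < (S c.1.1).card,
      ∀ l < (S c.1.1).ar c.1.2, ∃ m < D + 1,
        (par c.1.1)^[m] u = (S c.1.1).entry c.1.2 c.2 l) (hS.cnt _ _ e1 _ .var) ?_
    refine LSP.bex (p := fun c : ((α × ℕ) × ℕ) × ℕ => ∀ l < (S c.1.1.1).ar c.1.1.2, ∃ m < D + 1,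
      (par c.1.1.1)^[m] c.2 = (S c.1.1.1).entry c.1.1.2 c.1.2 l) (e2.2 _ hS.card) ?_
    refine LSP.ball (p := fun c : (((α × ℕ) × ℕ) × ℕ) × ℕ => ∃ m < D + 1,
      (par c.1.1.1.1)^[m] c.1.2 = (S c.1.1.1.1).entry c.1.1.1.2 c.1.1.2 c.2)
      (hS.ar _ _ e3 _ LS.var.wk.wk) ?_
    exact LSP.bex (p := fun c : ((((α × ℕ) × ℕ) × ℕ) × ℕ) × ℕ =>
      (par c.1.1.1.1.1)^[c.2] c.1.1.2 = (S c.1.1.1.1.1).entry c.1.1.1.1.2 c.1.1.1.2 c.1.2)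
      (.const _) (LSP.eq (hit _ _ e5 _ _ LS.var.wk.wk .var)
        (hS.entry _ _ e5 _ _ _ LS.var.wk.wk.wk.wk LS.var.wk.wk.wk LS.var.wk))

/-! #### Guessing a forest and a colouring -/

/-- The parent function of a forest on the numbers below `k`, with root `k`, encoded by the binary
digits of `P`. -/
noncomputable def parent (k P a : ℕ) : ℕ :=
  if a < k then least k fun q => P.testBit (q + (k + 1) * a) = true else k

theorem parent_le (k P a : ℕ) : parent k P a ≤ k := by
  unfold parent
  split_ifs
  exacts [least_le _ _, le_rfl]

/-- The hash value of `b` is among the colours of `a` encoded by the binary digits of `g`. -/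
def HasColor (t p q g a b : ℕ) : Prop := g.testBit (a * t + hash t p q b) = true

/-- The parameters `P`, `g`, `p` and `q` show that there is an embedding. -/
def Witness (S T : Table) (D P g p q : ℕ) : Prop :=
  (∀ a < S.card, (parent S.card P)^[D] a = S.card) ∧ TuplesOnPaths S (parent S.card P) D ∧
    (∀ a < S.card, ∀ a' < a, ∀ b < T.card, HasColor (S.card ^ 2 + 1) p q g a b →
      ¬ HasColor (S.card ^ 2 + 1) p q g a' b) ∧
    Extendable S T (parent S.card P) (HasColor (S.card ^ 2 + 1) p q g) D S.card []

/-- There are suitable parameters, with `P` and `g` below `m`. -/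
def HasWitness (S T : Table) (D m : ℕ) : Prop :=
  ∃ P < m, ∃ g < m, ∃ p < 2 * T.card + 1, ∃ q < 2 * T.card + 1, Witness S T D P g p q

theorem LSF.parent {k P : α → ℕ} (hk : LS k) (hP : LS P) : LSF fun a => parent (k a) (P a) :=
  fun β _ π hπ f hf => by
    have hk := hπ.2 k hk
    have hP := hπ.2 P hP
    exact LS.ite (LSP.lt hf hk) (LS.least (p := fun c : β × ℕ =>
      (P (π c.1)).testBit (c.2 + (k (π c.1) + 1) * f c.1) = true) hk
        (LSP.testBit hP.wk (LS.var.add (hk.wk.succ.mul hf.wk)))) hk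

theorem LSPF₂.hasColor {t p q g : α → ℕ} (ht : LS t) (hp : LS p) (hq : LS q) (hg : LS g) :
    LSPF₂ fun a => HasColor (t a) (p a) (q a) (g a) := fun _ _ _ hπ _ _ hf hh =>
  LSP.testBit (hπ.2 g hg) ((hf.mul (hπ.2 t ht)).add
    ((((hπ.2 q hq).mul hh).mod (hπ.2 p hp)).mod (hπ.2 t ht)))

theorem LSP.witness {S T : α → Table} {P g p q : α → ℕ} (hS : LSTable S) (hT : LSTable T) (D : ℕ)
    (hP : LS P) (hg : LS g) (hp : LS p) (hq : LS q) :
    LSP fun a => Witness (S a) (T a) D (P a) (g a) (p a) (q a) := by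
  have hpar : LSF fun a => ParaEmb.parent (S a).card (P a) := LSF.parent hS.card hP
  have hcol := LSPF₂.hasColor (t := fun a => (S a).card ^ 2 + 1)
    ((hS.card.mul hS.card).succ.congr fun a => by ring) hp hq hg
  obtain ⟨h1, h2⟩ := LSP.tuplesOnPaths hS hpar (fun _ _ => parent_le _ _ _) D
  have e1 : Extends fun c : α × ℕ => c.1 := .fst
  have e2 : Extends fun c : (α × ℕ) × ℕ => c.1.1 := e1.comp .fst
  have e3 : Extends fun c : ((α × ℕ) × ℕ) × ℕ => c.1.1.1 := e2.comp .fst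
  refine h1.and (h2.and (LSP.and ?_
    (LSP.extendable hS hT hpar hcol D α _ .id _ hS.card [] (by simp))))
  refine LSP.ball (p := fun c : α × ℕ => ∀ a' < c.2, ∀ b < (T c.1).card,
    HasColor ((S c.1).card ^ 2 + 1) (p c.1) (q c.1) (g c.1) c.2 b →
      ¬ HasColor ((S c.1).card ^ 2 + 1) (p c.1) (q c.1) (g c.1) a' b) hS.card ?_
  refine LSP.ball (p := fun c : (α × ℕ) × ℕ => ∀ b < (T c.1.1).card,
    HasColor ((S c.1.1).card ^ 2 + 1) (p c.1.1) (q c.1.1) (g c.1.1) c.1.2 b →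
      ¬ HasColor ((S c.1.1).card ^ 2 + 1) (p c.1.1) (q c.1.1) (g c.1.1) c.2 b) .var ?_
  exact LSP.ball (p := fun c : ((α × ℕ) × ℕ) × ℕ =>
    HasColor ((S c.1.1.1).card ^ 2 + 1) (p c.1.1.1) (q c.1.1.1) (g c.1.1.1) c.1.1.2 c.2 →
      ¬ HasColor ((S c.1.1.1).card ^ 2 + 1) (p c.1.1.1) (q c.1.1.1) (g c.1.1.1) c.1.2 c.2)
    (e2.2 _ hT.card) ((hcol _ _ e3 _ _ LS.var.wk.wk .var).imp
      (hcol _ _ e3 _ _ LS.var.wk .var).not)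

theorem LSP.hasWitness {S T : α → Table} {m : α → ℕ} (hS : LSTable S) (hT : LSTable T) (D : ℕ)
    (hm : LS m) : LSP fun a => HasWitness (S a) (T a) D (m a) := by
  have e1 : Extends fun c : α × ℕ => c.1 := .fst
  have e2 : Extends fun c : (α × ℕ) × ℕ => c.1.1 := e1.comp .fst
  have e3 : Extends fun c : ((α × ℕ) × ℕ) × ℕ => c.1.1.1 := e2.comp .fst
  have e4 : Extends fun c : (((α × ℕ) × ℕ) × ℕ) × ℕ => c.1.1.1.1 := e3.comp .fst
  have hn : LS fun a => 2 * (T a).card + 1 := ((LS.const 2).mul hT.card).succ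
  refine LSP.bex (p := fun c : α × ℕ => ∃ g < m c.1, ∃ p < 2 * (T c.1).card + 1,
    ∃ q < 2 * (T c.1).card + 1, Witness (S c.1) (T c.1) D c.2 g p q) hm ?_
  refine LSP.bex (p := fun c : (α × ℕ) × ℕ => ∃ p < 2 * (T c.1.1).card + 1,
    ∃ q < 2 * (T c.1.1).card + 1, Witness (S c.1.1) (T c.1.1) D c.1.2 c.2 p q) hm.wk ?_
  refine LSP.bex (p := fun c : ((α × ℕ) × ℕ) × ℕ => ∃ q < 2 * (T c.1.1.1).card + 1,
    Witness (S c.1.1.1) (T c.1.1.1) D c.1.1.2 c.1.2 c.2 q) hn.wk.wk ?_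
  exact LSP.bex (p := fun c : (((α × ℕ) × ℕ) × ℕ) × ℕ =>
    Witness (S c.1.1.1.1) (T c.1.1.1.1) D c.1.1.1.2 c.1.1.2 c.1.2 c.2) hn.wk.wk.wk
    (LSP.witness (hS.comp e4) (hT.comp e4) D LS.var.wk.wk.wk LS.var.wk.wk LS.var.wk .var)

/-- The guessed forest and colouring are verified as part of the witness, so soundness needs no
assumption on tree depth or on the hash function. -/
theorem Witness.embeds {S T : Table} {D P g p q : ℕ} (h : Witness S T D P g p q) {τ : Vocab}
    {A B : FinStr τ} (hS : S.Presents A) (hT : T.Presents B) : A.Embeds B := by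
  obtain ⟨h1, h2, h3, h4⟩ := h
  have hk : parent S.card P S.card = S.card := if_neg (lt_irrefl _)
  refine embeds_of_extendable hS hT hk (fun a ha => ?_) (fun a _ => parent_le _ _ _) h2 h3 h4
  rcases ha.eq_or_lt with rfl | ha
  · exact Function.iterate_fixed hk D
  · exact h1 a ha

theorem exists_testBit (n : ℕ) (f : ℕ → Prop) :
    ∃ P < 2 ^ n, ∀ i < n, P.testBit i = true ↔ f i := by
  classical
  refine ⟨Nat.ofBits fun i : Fin n => decide (f i), Nat.ofBits_lt_two_pow _, fun i hi => ?_⟩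
  rw [Nat.testBit_ofBits_lt _ _ hi]
  simp

/-- The forest comes from the tree depth bound, the hash function is injective on the image of the
embedding h, and the only colour given to an element a is the hash value of h a. -/
theorem hasWitness_of_embeds {S T : Table} {τ : Vocab} {A B : FinStr τ} (hS : S.Presents A)
    (hT : T.Presents B) {w m : ℕ} (hw : treeDepth A.gaifman ≤ w)
    (hm : 2 ^ ((S.card + 1) * (S.card + 1)) ≤ m) (hm' : 2 ^ (S.card * (S.card ^ 2 + 1)) ≤ m)
    (h : A.Embeds B) : HasWitness S T (w + 2) m := by
  obtain ⟨h, hh, hinj⟩ := h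
  obtain ⟨par, lev, h1, h2, h3, h4⟩ := exists_forest hS hw
  -- The bit at q + (k + 1) a says that q is the parent of a.
  obtain ⟨P, hP, hPb⟩ := exists_testBit ((S.card + 1) * (S.card + 1))
    fun i => par (i / (S.card + 1)) = i % (S.card + 1)
  have hpar : ∀ a ≤ S.card, parent S.card P a = par a := fun a ha => by
    rcases ha.eq_or_lt with rfl | ha
    · rw [parent, if_neg (lt_irrefl _), h1]
    · have hb : ∀ q < S.card + 1, P.testBit (q + (S.card + 1) * a) = true ↔ par a = q := by
        intro q hq
        rw [hPb _ (by nlinarith), Nat.add_mul_div_left _ _ (Nat.succ_pos _),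
          Nat.add_mul_mod_self_left, Nat.mod_eq_of_lt hq, Nat.div_eq_of_lt hq, zero_add]
      rw [parent, if_pos ha]
      have := (h3 a ha).1
      exact least_eq this ((hb _ (by omega)).2 rfl) fun j hj hj' => by
        have := (hb j (by omega)).1 hj'
        omega
  have hit : ∀ j a, a ≤ S.card → (parent S.card P)^[j] a = par^[j] a ∧ par^[j] a ≤ S.card := by
    intro j
    induction j with
    | zero => exact fun a ha => ⟨rfl, ha⟩
    | succ j ih =>
      intro a ha
      have := parent_le S.card P a
      rw [hpar a ha] at this
      rw [Function.iterate_succ_apply, Function.iterate_succ_apply, hpar a ha]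
      exact ih _ this
  have hroot : ∀ j a, a ≤ S.card → lev a ≤ j → par^[j] a = S.card := by
    intro j
    induction j with
    | zero =>
      intro a ha hl
      rcases ha.eq_or_lt with rfl | ha
      · rfl
      · have := h3 a ha
        omega
    | succ j ih =>
      intro a ha hl
      rcases ha.eq_or_lt with rfl | ha
      · exact Function.iterate_fixed h1 _
      · have := h3 a ha
        exact ih _ this.1 (by omega)
  obtain ⟨p, hp, q, hq, hpq⟩ := exists_hash (k := S.card) (n := T.card)
    (by rw [hT.card_eq]; exact B.card_pos.ne') (Finset.univ.image fun a => (h a : ℕ))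
    (fun v hv => by
      obtain ⟨a, -, rfl⟩ := Finset.mem_image.1 hv
      rw [hT.card_eq]
      exact (h a).2)
    (Finset.card_image_le.trans (by rw [Finset.card_univ, Fintype.card_fin, hS.card_eq]))
  obtain ⟨g, hg, hgb⟩ := exists_testBit (S.card * (S.card ^ 2 + 1)) fun i =>
    ∃ a : Fin A.card, i = a * (S.card ^ 2 + 1) + hash (S.card ^ 2 + 1) p q (h a)
  have hcol : ∀ a < S.card, ∀ b, HasColor (S.card ^ 2 + 1) p q g a b ↔ ∃ a' : Fin A.card,
      a = a' ∧ hash (S.card ^ 2 + 1) p q b = hash (S.card ^ 2 + 1) p q (h a') := fun a ha b => by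
    have hlt : ∀ v, hash (S.card ^ 2 + 1) p q v < S.card ^ 2 + 1 := fun v =>
      Nat.mod_lt _ (Nat.succ_pos _)
    rw [HasColor, hgb]
    · refine exists_congr fun a' => ⟨fun e => ?_, fun ⟨e1, e2⟩ => by rw [e1, e2]⟩
      have e1 := congrArg (· / (S.card ^ 2 + 1)) e
      have e2 := congrArg (· % (S.card ^ 2 + 1)) e
      simp only [mul_comm _ (S.card ^ 2 + 1), Nat.mul_add_div (Nat.succ_pos _), Nat.mul_add_mod,
        Nat.div_eq_of_lt (hlt _), Nat.mod_eq_of_lt (hlt _), add_zero] at e1 e2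
      exact ⟨e1, e2⟩
    · have := hlt b
      nlinarith
  refine ⟨P, hP.trans_le hm, g, hg.trans_le hm', p, by omega, q, by omega, fun a ha => ?_, ?_, ?_,
    ?_⟩
  · rw [(hit _ a ha.le).1, hroot _ a ha.le (h3 a ha).2.2]
  · intro i hi j hj
    obtain ⟨c, hc, hl⟩ := h4 i hi j hj
    refine ⟨c, hc, fun l hl' => ?_⟩
    obtain ⟨n, hn, hn'⟩ := hl l hl'
    exact ⟨n, hn, by rw [(hit n c hc.le).1, hn']⟩
  · intro a ha a' ha' b hb h5 h6
    obtain ⟨u, rfl, hu⟩ := (hcol a ha b).1 h5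
    obtain ⟨u', rfl, hu'⟩ := (hcol a' (ha'.trans ha) b).1 h6
    have := hpq (by simp) (by simp) (hu.symm.trans hu')
    rw [hinj (Fin.ext this)] at ha'
    exact lt_irrefl _ ha'
  · refine extendable_of_embeds hS hT (D := w + 2) lev (fun a ha => ?_) hh (fun a => ?_) _ _ _
      (by omega) (by simp)
    · rw [hpar a ha.le]
      exact (h3 a ha).2
    · exact (hcol a (by rw [hS.card_eq]; exact a.2) _).2 ⟨a, rfl, rfl⟩

/-! ### Tables of the members of a class -/

/-- The string encoded by the pair of its length and a number whose binary digits are its bits. -/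
def decodeString (z : ℕ) : List Bool :=
  (List.range z.unpair.1).map fun i => decide (z.unpair.2 / 2 ^ i % 2 = 1)

theorem decodeString_pair {e v : ℕ} {u : List Bool} (hu : u.length = e)
    (hv : ∀ i < e, v.testBit i = true ↔ u[i]? = some true) : decodeString (Nat.pair e v) = u := by
  refine List.ext_getElem (by simp [decodeString, hu]) fun i hi hi' => ?_
  have := hv i (by omega)
  rw [Nat.testBit_eq_decide_div_mod_eq, decide_eq_true_eq, List.getElem?_eq_getElem hi',
    Option.some.injEq] at this
  simp only [decodeString, Nat.unpair_pair, List.getElem_map, List.getElem_range, this]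
  cases u[i] <;> rfl

theorem primrec_pow {β : Type} [Primcodable β] {f g : β → ℕ} (hf : Primrec f) (hg : Primrec g) :
    Primrec fun b => f b ^ g b := by
  have : Primrec₂ fun m n : ℕ => m ^ n := Primrec₂.unpaired'.1 Nat.Primrec.pow
  exact this.comp hf hg

theorem computable_decodeString : Computable decodeString := by
  have h : PrimrecPred fun p : ℕ × ℕ => p.1.unpair.2 / 2 ^ p.2 % 2 = 1 :=
    Primrec.eq.comp (Primrec.nat_mod.comp (Primrec.nat_div.comp
      (Primrec.snd.comp (Primrec.unpair.comp Primrec.fst))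
      (primrec_pow (Primrec.const 2) Primrec.snd)) (Primrec.const 2)) (Primrec.const 1)
  have h' : Primrec₂ fun z i : ℕ => decide (z.unpair.2 / 2 ^ i % 2 = 1) := h.decide.to₂
  exact (Primrec.list_map (Primrec.list_range.comp (Primrec.fst.comp Primrec.unpair)) h').to_comp

open Classical in
/-- The binary digits of this number form the table of the values of `P` below `m`. -/
noncomputable def bitTable (P : ℕ → Prop) (m : ℕ) : ℕ :=
  ∑ z ∈ Finset.range m, (if P z then 1 else 0) * 2 ^ z

theorem bitTable_lt (P : ℕ → Prop) (m : ℕ) : bitTable P m < 2 ^ m := by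
  induction m with
  | zero => simp [bitTable]
  | succ m ih =>
    rw [bitTable, Finset.sum_range_succ, ← bitTable, pow_succ]
    split_ifs <;> omega

theorem testBit_bitTable (P : ℕ → Prop) {m z : ℕ} (hz : z < m) :
    (bitTable P m).testBit z = true ↔ P z := by
  induction m with
  | zero => omega
  | succ m ih =>
    rw [bitTable, Finset.sum_range_succ, ← bitTable, add_comm]
    rcases Nat.lt_succ_iff_lt_or_eq.1 hz with h | rfl
    · rw [← ih h]
      split_ifs
      · rw [one_mul, Nat.testBit_two_pow_add_gt h]
      · simp
    · have := Nat.testBit_lt_two_pow (bitTable_lt P z)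
      split_ifs with h
      · rw [one_mul, Nat.testBit_two_pow_add_eq, this]
        simpa using h
      · rw [zero_mul, zero_add, this]
        simpa using h

/-- Decidability of the class enters here: a table of all answers up to a computable bound is one
number computable from the parameter. -/
theorem computable_bitTable {Q : List Bool → Prop} (hQ : ComputablePred Q) {m : ℕ → ℕ}
    (hm : Computable m) : Computable fun k => bitTable (fun z => Q (decodeString z)) (m k) := by
  obtain ⟨_, hQ⟩ := hQ
  have h : Computable₂ fun _ z : ℕ => cond (decide (Q (decodeString z))) 1 0 * 2 ^ z :=
    (Primrec.nat_mul.to_comp.comp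
      (Computable.cond (hQ.comp (computable_decodeString.comp Computable.snd)) (.const 1) (.const 0))
      (primrec_pow (Primrec.const 2) Primrec.snd).to_comp).to₂
  refine (computable_sum h hm).of_eq fun k => Finset.sum_congr rfl fun z _ => ?_
  by_cases h : Q (decodeString z) <;> simp [h]

/-! ### Lengths of codes -/

theorem length_listCode_le {β : Type} {c : β → List Bool} {l : List β} {b : ℕ}
    (h : ∀ a ∈ l, (c a).length ≤ b) : (listCode c l).length ≤ l.length * (b + 1) + 1 := by
  induction l with
  | nil => simp [listCode]
  | cons a l ih =>
    have h1 := ih fun a ha => h a (by simp [ha])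
    have h2 := h a (by simp)
    rw [listCode_cons]
    simp only [List.length_cons, List.length_append]
    linarith

theorem length_tupCode_le {t : List ℕ} {k : ℕ} (h : ∀ v ∈ t, v ≤ k) :
    (tupCode t).length ≤ t.length * (2 * k + 1) := by
  induction t with
  | nil => simp [tupCode]
  | cons v t ih =>
    have h1 := ih fun v hv => h v (by simp [hv])
    have h2 := h v (by simp)
    have h3 : v.size ≤ v := Nat.size_le.2 Nat.lt_two_pow_self
    have h4 := length_binCode v
    rw [tupCode] at h1
    rw [tupCode, List.flatMap_cons, List.length_append, List.length_cons]
    linarith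

/-- A bound on the lengths of codes of structures of size `k` with arities at most `r`. -/
def codeBound (r k : ℕ) : ℕ :=
  k + 1 + (k * (r + 1 + ((k + 1) * (r * (2 * k + 1) + 1) + 1) + 1) + 1)

/-- The tuple of a nullary relation does not contribute to the sum in the size; this case is covered
by the added 1. -/
theorem FinStr.card_rel_le {τ : Vocab} (A : FinStr τ) (i : Fin τ.length) :
    (A.rel i).card ≤ A.size + 1 := by
  rcases Nat.eq_zero_or_pos (τ.get i) with h | h
  · have h1 : (A.rel i).card ≤ 1 := by
      refine (Finset.card_le_univ _).trans ?_
      rw [Fintype.card_fun, Fintype.card_fin, Fintype.card_fin, h, pow_zero]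
    omega
  · have h1 := Finset.single_le_sum (f := fun i => (A.rel i).card * τ.get i)
      (fun _ _ => Nat.zero_le _) (Finset.mem_univ i)
    have h2 : (A.rel i).card ≤ (A.rel i).card * τ.get i := Nat.le_mul_of_pos_right _ h
    have h3 : ∑ i, (A.rel i).card * τ.get i ≤ A.size := Nat.le_add_left _ _
    exact (h2.trans h1).trans (h3.trans (Nat.le_succ _))

/-- The arity bound is essential: an empty relation of huge arity does not add its arity to the
size, but the code lists that arity in unary. -/
theorem FinStr.Encodes.length_le {τ : Vocab} {A : FinStr τ} {u : List Bool} (h : A.Encodes u)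
    {r : ℕ} (hr : ∀ i : Fin τ.length, τ.get i ≤ r) : u.length ≤ codeBound r A.size := by
  obtain ⟨L, hL, rfl⟩ := h
  have hn : A.card ≤ A.size := by unfold FinStr.size; omega
  have hτ : τ.length ≤ A.size := by unfold FinStr.size; omega
  have h1 : ∀ i, ∀ t ∈ L i, (tupleCode t).length ≤ r * (2 * A.size + 1) := fun i t _ => by
    rw [tupleCode_eq]
    refine (length_tupCode_le (k := A.size) fun v hv => ?_).trans ?_
    · obtain ⟨j, rfl⟩ := (List.mem_ofFn' _ _).1 hv
      exact (t j).2.le.trans hn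
    · rw [List.length_ofFn]
      exact Nat.mul_le_mul_right _ (hr i)
  have h2 : ∀ i, (L i).length ≤ A.size + 1 := fun i => by
    rw [← List.toFinset_card_of_nodup (hL i).1]
    have : (L i).toFinset = A.rel i := by
      ext t
      rw [List.mem_toFinset, (hL i).2]
    rw [this]
    exact A.card_rel_le i
  have h3 : ∀ i ∈ List.finRange τ.length, (unaryCode (τ.get i) ++ listCode tupleCode (L i)).length ≤
      r + 1 + ((A.size + 1) * (r * (2 * A.size + 1) + 1) + 1) := fun i _ => by
    have h4 := length_listCode_le (h1 i)
    have h5 := Nat.mul_le_mul_right (r * (2 * A.size + 1) + 1) (h2 i)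
    have h6 := hr i
    rw [List.length_append, unaryCode, List.length_append, List.length_replicate,
      List.length_singleton]
    omega
  have h4 := length_listCode_le h3
  rw [List.length_finRange] at h4
  have h5 := Nat.mul_le_mul_right
    (r + 1 + ((A.size + 1) * (r * (2 * A.size + 1) + 1) + 1) + 1) hτ
  rw [strCode, List.length_append, unaryCode, List.length_append, List.length_replicate,
      List.length_singleton, codeBound]
  omega

/-- A bound for the guessed numbers. -/
def guessBound (r k : ℕ) : ℕ :=
  (2 ^ codeBound r k + codeBound r k + 1) ^ 2 + 2 ^ ((k + 1) * (k + 1)) + 2 ^ (k * (k ^ 2 + 1))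

theorem computable_guessBound (r : ℕ) : Computable (guessBound r) := by
  have add : ∀ {f g : ℕ → ℕ}, Primrec f → Primrec g → Primrec fun k => f k + g k :=
    fun hf hg => Primrec.nat_add.comp hf hg
  have mul : ∀ {f g : ℕ → ℕ}, Primrec f → Primrec g → Primrec fun k => f k * g k :=
    fun hf hg => Primrec.nat_mul.comp hf hg
  have c : ∀ n : ℕ, Primrec fun _ : ℕ => n := Primrec.const
  have v : Primrec fun k : ℕ => k := Primrec.id
  have hb : Primrec fun k => codeBound r k :=
    add (add v (c 1)) (add (mul v (add (add (add (c r) (c 1)) (add (mul (add v (c 1))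
      (add (mul (c r) (add (mul (c 2) v) (c 1))) (c 1))) (c 1))) (c 1))) (c 1))
  exact (add (add (primrec_pow (add (add (primrec_pow (c 2) hb) hb) (c 1)) (c 2))
    (primrec_pow (c 2) (mul (add v (c 1)) (add v (c 1)))))
    (primrec_pow (c 2) (mul v (add (primrec_pow v (c 2)) (c 1))))).to_comp

/-! ### The embedding problem -/

/-- The first structure encoded by `x` is in the class, according to the table `t`. -/
def InTable (x : List Bool) (t m : ℕ) : Prop :=
  ∃ z < m, (z.unpair.1 = strEnd x 0 ∧
    ∀ i < strEnd x 0, (z.unpair.2.testBit i = true ↔ symAt x i = 1)) ∧ t.testBit z = true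

/-- Both structures encoded by `x` have the same vocabulary. -/
def SameVocab (S T : Table) : Prop := S.count = T.count ∧ ∀ i < S.count, S.ar i = T.ar i

theorem LSP.inTable {t m : α → ℕ} (ht : LS t) (hm : LS m) :
    LSP fun a => InTable (inp a) (t a) (m a) := by
  have he : LS fun a : α => strEnd (inp a) 0 := LS.strEnd .zero
  refine LSP.bex (p := fun c : α × ℕ => (c.2.unpair.1 = strEnd (inp c) 0 ∧
    ∀ i < strEnd (inp c) 0, (c.2.unpair.2.testBit i = true ↔ symAt (inp c) i = 1)) ∧
      (t c.1).testBit c.2 = true) hm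
    (((LSP.eq LS.var.unpair_left he.wk).and ?_).and (LSP.testBit ht.wk .var))
  exact LSP.ball (p := fun c : (α × ℕ) × ℕ => c.1.2.unpair.2.testBit c.2 = true ↔
    symAt (inp c) c.2 = 1) he.wk
    ((LSP.testBit LS.var.unpair_right.wk .var).iff (LSP.eq LS.var.symAt (.const 1)))

theorem LSP.sameVocab {S T : α → Table} (hS : LSTable S) (hT : LSTable T) :
    LSP fun a => SameVocab (S a) (T a) :=
  (LSP.eq hS.count hT.count).and (LSP.ball (p := fun c : α × ℕ => (S c.1).ar c.2 = (T c.1).ar c.2)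
    hS.count (LSP.eq (hS.ar _ _ .fst _ .var) (hT.ar _ _ .fst _ .var)))

theorem sameVocab_iff {S T : Table} {τ σ : Vocab} {A : FinStr τ} {B : FinStr σ}
    (hS : S.Presents A) (hT : T.Presents B) : SameVocab S T ↔ τ = σ := by
  constructor
  · rintro ⟨h1, h2⟩
    rw [hS.count_eq] at h2
    rw [hS.count_eq, hT.count_eq] at h1
    refine List.ext_getElem h1 fun i hi hi' => ?_
    have := h2 i hi
    rwa [hS.ar_eq ⟨i, hi⟩, hT.ar_eq ⟨i, hi'⟩] at this
  · rintro rfl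
    refine ⟨hS.count_eq.trans hT.count_eq.symm, fun i hi => ?_⟩
    rw [hS.count_eq] at hi
    exact (hS.ar_eq ⟨i, hi⟩).trans (hT.ar_eq ⟨i, hi⟩).symm

/-- The codes of the members of the class. -/
def IsMemberCode (𝒜 : StrClass) (x : List Bool) : Prop :=
  ∃ (τ : Vocab) (A : FinStr τ), A ∈ 𝒜 τ ∧ A.Encodes x

/-- The bound `hm` is required for members only, where the arities are known to be bounded. The code
of a nonmember may be too long for the table, but then the lookup fails, which is the right answer.
-/
theorem inTable_iff {𝒜 : StrClass} {x : List Bool} (hx : strEnd x 0 ≤ x.length) {m : ℕ}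
    (hm : IsMemberCode 𝒜 (x.take (strEnd x 0)) → ∀ v < 2 ^ strEnd x 0, Nat.pair (strEnd x 0) v < m) :
    InTable x (bitTable (fun z => IsMemberCode 𝒜 (decodeString z)) m) m ↔
      IsMemberCode 𝒜 (x.take (strEnd x 0)) := by
  have key : ∀ v, (∀ i < strEnd x 0, (v.testBit i = true ↔ symAt x i = 1)) →
      decodeString (Nat.pair (strEnd x 0) v) = x.take (strEnd x 0) := fun v hv =>
    decodeString_pair (by simpa using hx) fun i hi => by
      rw [hv i hi, symAt_eq_one, List.getElem?_take_of_lt hi]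
  constructor
  · rintro ⟨z, hz, ⟨h1, h2⟩, h3⟩
    rw [testBit_bitTable _ hz] at h3
    rwa [← key _ h2, ← h1, Nat.pair_unpair]
  · intro h
    obtain ⟨v, hv, hvb⟩ := exists_testBit (strEnd x 0) fun i => symAt x i = 1
    have hz := hm h v hv
    refine ⟨_, hz, ⟨by rw [Nat.unpair_pair], by simpa only [Nat.unpair_pair] using hvb⟩, ?_⟩
    rwa [testBit_bitTable _ hz, key v hvb]

/-- By unique decodability, membership can be tested on the pair of structures read by the parser.
The guess bound majorizes the table indices of codes of members as well as the encoded forests and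
colourings. -/
theorem mem_embProblem_iff {𝒜 : StrClass} {r w : ℕ}
    (hr : ∀ (τ : Vocab), ∀ A ∈ 𝒜 τ, ∀ i : Fin τ.length, τ.get i ≤ r)
    (hw : ∀ (τ : Vocab), ∀ A ∈ 𝒜 τ, treeDepth A.gaifman ≤ w) (x : List Bool) :
    x ∈ embProblem 𝒜 ↔ PairOk x ∧ SameVocab (tableAt x 0) (tableAt x (strEnd x 0)) ∧
      InTable x (bitTable (fun z => IsMemberCode 𝒜 (decodeString z)) (guessBound r (embParam x)))
        (guessBound r (embParam x)) ∧
      HasWitness (tableAt x 0) (tableAt x (strEnd x 0)) (w + 2) (guessBound r (embParam x)) := by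
  have main : ∀ (τ σ : Vocab) (A : FinStr τ) (B : FinStr σ), EncodesPair A B x →
      (InTable x (bitTable (fun z => IsMemberCode 𝒜 (decodeString z)) (guessBound r (embParam x)))
        (guessBound r (embParam x)) ↔ A ∈ 𝒜 τ) := by
    intro τ σ A B hx
    obtain ⟨h1, h2, h3, h4⟩ := hx.reads
    have hk : embParam x = A.size := by
      rw [embParam_eq_ite, if_pos h1, h2.size_eq]
    have hmem : IsMemberCode 𝒜 (x.take (strEnd x 0)) ↔ A ∈ 𝒜 τ := by
      constructor
      · rintro ⟨τ', A', hA', hu⟩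
        have e := (Encodes_inj (u := []) (v := []) h4 hu rfl).1
        cases e
        exact hA'
      · exact fun h => ⟨τ, A, h, h4⟩
    have hle : strEnd x 0 ≤ x.length := by
      obtain ⟨u, v, hu, -, rfl⟩ := hx
      rw [(hu.reads (p := 0) (x := u ++ v) (by simp [OccursAt])).2.1]
      simp
    rw [inTable_iff hle, hmem]
    intro h v hv
    have hlen := h4.length_le (hr τ A (hmem.1 h))
    rw [List.length_take, min_eq_left hle] at hlen
    rw [hk, guessBound]
    have hv' : v < 2 ^ codeBound r A.size :=
      hv.trans_le (Nat.pow_le_pow_right (by norm_num) hlen)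
    have h5 := Nat.pair_lt_max_add_one_sq (strEnd x 0) v
    have h6 : max (strEnd x 0) v + 1 ≤ 2 ^ codeBound r A.size + codeBound r A.size + 1 := by
      omega
    exact h5.trans_le ((Nat.pow_le_pow_left h6 2).trans
      ((Nat.le_add_right _ _).trans (Nat.le_add_right _ _)))
  constructor
  · rintro ⟨τ, A, B, hA, hx, hAB⟩
    obtain ⟨h1, h2, h3, h4⟩ := hx.reads
    have hk : embParam x = A.size := by
      rw [embParam_eq_ite, if_pos h1, h2.size_eq]
    have hn : (tableAt x 0).card ≤ A.size := by
      rw [h2.card_eq]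
      unfold FinStr.size
      omega
    refine ⟨h1, (sameVocab_iff h2 h3).2 rfl, (main _ _ A B hx).2 hA,
      hasWitness_of_embeds h2 h3 (hw τ A hA) ?_ ?_ hAB⟩
    · rw [hk, guessBound]
      have := Nat.pow_le_pow_right (n := 2) (by norm_num)
        (Nat.mul_le_mul (Nat.succ_le_succ hn) (Nat.succ_le_succ hn))
      exact this.trans ((Nat.le_add_left _ _).trans (Nat.le_add_right _ _))
    · rw [hk, guessBound]
      have := Nat.pow_le_pow_right (n := 2) (by norm_num)
        (Nat.mul_le_mul hn (Nat.succ_le_succ (Nat.pow_le_pow_left hn 2)))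
      exact this.trans (Nat.le_add_left _ _)
  · rintro ⟨h1, h2, h3, P, -, g, -, p, -, q, -, h4⟩
    obtain ⟨τ, σ, A, B, hx⟩ := h1.exists_encodes
    obtain ⟨-, h5, h6, -⟩ := hx.reads
    obtain rfl := (sameVocab_iff h5 h6).1 h2
    exact ⟨τ, A, B, (main _ _ A B hx).1 h3, hx, h4.embeds h5 h6⟩

end ParaEmb

theorem theorem3p13 (𝒜 : ParaEmb.StrClass) (hdec : 𝒜.IsDecidable) (har : 𝒜.BoundedArity)
    (htd : 𝒜.BoundedTreeDepth) :
    ParaEmb.InParaL (ParaEmb.embProblem 𝒜) ParaEmb.embParam := by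
  classical
  obtain ⟨r, hr⟩ := har
  obtain ⟨w, hw⟩ := htd
  refine ⟨ParaEmb.logspaceComputable_of_LS ParaEmb.LS.embParam, ?_⟩
  have hm := ParaEmb.computable_guessBound r
  have ht := ParaEmb.computable_bitTable (Q := ParaEmb.IsMemberCode 𝒜) hdec hm
  obtain ⟨g, hg, hgm⟩ := ParaEmb.slackLS_of_computable hm
  obtain ⟨g', hg', hgt⟩ := ParaEmb.slackLS_of_computable ht
  -- The slack pays for computing both the guess bound and the membership table from the parameter.
  let α := {a : ParaEmb.Inp // g (ParaEmb.embParam a.word) + g' (ParaEmb.embParam a.word) ≤ a.slack}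
  have hsize : ∀ a : α, g (ParaEmb.embParam a.1.word) + g' (ParaEmb.embParam a.1.word) ≤
      ParaEmb.Ctx.size a := fun a => a.2.trans (Nat.le_add_left _ _)
  have hm' := hgm α _ ParaEmb.LS.embParam fun a => (Nat.le_add_right _ _).trans (hsize a)
  have ht' := hgt α _ ParaEmb.LS.embParam fun a => (Nat.le_add_left _ _).trans (hsize a)
  have hS : ParaEmb.LSTable fun a : α => ParaEmb.tableAt (ParaEmb.Ctx.inp a) 0 :=
    ParaEmb.LSTable.tableAt .zero
  have hT : ParaEmb.LSTable fun a : α => ParaEmb.tableAt (ParaEmb.Ctx.inp a)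
      (ParaEmb.strEnd (ParaEmb.Ctx.inp a) 0) := ParaEmb.LSTable.tableAt (.strEnd .zero)
  have hF := ParaEmb.LSP.pairOk.and ((ParaEmb.LSP.sameVocab hS hT).and
    ((ParaEmb.LSP.inTable ht' hm').and (ParaEmb.LSP.hasWitness hS hT (w + 2) hm')))
  obtain ⟨M, f, C, h1, h2, h3⟩ := ParaEmb.exists_decider
    (F := fun x => if x ∈ ParaEmb.embProblem 𝒜 then 1 else 0) (ParaEmb.computable_add hg hg')
    (hF.congr fun a => (ParaEmb.mem_embProblem_iff hr hw a.1.word).symm)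
  refine ⟨M, f, C, h1, ?_, h3⟩
  convert h2 using 1
  ext x
  simp
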